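/- **Theorem 3.2 (optimal error bounds for the Strang time-splitting extended Fourier pseudospectral method).** Let $\Omega=(a,b)$ be a bounded interval, $T>0$, $\beta\in\mathbb R$, and let $V:\Omega\to\mathbb R$ be a real potential. Write $H^m_{\rm per}(\Omega)=\{\phi\in H^m(\Omega):\phi^{(k)}(a)=\phi^{(k)}(b),\ 0\le k\le m-1\}$. Let $\psi=\psi(x,t)$ be the solution on $[0,T]$ of the Gross–Pitaevskii equation $$ i\,\partial_t\psi=-\partial_{xx}\psi+V\psi+\beta|\psi|^2\psi,\qquad \psi(\cdot,0)=\psi_0\in C([a,b]), $$ with periodic boundary conditions. For a positive even integer $N$ put $h=(b-a)/N$, $x_j=a+jh$ $(0\le j\le N)$, $\mathcal T_N=\{-N/2,\dots,N/2-1\}$, $\mu_l=2\pi l/(b-a)$. For a grid vector $v=(v_0,\dots,v_N)$ and a function $u\in L^2(\Omega)$ put $$\widetilde v_l=\frac1N\sum_{j=0}^{N-1}v_je^{-i\mu_l(x_j-a)},\quad \widehat u_l=\frac1{b-a}\int_a^bu(x)e^{-i\mu_l(x-a)}\,dx,\quad (I_Nv)(x)=\sum_{l\in\mathcal T_N}\widetilde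 v_l\,e^{i\mu_l(x-a)} .$$ Given a time step $\tau>0$, let $t_n=n\tau$, and define grid vectors $\psi^{\langle n\rangle}$ by $\psi^{\langle 0\rangle}_j=\psi_0(x_j)$ and, for $n\ge0$ and $0\le j\le N$, $$\psi^{(1)}_j=\sum_{l\in\mathcal T_N}e^{-i\frac\tau2\mu_l^2}\,\widetilde{(\psi^{\langle n\rangle})}_l\,e^{i\mu_l(x_j-a)},\quad \psi^{(2)}(x)=e^{-i\tau V(x)}\,I_N\!\left(\psi^{(1)}e^{-i\tau\beta|\psi^{(1)}|^2}\right)(x),\quad \psi^{\langle n+1\rangle}_j=\sum_{l\in\mathcal T_N}e^{-i\frac\tau2\mu_l^2}\,\widehat{(\psi^{(2)})}_l\,e^{i\mu_l(x_j-a)} .$$ Assume that $V\in H^2_{\rm per}(\Omega)$ and $\psi\in C([0,T];H^4_{\rm per}(\Omega))\cap C^1([0,T];H^2(\Omega))\cap C^2([0,T];L^2(\Omega))$. Then there are $h_0>0$ and $C>0$, with $C$ independent of $h$, $\tau$ and $n$, such that whenever $0<h<h_0$ and $0<\tau\le h^2/\pi$, $$\|\psi(\cdot,t_n)-I_N\psi^{\langle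 n\rangle}\|_{L^2}\le C(\tau^2+h^4),\qquad \|\psi(\cdot,t_n)-I_N\psi^{\langle n\rangle}\|_{H^1}\le C(\tau^{3/2}+h^3),\qquad 0\le n\le T/\tau .$$ If in addition $V\in H^3_{\rm per}(\Omega)$ and $\psi\in C([0,T];H^5_{\rm per}(\Omega))\cap C^1([0,T];H^3(\Omega))\cap C^2([0,T];H^1(\Omega))$, then there is $C>0$, independent of $h$, $\tau$ and $n$, such that for the same $h$, $\tau$ and $n$, $$\|\psi(\cdot,t_n)-I_N\psi^{\langle n\rangle}\|_{H^1}\le C(\tau^2+h^4).$$ -/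

import Mathlib

open MeasureTheory Set
open scoped ContDiff ENNReal

noncomputable section

namespace GPE

/-! ### Sobolev spaces on the interval `(a, b)` -/

/-- Lebesgue measure on `Ω = (a, b)`. -/
abbrev vol (a b : ℝ) : Measure ℝ := volume.restrict (Ioo a b)

/-- The complex space `L²(Ω)`. -/
abbrev L2 (a b : ℝ) : Type := Lp ℂ 2 (vol a b)

/-- `(m+1)`-tuples of elements of `L²(Ω)`, with the norm `(∑ₖ ‖gₖ‖²_{L²})^{1/2}`. -/
abbrev Jet (a b : ℝ) (m : ℕ) : Type := PiLp 2 (fun _ : Fin (m + 1) => L2 a b)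

/-- `v` is the `k`-th weak derivative of `u` on `(a, b)`:
`∫ u φ⁽ᵏ⁾ = (-1)ᵏ ∫ v φ` for every test function `φ ∈ C_c^∞(a, b)`. -/
def IsWeakDeriv (a b : ℝ) (k : ℕ) (u v : ℝ → ℂ) : Prop :=
  ∀ φ : ℝ → ℝ, ContDiff ℝ ∞ φ → HasCompactSupport φ → tsupport φ ⊆ Ioo a b →
    ∫ x, u x * ((iteratedDeriv k φ x : ℝ) : ℂ) ∂(vol a b)
      = (-1) ^ k * ∫ x, v x * ((φ x : ℝ) : ℂ) ∂(vol a b)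

theorem integrable_mul_test {a b : ℝ} (u : L2 a b) {φ : ℝ → ℝ} (hφ : ContDiff ℝ ∞ φ)
    (hc : HasCompactSupport φ) (k : ℕ) :
    Integrable (fun x => u x * ((iteratedDeriv k φ x : ℝ) : ℂ)) (vol a b) := by
  have hcont : Continuous (iteratedDeriv k φ) :=
    hφ.continuous_iteratedDeriv k (by exact_mod_cast le_top)
  have hcs : HasCompactSupport (iteratedDeriv k φ) := by
    induction k with
    | zero => simpa using hc
    | succ k ih =>
      rw [iteratedDeriv_succ]
      exact (ih (hφ.continuous_iteratedDeriv k (by exact_mod_cast le_top))).deriv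
  obtain ⟨C, hC⟩ := hcs.exists_bound_of_continuous hcont
  have hu : Integrable (fun x => u x) (vol a b) := (Lp.memLp u).integrable (by norm_num)
  refine hu.mul_bdd (c := C) ?_ ?_
  · exact (Complex.continuous_ofReal.comp hcont).aestronglyMeasurable
  · exact Filter.Eventually.of_forall fun x => by simpa using hC x

theorem IsWeakDeriv.congr {a b : ℝ} {k : ℕ} {u u' v v' : ℝ → ℂ} (h : IsWeakDeriv a b k u v)
    (hu : u' =ᵐ[vol a b] u) (hv : v' =ᵐ[vol a b] v) : IsWeakDeriv a b k u' v' := by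
  intro φ h1 h2 h3
  have e1 : ∫ x, u' x * ((iteratedDeriv k φ x : ℝ) : ℂ) ∂(vol a b)
      = ∫ x, u x * ((iteratedDeriv k φ x : ℝ) : ℂ) ∂(vol a b) :=
    integral_congr_ae (by filter_upwards [hu] with x hx; rw [hx])
  have e2 : ∫ x, v' x * ((φ x : ℝ) : ℂ) ∂(vol a b) = ∫ x, v x * ((φ x : ℝ) : ℂ) ∂(vol a b) :=
    integral_congr_ae (by filter_upwards [hv] with x hx; rw [hx])
  rw [e1, e2]
  exact h φ h1 h2 h3

/-- The Sobolev space `H^m(Ω)`, each `u` being identified with the tuple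
`(u, u', …, u⁽ᵐ⁾)` of its weak derivatives; it carries the norm
`‖u‖_{H^m} = (∑_{k ≤ m} ‖u⁽ᵏ⁾‖²_{L²})^{1/2}`. -/
def H (a b : ℝ) (m : ℕ) : Submodule ℂ (Jet a b m) where
  carrier := {g | ∀ k : Fin (m + 1), IsWeakDeriv a b k (g 0) (g k)}
  zero_mem' := by
    intro k
    have h0 : ((0 : L2 a b) : ℝ → ℂ) =ᵐ[vol a b] fun _ => 0 := Lp.coeFn_zero _ _ _
    refine IsWeakDeriv.congr (u := fun _ => 0) (v := fun _ => 0) ?_ h0 h0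
    intro φ _ _ _
    simp
  add_mem' := by
    intro f g hf hg k
    refine IsWeakDeriv.congr (u := fun x => f 0 x + g 0 x) (v := fun x => f k x + g k x) ?_
      (Lp.coeFn_add _ _) (Lp.coeFn_add _ _)
    intro φ h1 h2 h3
    simp only [add_mul]
    have i0 := integrable_mul_test (f k) h1 h2 0
    have i1 := integrable_mul_test (g k) h1 h2 0
    simp only [iteratedDeriv_zero] at i0 i1
    rw [integral_add (integrable_mul_test (f 0) h1 h2 k) (integrable_mul_test (g 0) h1 h2 k),
      integral_add i0 i1, hf k φ h1 h2 h3, hg k φ h1 h2 h3, mul_add]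
  smul_mem' := by
    intro c f hf k
    refine IsWeakDeriv.congr (u := fun x => c * f 0 x) (v := fun x => c * f k x) ?_
      (Lp.coeFn_smul _ _) (Lp.coeFn_smul _ _)
    intro φ h1 h2 h3
    simp only [mul_assoc]
    rw [integral_const_mul, integral_const_mul, hf k φ h1 h2 h3]
    ring

/-- The periodic Sobolev space `H^m_per(Ω)`: those `u ∈ H^m(Ω)` with
`u⁽ᵏ⁾(a) = u⁽ᵏ⁾(b)` for `0 ≤ k < m`, where `u⁽ᵏ⁾` is evaluated through its representative that is
continuous on `[a, b]`. -/
def HPer (a b : ℝ) (m : ℕ) : Submodule ℂ (Jet a b m) where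
  carrier := {g | g ∈ H a b m ∧ ∀ k : Fin (m + 1), (k : ℕ) < m →
    ∃ w : ℝ → ℂ, ContinuousOn w (Icc a b) ∧ g k =ᵐ[vol a b] w ∧ w a = w b}
  zero_mem' := ⟨zero_mem _, fun _ _ => ⟨0, continuousOn_const, Lp.coeFn_zero _ _ _, rfl⟩⟩
  add_mem' := by
    rintro f g ⟨hf, hf'⟩ ⟨hg, hg'⟩
    refine ⟨add_mem hf hg, fun k hk => ?_⟩
    obtain ⟨w, h1, h2, h3⟩ := hf' k hk
    obtain ⟨z, h4, h5, h6⟩ := hg' k hk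
    exact ⟨w + z, h1.add h4, (Lp.coeFn_add _ _).trans (h2.add h5), by simp [h3, h6]⟩
  smul_mem' := by
    rintro c f ⟨hf, hf'⟩
    refine ⟨Submodule.smul_mem _ c hf, fun k hk => ?_⟩
    obtain ⟨w, h1, h2, h3⟩ := hf' k hk
    exact ⟨c • w, h1.const_smul c, (Lp.coeFn_smul _ _).trans (h2.const_smul c), by simp [h3]⟩

/-- The function `u` belongs to the space `S` (where `S` is `H a b m` or `HPer a b m`). -/
def MemSpace {a b : ℝ} {m : ℕ} (S : Submodule ℂ (Jet a b m)) (u : ℝ → ℂ) : Prop :=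
  ∃ g ∈ S, g 0 =ᵐ[vol a b] u

/-- `ψ ∈ C^k([0, T]; S)`, where `S` is `H a b m` or `HPer a b m` with the `H^m` norm, for a function
`ψ t x` of time and space. -/
def MemC (T : ℝ) (k : ℕ) {a b : ℝ} {m : ℕ} (S : Submodule ℂ (Jet a b m)) (ψ : ℝ → ℝ → ℂ) : Prop :=
  ∃ Ψ : ℝ → S, ContDiffOn ℝ k Ψ (Icc 0 T) ∧
    ∀ t ∈ Icc 0 T, (Ψ t : Jet a b m) 0 =ᵐ[vol a b] ψ t

/-- The norm `‖u‖_{L²(Ω)}` in `[0, ∞]`. -/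
def normL2 (a b : ℝ) (u : ℝ → ℂ) : ℝ≥0∞ := eLpNorm u 2 (vol a b)

/-- The norm `‖u‖_{H¹(Ω)}` in `[0, ∞]`; it is `∞` when `u ∉ H¹(Ω)`. -/
def normH1 (a b : ℝ) (u : ℝ → ℂ) : ℝ≥0∞ :=
  ⨅ (g : H a b 1) (_ : (g : Jet a b 1) 0 =ᵐ[vol a b] u), ‖g‖ₑ

/-! ### The Gross-Pitaevskii equation -/

/-- `ψ` solves `i ∂ₜψ = -∂ₓₓψ + V ψ + β |ψ|² ψ` on `(a, b) × [0, T]` with periodic boundary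
conditions and `ψ(·, 0) = ψ₀` on `[a, b]`; the equation holds in `L²(Ω)` at every time. -/
structure IsSolution (a b T β : ℝ) (V : ℝ → ℝ) (ψ₀ : ℝ → ℂ) (ψ : ℝ → ℝ → ℂ) : Prop where
  initial : ∀ x ∈ Icc a b, ψ 0 x = ψ₀ x
  equation : ∃ (Ψ : ℝ → HPer a b 2) (Ψt : ℝ → L2 a b), ∀ t ∈ Icc 0 T,
    (Ψ t : Jet a b 2) 0 =ᵐ[vol a b] ψ t ∧
    HasDerivWithinAt (fun s => (Ψ s : Jet a b 2) 0) (Ψt t) (Icc 0 T) t ∧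
    ∀ᵐ x ∂(vol a b), Complex.I * Ψt t x =
      -((Ψ t : Jet a b 2) 2 x) + V x * ψ t x + β * (‖ψ t x‖ : ℂ) ^ 2 * ψ t x

/-! ### The Strang time-splitting extended Fourier pseudospectral scheme -/

/-- The index set `𝒯_N = {-N/2, …, N/2 - 1}` (for even `N`). -/
def freq (N : ℕ) : Finset ℤ := Finset.Ico (-((N : ℤ) / 2)) ((N : ℤ) / 2)

/-- The frequencies `μ_l = 2πl/(b - a)`. -/
def μ (a b : ℝ) (l : ℤ) : ℝ := 2 * Real.pi * l / (b - a)

/-- The mesh size `h = (b - a)/N`. -/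
def mesh (a b : ℝ) (N : ℕ) : ℝ := (b - a) / N

/-- The grid points `x_j = a + jh`. -/
def node (a b : ℝ) (N j : ℕ) : ℝ := a + j * mesh a b N

/-- The function `e^{i μ_l (x - a)}`. -/
def mode (a b : ℝ) (l : ℤ) (x : ℝ) : ℂ := Complex.exp (Complex.I * μ a b l * (x - a))

/-- The Fourier coefficient `û_l = (b - a)⁻¹ ∫_a^b u(x) e^{-i μ_l (x - a)} dx`. -/
def coeffHat (a b : ℝ) (u : ℝ → ℂ) (l : ℤ) : ℂ :=
  1 / (b - a) * ∫ x in a..b, u x * Complex.exp (-Complex.I * μ a b l * (x - a))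

/-- The discrete Fourier coefficient `ṽ_l = N⁻¹ ∑_{j < N} v_j e^{-i μ_l (x_j - a)}` of a grid
vector `v = (v_0, …, v_N)`. -/
def coeffTilde (a b : ℝ) {N : ℕ} (v : Fin (N + 1) → ℂ) (l : ℤ) : ℂ :=
  1 / N * ∑ j : Fin N,
    v j.castSucc * Complex.exp (-Complex.I * μ a b l * (node a b N j - a))

/-- The Fourier interpolation operator `I_N`. -/
def interp (a b : ℝ) {N : ℕ} (v : Fin (N + 1) → ℂ) (x : ℝ) : ℂ :=
  ∑ l ∈ freq N, coeffTilde a b v l * mode a b l x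

/-- The first stage of the scheme (half a step of the free flow). -/
def stage1 (a b τ : ℝ) {N : ℕ} (v : Fin (N + 1) → ℂ) : Fin (N + 1) → ℂ := fun j =>
  ∑ l ∈ freq N, Complex.exp (-Complex.I * (τ / 2) * μ a b l ^ 2) * coeffTilde a b v l *
    mode a b l (node a b N j)

/-- The second stage of the scheme, `e^{-iτV} I_N (w e^{-iτβ|w|²})`. -/
def stage2 (a b β : ℝ) (V : ℝ → ℝ) (τ : ℝ) {N : ℕ} (w : Fin (N + 1) → ℂ) : ℝ → ℂ := fun x =>
  Complex.exp (-Complex.I * τ * V x) *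
    interp a b (fun j => w j * Complex.exp (-Complex.I * τ * (β * (‖w j‖ : ℂ) ^ 2))) x

/-- The third stage of the scheme (projection and half a step of the free flow). -/
def stage3 (a b τ : ℝ) (N : ℕ) (u : ℝ → ℂ) : Fin (N + 1) → ℂ := fun j =>
  ∑ l ∈ freq N, Complex.exp (-Complex.I * (τ / 2) * μ a b l ^ 2) * coeffHat a b u l *
    mode a b l (node a b N j)

/-- The grid vector produced by `n` steps of the scheme with `N` grid cells and time step `τ`,
started from the grid values of `ψ₀`. -/
def STeFP (a b β : ℝ) (V : ℝ → ℝ) (ψ₀ : ℝ → ℂ) (N : ℕ) (τ : ℝ) : ℕ → Fin (N + 1) → ℂ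
  | 0 => fun j => ψ₀ (node a b N j)
  | n + 1 => stage3 a b τ N (stage2 a b β V τ (stage1 a b τ (STeFP a b β V ψ₀ N τ n)))

/-- The error function `ψ(·, t_n) - I_N ψⁿ` at `t_n = nτ`. -/
def error (a b β : ℝ) (V : ℝ → ℝ) (ψ₀ : ℝ → ℂ) (ψ : ℝ → ℝ → ℂ) (N : ℕ) (τ : ℝ) (n : ℕ) :
    ℝ → ℂ := fun x =>
  ψ (n * τ) x - interp a b (STeFP a b β V ψ₀ N τ n) x

/-- The admissible discretisations: `N` is a positive even integer, `h = (b - a)/N < h₀`,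
`0 < τ ≤ h²/π`, and `0 ≤ nτ ≤ T`. -/
def Admissible (a b T h₀ : ℝ) (N : ℕ) (τ : ℝ) (n : ℕ) : Prop :=
  0 < N ∧ Even N ∧ mesh a b N < h₀ ∧ 0 < τ ∧ τ ≤ mesh a b N ^ 2 / Real.pi ∧ n * τ ≤ T

end GPE

end

/-! The interval with periodic boundary conditions is a circle of length `L = b - a`. Exact
solution, potential and iterates become continuous functions on it, and `H^s` norms are read off
Fourier coefficients with weights `(1 + |l|)^s`. After interpolation the scheme is a map `strang` on
trigonometric polynomials. Everything is proved in `H^σ` for `σ ≤ 1`: `σ = 0` gives the first part,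
`σ = 1` the second. Since `τ ≤ h²`, each `τ²` is absorbed into `h⁴`.

Local error (`local_error`). In Duhamel's formula the force `f(u) = V u + β|u|²u` is replaced by its
linear interpolant in time, with error `O(τ²)` in `H^σ`; each mode is then integrated exactly
(`exact_step`). In the scheme, the half step of the free flow produces `v + (iτ/2) f(v) + O(h⁴)`,
where `v` is the solution at the midpoint (`half_step`). Its second-order effect cancels the
quadratic term in the expansion of the exponential (`force_perturb`). Interpolation acts only on the
nonlinear increment, which is `O(τ)` in `H^{4+σ}`, so aliasing costs `O(τ h⁴)`. What remains, up to
`O(τ h⁴)`, is an explicit Fourier multiplier, the `defect`: the error of the midpoint rule for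
`e^{iκ(r-τ)}`, `κ = μ_l²`.

Recovering the order. Since the force has only `2 + σ` derivatives, the defect is merely `O(τ²)` per
step, and adding such terms up would lose one order in `τ`. But the defect is `(e^{-iκτ} - 1)` times
a multiplier `corr`, and `e^{-iκτ}` is the free flow over a full step. Hence it telescopes: the
error plus `corr f(u(t_n))` obeys a recursion with sources of size `τ h⁴` only (`defect_eq`,
`modified_error_step`). The step restriction gives `κτ ≤ π` on the resolved frequencies, so
`|e^{-iκτ} - 1| ≥ 2κτ/π`, the division is harmless and `corr f` is `O(τ²)`.

Stability (`stability`). Two runs differ after one step by the free flow of their difference plus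
`O(τ)` times it, as long as both stay bounded in `H¹`. For `σ = 0` interpolation must be controlled
in `L²`; this works on products of an `H¹` function with a trigonometric polynomial whose
frequencies are distinct modulo `N` (`Bd.interpC_fourier_mul`). The `H¹` bound is bootstrapped from
the `L²` estimate by the inverse inequality (`strangSeq_bounded`), which also gives the `h³` bound
in `H¹` under the weaker regularity.

The transfer to the interval rests on the fact that a weak derivative multiplies the Fourier
coefficients by `iμ_l` when the boundary values match (`coeffHat_of_isWeakDeriv`). -/

noncomputable section

set_option linter.unusedSectionVars false

namespace PeriodicSobolev

open AddCircle Filter GPE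
open scoped Topology ComplexConjugate

/-! ### Fourier coefficients of continuous functions on the circle. -/

section Coefficients

/-- Continuous functions on the circle of length `L`. -/
abbrev PerC (L : ℝ) : Type := C(AddCircle L, ℂ)

variable {L : ℝ} [hL : Fact (0 < L)]

theorem integrable_haar (u : PerC L) : Integrable u (haarAddCircle (T := L)) :=
  u.continuous.integrable_of_hasCompactSupport (HasCompactSupport.of_compactSpace _)

theorem norm_fourierCoeff_le (l : ℤ) (u : PerC L) : ‖fourierCoeff u l‖ ≤ ‖u‖ := by
  refine (norm_integral_le_of_norm_le_const (μ := haarAddCircle (T := L)) (C := ‖u‖)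
    (Eventually.of_forall fun x => ?_)).trans (by simp)
  rw [norm_smul, fourier_apply, Circle.norm_coe, one_mul]
  exact u.norm_coe_le_norm x

/-- The `l`-th Fourier coefficient as a continuous linear functional. -/
def coeff (l : ℤ) : PerC L →L[ℂ] ℂ :=
  LinearMap.mkContinuous
    { toFun := fun u => fourierCoeff u l
      map_add' := fun u v => by
        have h := fourierCoeff.add (integrable_haar u) (integrable_haar v)
        rw [ContinuousMap.coe_add, h, Pi.add_apply]
      map_smul' := fun c u => by
        rw [ContinuousMap.coe_smul, fourierCoeff.const_smul]; rfl } 1 fun u => by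
    rw [one_mul]; exact norm_fourierCoeff_le l u

theorem coeff_apply (l : ℤ) (u : PerC L) : coeff l u = fourierCoeff u l := rfl

theorem coeff_fourier (l k : ℤ) : coeff l (fourier k : PerC L) = if l = k then 1 else 0 := by
  rw [coeff_apply, fourierCoeff_fourier, Pi.single_apply]

theorem coeff_fourier_mul (l k : ℤ) (v : PerC L) :
    coeff l (fourier k * v) = coeff (l - k) v := by
  rw [coeff_apply, coeff_apply, fourierCoeff, fourierCoeff]
  congr 1
  ext x
  rw [ContinuousMap.mul_apply, smul_eq_mul, smul_eq_mul, ← mul_assoc, ← fourier_add]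
  congr 3
  ring

theorem coeff_star (l : ℤ) (u : PerC L) : coeff l (star u) = conj (coeff (-l) u) := by
  rw [coeff_apply, coeff_apply, fourierCoeff, fourierCoeff, ← integral_conj]
  congr 1
  ext x
  simp only [smul_eq_mul, map_mul, ← fourier_neg, neg_neg, ContinuousMap.star_apply,
    RCLike.star_def]

theorem fourier_mul_fourier (k l : ℤ) : (fourier k * fourier l : PerC L) = fourier (k + l) := by
  ext x
  rw [ContinuousMap.mul_apply, fourier_add]

/-- A function with vanishing coefficients has a trivially summable Fourier series, which therefore
converges to it. Identities between multipliers are checked mode by mode through this. -/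
theorem coeff_ext {u v : PerC L} (h : ∀ l, coeff l u = coeff l v) : u = v := by
  have h0 : ∀ l, coeff l (u - v) = 0 := fun l => by rw [map_sub, h, sub_self]
  have hs : Summable (fourierCoeff (u - v)) := by
    have : fourierCoeff (u - v) = fun _ => 0 := funext h0
    rw [this]; exact summable_zero
  have h1 := hasSum_fourier_series_of_summable (f := u - v) hs
  have h2 : (fun i => fourierCoeff (u - v) i • (fourier i : PerC L)) = fun _ => 0 := by
    funext i
    have : fourierCoeff (u - v) i = 0 := h0 i
    rw [this, zero_smul]
  have h1 : HasSum (fun i => fourierCoeff (u - v : PerC L) i • (fourier i : PerC L)) (u - v) := h1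
  rw [h2] at h1
  exact sub_eq_zero.1 (h1.unique hasSum_zero)

end Coefficients

/-! ### Sobolev weights. -/

section Weights

/-- The Sobolev weight `1 + |l|`. -/
def wt (l : ℤ) : ℝ := 1 + |(l : ℝ)|

theorem one_le_wt (l : ℤ) : 1 ≤ wt l := by unfold wt; linarith [abs_nonneg (l : ℝ)]

theorem wt_pos (l : ℤ) : 0 < wt l := lt_of_lt_of_le one_pos (one_le_wt l)

theorem wt_neg (l : ℤ) : wt (-l) = wt l := by simp [wt]

theorem wt_le_add (l k : ℤ) : wt l ≤ wt k + wt (l - k) := by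
  unfold wt
  have : (l : ℝ) = k + ((l - k : ℤ) : ℝ) := by push_cast; ring
  have h := abs_add_le (k : ℝ) ((l - k : ℤ) : ℝ)
  rw [← this] at h
  linarith

theorem wt_pow_le (s : ℕ) (l k : ℤ) : wt l ^ s ≤ 2 ^ s * (wt k ^ s + wt (l - k) ^ s) := by
  have h1 : wt l ^ s ≤ (wt k + wt (l - k)) ^ s :=
    pow_le_pow_left₀ (wt_pos l).le (wt_le_add l k) s
  have h2 := add_pow_le (wt_pos k).le (wt_pos (l - k)).le s
  have h3 : (2 : ℝ) ^ (s - 1) ≤ 2 ^ s := pow_le_pow_right₀ (by norm_num) (Nat.sub_le s 1)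
  have h4 : 0 ≤ wt k ^ s + wt (l - k) ^ s :=
    add_nonneg (pow_nonneg (wt_pos k).le s) (pow_nonneg (wt_pos (l - k)).le s)
  exact h1.trans (h2.trans (mul_le_mul_of_nonneg_right h3 h4))

theorem summable_inv_wt_sq : Summable fun l : ℤ => ((wt l) ^ 2)⁻¹ := by
  have h : Summable fun l : ℤ => 1 / |(l : ℝ)| ^ 2 := by
    have := Real.summable_one_div_int_pow (p := 2)
    simpa using this.2 one_lt_two
  -- At `l = 0` the comparison series takes the value `1 / 0 = 0`, so the missing term is added by
  -- hand.
  have h' : Summable fun l : ℤ => 1 / |(l : ℝ)| ^ 2 + if l = 0 then (1 : ℝ) else 0 :=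
    h.add (summable_of_ne_finset_zero (s := {0}) (by intro b hb; simp at hb; simp [hb]))
  refine Summable.of_nonneg_of_le (fun l => by have := wt_pos l; positivity) (fun l => ?_) h'
  by_cases hl : l = 0
  · simp [hl, wt]
  · have hp : 0 < |(l : ℝ)| := abs_pos.2 (by exact_mod_cast hl)
    simp only [hl, if_false, add_zero, one_div]
    apply inv_anti₀ (by positivity)
    apply pow_le_pow_left₀ hp.le
    unfold wt; linarith

/-- The constant `∑ₗ (1 + |l|)⁻²`. -/
def wtSum : ℝ := ∑' l : ℤ, ((wt l) ^ 2)⁻¹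

theorem sum_inv_wt_sq_le (F : Finset ℤ) : ∑ l ∈ F, ((wt l) ^ 2)⁻¹ ≤ wtSum :=
  summable_inv_wt_sq.sum_le_tsum F (fun l _ => by have := wt_pos l; positivity)

theorem wtSum_nonneg : 0 ≤ wtSum := by simpa using sum_inv_wt_sq_le ∅

end Weights

/-! ### Sobolev bounds in terms of finite weighted coefficient sums. -/

section Bounds

variable {L : ℝ} [hL : Fact (0 < L)]

/-- The weighted Fourier coefficients of `u` with frequencies in `F`. -/
def wvec (F : Finset ℤ) (s : ℕ) : PerC L →ₗ[ℂ] EuclideanSpace ℂ F where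
  toFun u := WithLp.toLp 2 fun l => ((wt l ^ s : ℝ) : ℂ) * coeff (l : ℤ) u
  map_add' u v := by ext l; simp [mul_add]
  map_smul' c u := by ext l; simp [mul_left_comm]

theorem wvec_apply (F : Finset ℤ) (s : ℕ) (u : PerC L) (l : F) :
    wvec F s u l = ((wt l ^ s : ℝ) : ℂ) * coeff (l : ℤ) u := rfl

theorem norm_wvec_sq (F : Finset ℤ) (s : ℕ) (u : PerC L) :
    ‖wvec F s u‖ ^ 2 = ∑ l ∈ F, (wt l ^ s * ‖coeff l u‖) ^ 2 := by
  rw [EuclideanSpace.norm_sq_eq, ← Finset.sum_coe_sort F]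
  refine Finset.sum_congr rfl fun l _ => ?_
  rw [wvec_apply, norm_mul, Complex.norm_real, Real.norm_of_nonneg (pow_nonneg (wt_pos _).le s)]

/-- `Bd s u M`: the `H^s` norm `(∑ₗ (1 + |l|)^{2s} |û_l|²)^{1/2}` of `u` is at most `M`. -/
def Bd (s : ℕ) (u : PerC L) (M : ℝ) : Prop := 0 ≤ M ∧ ∀ F : Finset ℤ, ‖wvec F s u‖ ≤ M

theorem bd_iff {s : ℕ} {u : PerC L} {M : ℝ} :
    Bd s u M ↔ 0 ≤ M ∧ ∀ F : Finset ℤ, ∑ l ∈ F, (wt l ^ s * ‖coeff l u‖) ^ 2 ≤ M ^ 2 := by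
  refine and_congr_right fun hM => forall_congr' fun F => ?_
  rw [← norm_wvec_sq, sq_le_sq₀ (norm_nonneg _) hM]

theorem Bd.mono {s : ℕ} {u : PerC L} {M M' : ℝ} (h : Bd s u M) (hM : M ≤ M') : Bd s u M' :=
  ⟨h.1.trans hM, fun F => (h.2 F).trans hM⟩

theorem bd_zero (s : ℕ) : Bd s (0 : PerC L) 0 := ⟨le_rfl, fun F => by simp⟩

theorem Bd.add {s : ℕ} {u v : PerC L} {M M' : ℝ} (h : Bd s u M) (h' : Bd s v M') :
    Bd s (u + v) (M + M') :=
  ⟨add_nonneg h.1 h'.1, fun F => by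
    rw [map_add]; exact (norm_add_le _ _).trans (add_le_add (h.2 F) (h'.2 F))⟩

theorem Bd.smul {s : ℕ} {u : PerC L} {M : ℝ} (h : Bd s u M) (c : ℂ) :
    Bd s (c • u) (‖c‖ * M) :=
  ⟨mul_nonneg (norm_nonneg _) h.1, fun F => by
    rw [map_smul, norm_smul]; exact mul_le_mul_of_nonneg_left (h.2 F) (norm_nonneg _)⟩

theorem Bd.neg {s : ℕ} {u : PerC L} {M : ℝ} (h : Bd s u M) : Bd s (-u) M :=
  ⟨h.1, fun F => by rw [map_neg, norm_neg]; exact h.2 F⟩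

theorem Bd.sub {s : ℕ} {u v : PerC L} {M M' : ℝ} (h : Bd s u M) (h' : Bd s v M') :
    Bd s (u - v) (M + M') := by
  rw [sub_eq_add_neg]; exact h.add h'.neg

theorem Bd.sum {ι : Type*} {s : ℕ} (G : Finset ι) {u : ι → PerC L} {M : ι → ℝ}
    (h : ∀ i ∈ G, Bd s (u i) (M i)) : Bd s (∑ i ∈ G, u i) (∑ i ∈ G, M i) := by
  classical
  induction G using Finset.induction_on with
  | empty => simpa using bd_zero s
  | insert a G ha ih =>
    rw [Finset.sum_insert ha, Finset.sum_insert ha]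
    exact (h a (Finset.mem_insert_self a G)).add
      (ih fun i hi => h i (Finset.mem_insert_of_mem hi))

/-- Comparison of coefficients, possibly with a loss of derivatives. -/
theorem Bd.of_coeff_le {s s' : ℕ} {u v : PerC L} {M c : ℝ} (hc : 0 ≤ c) (h : Bd s u M)
    (hv : ∀ l, wt l ^ s' * ‖coeff l v‖ ≤ c * (wt l ^ s * ‖coeff l u‖)) : Bd s' v (c * M) := by
  rw [bd_iff] at h ⊢
  refine ⟨mul_nonneg hc h.1, fun F => ?_⟩
  calc ∑ l ∈ F, (wt l ^ s' * ‖coeff l v‖) ^ 2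
      ≤ ∑ l ∈ F, (c * (wt l ^ s * ‖coeff l u‖)) ^ 2 :=
        Finset.sum_le_sum fun l _ => pow_le_pow_left₀
          (mul_nonneg (pow_nonneg (wt_pos l).le _) (norm_nonneg _)) (hv l) 2
    _ = c ^ 2 * ∑ l ∈ F, (wt l ^ s * ‖coeff l u‖) ^ 2 := by
        rw [Finset.mul_sum]; exact Finset.sum_congr rfl fun l _ => by ring
    _ ≤ (c * M) ^ 2 := by
        rw [mul_pow]; exact mul_le_mul_of_nonneg_left (h.2 F) (sq_nonneg c)

theorem Bd.lower {s s' : ℕ} {u : PerC L} {M : ℝ} (h : Bd s u M) (hs : s' ≤ s) : Bd s' u M := by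
  have := h.of_coeff_le (s' := s') (v := u) zero_le_one fun l => by
    rw [one_mul]
    exact mul_le_mul_of_nonneg_right (pow_le_pow_right₀ (one_le_wt l) hs) (norm_nonneg _)
  simpa using this

theorem Bd.star {s : ℕ} {u : PerC L} {M : ℝ} (h : Bd s u M) : Bd s (star u) M := by
  rw [bd_iff] at h ⊢
  refine ⟨h.1, fun F => ?_⟩
  have := h.2 (F.map (Equiv.neg ℤ).toEmbedding)
  rw [Finset.sum_map] at this
  refine le_trans (le_of_eq (Finset.sum_congr rfl fun l _ => ?_)) this
  simp [coeff_star, wt_neg]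

/-- Finitely many coefficients depend continuously on the function in the uniform norm, so balls of
`H^s` are closed under uniform limits. This reduces infinite series to finite sums. -/
theorem Bd.of_tendsto {ι : Type*} {f : Filter ι} [f.NeBot] {s : ℕ} {u : ι → PerC L} {v : PerC L}
    {M : ℝ} (hv : Tendsto u f (𝓝 v)) (h : ∀ᶠ i in f, Bd s (u i) M) : Bd s v M := by
  obtain ⟨i, hi⟩ := h.exists
  rw [bd_iff]
  refine ⟨hi.1, fun F => ?_⟩
  refine le_of_tendsto (x := f) (b := M ^ 2)
    (f := fun i => ∑ l ∈ F, (wt l ^ s * ‖coeff l (u i)‖) ^ 2) ?_ ?_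
  · refine tendsto_finsetSum _ fun l _ => ?_
    exact ((((coeff l).continuous.tendsto v).comp hv).norm.const_mul _).pow 2
  · filter_upwards [h] with i hi
    exact (bd_iff.1 hi).2 F

/-- Multiplication by an exponential only shifts the coefficients. -/
theorem bd_fourier_mul_zero {u : PerC L} {M : ℝ} (h : Bd 0 u M) (k : ℤ) :
    Bd 0 (fourier k * u) M := by
  rw [bd_iff] at h ⊢
  refine ⟨h.1, fun F => ?_⟩
  have := h.2 (F.map (Equiv.subRight k).toEmbedding)
  rw [Finset.sum_map] at this
  refine le_trans (le_of_eq (Finset.sum_congr rfl fun l _ => ?_)) this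
  simp [coeff_fourier_mul]

/-- Cauchy–Schwarz against `(1 + |l|)⁻¹`, which is square summable: in one dimension `H¹` functions
have absolutely convergent Fourier series. -/
theorem Bd.sum_norm_coeff_le {u : PerC L} {M : ℝ} (h : Bd 1 u M) (F : Finset ℤ) :
    ∑ l ∈ F, ‖coeff l u‖ ≤ √wtSum * M := by
  have h1 := Finset.sum_mul_sq_le_sq_mul_sq F (fun l => (wt l)⁻¹) fun l => wt l * ‖coeff l u‖
  have h2 : ∑ l ∈ F, (wt l)⁻¹ * (wt l * ‖coeff l u‖) = ∑ l ∈ F, ‖coeff l u‖ :=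
    Finset.sum_congr rfl fun l _ => by rw [inv_mul_cancel_left₀ (wt_pos l).ne']
  rw [h2] at h1
  have h3 : ∑ l ∈ F, ((wt l)⁻¹) ^ 2 ≤ wtSum := by
    simpa only [inv_pow] using sum_inv_wt_sq_le F
  have h4 : ∑ l ∈ F, (wt l * ‖coeff l u‖) ^ 2 ≤ M ^ 2 := by simpa using (bd_iff.1 h).2 F
  have h5 : (∑ l ∈ F, ‖coeff l u‖) ^ 2 ≤ (√wtSum * M) ^ 2 := by
    rw [mul_pow, Real.sq_sqrt wtSum_nonneg]
    exact h1.trans (mul_le_mul h3 h4 (Finset.sum_nonneg fun _ _ => sq_nonneg _) wtSum_nonneg)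
  exact (sq_le_sq₀ (Finset.sum_nonneg fun _ _ => norm_nonneg _)
    (mul_nonneg (Real.sqrt_nonneg _) h.1)).1 h5

theorem Bd.summable {u : PerC L} {M : ℝ} (h : Bd 1 u M) : Summable fun l => ‖coeff l u‖ :=
  summable_of_sum_le (fun _ => norm_nonneg _) h.sum_norm_coeff_le

theorem Bd.hasSum {u : PerC L} {M : ℝ} (h : Bd 1 u M) :
    HasSum (fun l => coeff l u • (fourier l : PerC L)) u :=
  hasSum_fourier_series_of_summable h.summable.of_norm

end Bounds

/-! ### Products and exponentials in Sobolev spaces. -/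

section Products

variable {L : ℝ} [hL : Fact (0 < L)]

/-- The `H¹` factor is expanded in its absolutely convergent Fourier series, and each exponential
preserves the `L²` norm of the other factor. -/
theorem Bd.mul_zero_of_one {u v : PerC L} {M M' : ℝ} (h : Bd 1 u M) (h' : Bd 0 v M') :
    Bd 0 (u * v) (√wtSum * M * M') := by
  refine Bd.of_tendsto (h.hasSum.mul_right v) (Eventually.of_forall fun G => ?_)
  have := Bd.sum G (u := fun l => coeff l u • (fourier l : PerC L) * v)
    (M := fun l => ‖coeff l u‖ * M') fun l _ => by
      rw [smul_mul_assoc]; exact (bd_fourier_mul_zero h' l).smul _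
  refine this.mono ?_
  rw [← Finset.sum_mul]
  exact mul_le_mul_of_nonneg_right (h.sum_norm_coeff_le G) h'.1

/-- Young's inequality for finite sums. -/
theorem sum_conv_sq_le {a b : ℤ → ℝ} {A B : ℝ} (hb : ∀ l, 0 ≤ b l) (hB : 0 ≤ B)
    (h1 : ∀ F : Finset ℤ, ∑ l ∈ F, a l ^ 2 ≤ A ^ 2) (h2 : ∀ F : Finset ℤ, ∑ l ∈ F, b l ≤ B)
    (F G : Finset ℤ) : ∑ l ∈ F, (∑ k ∈ G, a k * b (l - k)) ^ 2 ≤ (B * A) ^ 2 := by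
  have hsum : ∀ l, ∑ k ∈ G, b (l - k) ≤ B := fun l => by
    have := h2 (G.map (Equiv.subLeft l).toEmbedding)
    simpa [Finset.sum_map] using this
  have hsum' : ∀ k, ∑ l ∈ F, b (l - k) ≤ B := fun k => by
    have := h2 (F.map (Equiv.subRight k).toEmbedding)
    simpa [Finset.sum_map] using this
  have hcs : ∀ l, (∑ k ∈ G, a k * b (l - k)) ^ 2 ≤ B * ∑ k ∈ G, a k ^ 2 * b (l - k) := fun l => by
    have h := Finset.sum_sq_le_sum_mul_sum_of_sq_le_mul G (r := fun k => a k * b (l - k))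
      (f := fun k => b (l - k)) (g := fun k => a k ^ 2 * b (l - k)) (fun k _ => hb _)
      (fun k _ => mul_nonneg (sq_nonneg _) (hb _)) (fun k _ => le_of_eq (by ring))
    exact h.trans (mul_le_mul_of_nonneg_right (hsum l)
      (Finset.sum_nonneg fun k _ => mul_nonneg (sq_nonneg _) (hb _)))
  calc ∑ l ∈ F, (∑ k ∈ G, a k * b (l - k)) ^ 2
      ≤ ∑ l ∈ F, B * ∑ k ∈ G, a k ^ 2 * b (l - k) := Finset.sum_le_sum fun l _ => hcs l
    _ = B * ∑ k ∈ G, a k ^ 2 * ∑ l ∈ F, b (l - k) := by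
        rw [← Finset.mul_sum, Finset.sum_comm]; simp_rw [Finset.mul_sum]
    _ ≤ B * ∑ k ∈ G, a k ^ 2 * B := by
        gcongr with k hk
        exact hsum' k
    _ = B * (B * ∑ k ∈ G, a k ^ 2) := by rw [← Finset.sum_mul]; ring
    _ ≤ B * (B * A ^ 2) := by gcongr; exact h1 G
    _ = (B * A) ^ 2 := by ring

/-- The same convolution inequality with the summable and the square summable sequence exchanged;
both versions are needed, since the weight may fall on either factor of a product. -/
theorem sum_conv_sq_le' {a b : ℤ → ℝ} {A B : ℝ} (ha : ∀ l, 0 ≤ a l) (hA : 0 ≤ A)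
    (h1 : ∀ F : Finset ℤ, ∑ l ∈ F, a l ≤ A) (h2 : ∀ F : Finset ℤ, ∑ l ∈ F, b l ^ 2 ≤ B ^ 2)
    (F G : Finset ℤ) : ∑ l ∈ F, (∑ k ∈ G, a k * b (l - k)) ^ 2 ≤ (A * B) ^ 2 := by
  have hcs : ∀ l, (∑ k ∈ G, a k * b (l - k)) ^ 2 ≤ A * ∑ k ∈ G, a k * b (l - k) ^ 2 := fun l => by
    have h := Finset.sum_sq_le_sum_mul_sum_of_sq_le_mul G (r := fun k => a k * b (l - k))
      (f := fun k => a k) (g := fun k => a k * b (l - k) ^ 2) (fun k _ => ha _)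
      (fun k _ => mul_nonneg (ha _) (sq_nonneg _)) (fun k _ => le_of_eq (by ring))
    exact h.trans (mul_le_mul_of_nonneg_right (h1 G)
      (Finset.sum_nonneg fun k _ => mul_nonneg (ha _) (sq_nonneg _)))
  have hsum' : ∀ k, ∑ l ∈ F, b (l - k) ^ 2 ≤ B ^ 2 := fun k => by
    have := h2 (F.map (Equiv.subRight k).toEmbedding)
    simpa [Finset.sum_map] using this
  calc ∑ l ∈ F, (∑ k ∈ G, a k * b (l - k)) ^ 2
      ≤ ∑ l ∈ F, A * ∑ k ∈ G, a k * b (l - k) ^ 2 := Finset.sum_le_sum fun l _ => hcs l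
    _ = A * ∑ k ∈ G, a k * ∑ l ∈ F, b (l - k) ^ 2 := by
        rw [← Finset.mul_sum, Finset.sum_comm]; simp_rw [Finset.mul_sum]
    _ ≤ A * ∑ k ∈ G, a k * B ^ 2 := by
        gcongr with k hk
        · exact ha k
        · exact hsum' k
    _ = A * ((∑ k ∈ G, a k) * B ^ 2) := by rw [← Finset.sum_mul]
    _ ≤ A * (A * B ^ 2) := by gcongr; exact h1 G
    _ = (A * B) ^ 2 := by ring

/-- The constant in the algebra property of `H^s`. -/
def mulConst (s : ℕ) : ℝ := 2 ^ s * (2 * √wtSum)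

theorem mulConst_nonneg (s : ℕ) : 0 ≤ mulConst s := by unfold mulConst; positivity

/-- `H^s` is an algebra for `s ≥ 1`. -/
theorem Bd.mul {s : ℕ} (hs : 1 ≤ s) {u v : PerC L} {M M' : ℝ} (h : Bd s u M) (h' : Bd s v M') :
    Bd s (u * v) (mulConst s * (M * M')) := by
  have hu1 := h.lower hs
  have hv1 := h'.lower hs
  have hM := h.1
  have hM' := h'.1
  have hW : 0 ≤ √wtSum := Real.sqrt_nonneg _
  refine Bd.of_tendsto (hu1.hasSum.mul_right v) (Eventually.of_forall fun G => ?_)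
  rw [bd_iff]
  refine ⟨mul_nonneg (mulConst_nonneg s) (mul_nonneg h.1 h'.1), fun F => ?_⟩
  rw [← Finset.sum_mul]
  -- The weight of the output frequency is shared out to the factors: it falls on `u` in `X` and on
  -- `v` in `Y`. Each is a convolution of a square summable with a summable sequence.
  set X : ℤ → ℝ := fun l => ∑ k ∈ G, (wt k ^ s * ‖coeff k u‖) * ‖coeff (l - k) v‖
  set Y : ℤ → ℝ := fun l => ∑ k ∈ G, ‖coeff k u‖ * (wt (l - k) ^ s * ‖coeff (l - k) v‖)
  have hw : ∀ l : ℤ, 0 ≤ wt l ^ s := fun l => pow_nonneg (wt_pos l).le s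
  have hXY : ∀ l, wt l ^ s * ‖coeff l ((∑ k ∈ G, coeff k u • (fourier k : PerC L)) * v)‖
      ≤ 2 ^ s * (X l + Y l) := fun l => by
    have e : coeff l ((∑ k ∈ G, coeff k u • (fourier k : PerC L)) * v)
        = ∑ k ∈ G, coeff k u * coeff (l - k) v := by
      rw [Finset.sum_mul, map_sum]
      exact Finset.sum_congr rfl fun k _ => by
        rw [smul_mul_assoc, map_smul, coeff_fourier_mul, smul_eq_mul]
    rw [e]
    calc wt l ^ s * ‖∑ k ∈ G, coeff k u * coeff (l - k) v‖
        ≤ wt l ^ s * ∑ k ∈ G, ‖coeff k u‖ * ‖coeff (l - k) v‖ := by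
          refine mul_le_mul_of_nonneg_left ((norm_sum_le _ _).trans ?_) (hw l)
          exact Finset.sum_le_sum fun k _ => (norm_mul _ _).le
      _ = ∑ k ∈ G, wt l ^ s * (‖coeff k u‖ * ‖coeff (l - k) v‖) := Finset.mul_sum _ _ _
      _ ≤ ∑ k ∈ G, 2 ^ s * (wt k ^ s + wt (l - k) ^ s) * (‖coeff k u‖ * ‖coeff (l - k) v‖) :=
          Finset.sum_le_sum fun k _ => mul_le_mul_of_nonneg_right (wt_pow_le s l k)
            (mul_nonneg (norm_nonneg _) (norm_nonneg _))
      _ = 2 ^ s * (X l + Y l) := by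
          simp only [X, Y, ← Finset.sum_add_distrib, Finset.mul_sum]
          exact Finset.sum_congr rfl fun k _ => by ring
  have hX : ∑ l ∈ F, X l ^ 2 ≤ (√wtSum * M' * M) ^ 2 :=
    sum_conv_sq_le (a := fun k => wt k ^ s * ‖coeff k u‖) (b := fun k => ‖coeff k v‖)
      (fun _ => norm_nonneg _) (mul_nonneg hW hM') (bd_iff.1 h).2 hv1.sum_norm_coeff_le F G
  have hY : ∑ l ∈ F, Y l ^ 2 ≤ (√wtSum * M * M') ^ 2 :=
    sum_conv_sq_le' (a := fun k => ‖coeff k u‖) (b := fun k => wt k ^ s * ‖coeff k v‖)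
      (fun _ => norm_nonneg _) (mul_nonneg hW hM) hu1.sum_norm_coeff_le (bd_iff.1 h').2 F G
  calc ∑ l ∈ F, (wt l ^ s * ‖coeff l ((∑ k ∈ G, coeff k u • (fourier k : PerC L)) * v)‖) ^ 2
      ≤ ∑ l ∈ F, (2 ^ s * (X l + Y l)) ^ 2 := Finset.sum_le_sum fun l _ =>
        pow_le_pow_left₀ (mul_nonneg (hw l) (norm_nonneg _)) (hXY l) 2
    _ ≤ ∑ l ∈ F, (2 ^ s) ^ 2 * (2 * (X l ^ 2 + Y l ^ 2)) := Finset.sum_le_sum fun l _ => by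
        rw [mul_pow]
        exact mul_le_mul_of_nonneg_left add_sq_le (by positivity)
    _ = (2 ^ s) ^ 2 * (2 * (∑ l ∈ F, X l ^ 2 + ∑ l ∈ F, Y l ^ 2)) := by
        rw [← Finset.mul_sum, ← Finset.mul_sum, Finset.sum_add_distrib]
    _ ≤ (2 ^ s) ^ 2 * (2 * ((√wtSum * M' * M) ^ 2 + (√wtSum * M * M') ^ 2)) := by gcongr
    _ = (mulConst s * (M * M')) ^ 2 := by unfold mulConst; ring

/-- Lets the cases `s = 0` and `s = 1` be run through the same argument: only the multiplier has to
lie in `H¹`. -/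
theorem Bd.mul_low {s : ℕ} (hs : s ≤ 1) {u v : PerC L} {M M' : ℝ} (h : Bd 1 u M)
    (h' : Bd s v M') : Bd s (u * v) (mulConst 1 * (M * M')) := by
  obtain rfl | rfl : s = 0 ∨ s = 1 := by omega
  · refine (h.mul_zero_of_one h').mono ?_
    have : 0 ≤ √wtSum * (M * M') :=
      mul_nonneg (Real.sqrt_nonneg _) (mul_nonneg h.1 h'.1)
    unfold mulConst
    linarith
  · exact h.mul le_rfl h'

theorem bd_one (s : ℕ) : Bd s (1 : PerC L) 1 := by
  have e : (1 : PerC L) = fourier 0 := by ext x; simp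
  rw [e, bd_iff]
  refine ⟨zero_le_one, fun F => ?_⟩
  have : ∀ l ∈ F, (wt l ^ s * ‖coeff l (fourier 0 : PerC L)‖) ^ 2 = if l = 0 then 1 else 0 := by
    intro l _
    rw [coeff_fourier]
    split_ifs with h <;> simp [h, wt]
  rw [Finset.sum_congr rfl this, Finset.sum_ite_eq']
  split_ifs <;> norm_num

theorem Bd.pow {s : ℕ} (hs : 1 ≤ s) {u : PerC L} {M : ℝ} (h : Bd s u M) (k : ℕ) :
    Bd s (u ^ k) ((mulConst s * M) ^ k) := by
  induction k with
  | zero => simpa using bd_one s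
  | succ k ih =>
    rw [pow_succ]
    refine (ih.mul hs h).mono (le_of_eq ?_)
    ring

/-- The entire function `∑ₖ zᵏ / (k + m)!` on continuous functions. -/
def expTail (m : ℕ) (y : PerC L) : PerC L := ∑' k : ℕ, (((k + m).factorial : ℂ)⁻¹) • y ^ k

theorem summable_expTail (m : ℕ) (y : PerC L) :
    Summable fun k : ℕ => (((k + m).factorial : ℂ)⁻¹) • y ^ k := by
  refine Summable.of_norm_bounded (g := fun k : ℕ => ‖y‖ ^ k / k.factorial)
    (Real.summable_pow_div_factorial _) fun k => ?_
  rw [norm_smul, norm_inv, Complex.norm_natCast, div_eq_inv_mul]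
  refine mul_le_mul ?_ (norm_pow_le y k) (norm_nonneg _) (by positivity)
  refine inv_anti₀ (by positivity) ?_
  exact_mod_cast Nat.factorial_le (Nat.le_add_right k m)

/-- The algebra property bounds `y^k` by `(mulConst s * M)^k`, and `1/(k+m)! ≤ 1/k!`, so the
exponential series dominates term by term. -/
theorem bd_expTail {s : ℕ} (hs : 1 ≤ s) {y : PerC L} {M : ℝ} (h : Bd s y M) (m : ℕ) :
    Bd s (expTail m y) (Real.exp (mulConst s * M)) := by
  refine Bd.of_tendsto (summable_expTail m y).hasSum.tendsto_sum_nat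
    (Eventually.of_forall fun n => ?_)
  have hc : 0 ≤ mulConst s * M := mul_nonneg (mulConst_nonneg s) h.1
  refine (Bd.sum (Finset.range n) fun k _ => (h.pow hs k).smul (((k + m).factorial : ℂ)⁻¹)).mono ?_
  refine le_trans (Finset.sum_le_sum fun k _ => ?_) (Real.sum_le_exp_of_nonneg hc n)
  rw [norm_inv, Complex.norm_natCast, div_eq_inv_mul]
  refine mul_le_mul_of_nonneg_right ?_ (pow_nonneg hc k)
  refine inv_anti₀ (by positivity) ?_
  exact_mod_cast Nat.factorial_le (Nat.le_add_right k m)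

/-- The pointwise exponential. -/
def cexp (y : PerC L) : PerC L := ⟨fun x => Complex.exp (y x), by fun_prop⟩

theorem cexp_apply (y : PerC L) (x : AddCircle L) : cexp y x = Complex.exp (y x) := rfl

theorem cexp_sub_mul (y z : PerC L) : cexp y = cexp z * cexp (y - z) := by
  ext x
  simp [cexp_apply, ← Complex.exp_add]

theorem cexp_add (y z : PerC L) : cexp (y + z) = cexp y * cexp z := by
  ext x
  simp [cexp_apply, ← Complex.exp_add]

/-- Taylor's formula with the remainder factored as `y^m` times an entire function of `y`. In this
form the algebra property estimates the remainder directly in `H^s`. -/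
theorem cexp_eq (m : ℕ) (y : PerC L) :
    cexp y = ∑ k ∈ Finset.range m, ((k.factorial : ℂ)⁻¹) • y ^ k + y ^ m * expTail m y := by
  ext x
  have h := (NormedSpace.expSeries_div_hasSum_exp (𝔸 := ℂ) (y x))
  rw [← Complex.exp_eq_exp_ℂ] at h
  have h1 := h.summable.sum_add_tsum_nat_add m
  rw [h.tsum_eq] at h1
  have h2 := (ContinuousMap.evalCLM ℂ x).hasSum (summable_expTail m y).hasSum
  rw [cexp_apply, ← h1, ContinuousMap.add_apply, ContinuousMap.mul_apply]
  congr 1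
  · rw [ContinuousMap.coe_sum, Finset.sum_apply]
    exact Finset.sum_congr rfl fun k _ => by simp [div_eq_inv_mul]
  · have h3 : expTail m y x = ∑' k : ℕ, (((k + m).factorial : ℂ)⁻¹) • (y x) ^ k := by
      exact h2.tsum_eq.symm
    rw [h3, ContinuousMap.pow_apply, ← tsum_mul_left]
    refine tsum_congr fun k => ?_
    rw [smul_eq_mul, pow_add]
    field_simp

end Products

/-! ### Fourier multipliers and trigonometric polynomials. -/

section Multipliers

variable {L : ℝ} [hL : Fact (0 < L)]

/-- The Fourier multiplier with symbol `m`, restricted to the frequencies in `S`. -/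
def mult (S : Finset ℤ) (m : ℤ → ℂ) : PerC L →L[ℂ] PerC L :=
  ∑ l ∈ S, m l • (coeff l).smulRight (fourier l : PerC L)

theorem mult_apply (S : Finset ℤ) (m : ℤ → ℂ) (u : PerC L) :
    mult S m u = ∑ l ∈ S, (m l * coeff l u) • (fourier l : PerC L) := by
  simp only [mult, _root_.sum_apply, _root_.smul_apply,
    ContinuousLinearMap.smulRight_apply, smul_smul]

theorem coeff_sum_fourier (S : Finset ℤ) (c : ℤ → ℂ) (l : ℤ) :
    coeff l (∑ k ∈ S, c k • (fourier k : PerC L)) = if l ∈ S then c l else 0 := by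
  simp [map_sum, coeff_fourier, Finset.sum_ite_eq]

theorem coeff_mult (S : Finset ℤ) (m : ℤ → ℂ) (u : PerC L) (l : ℤ) :
    coeff l (mult S m u) = if l ∈ S then m l * coeff l u else 0 := by
  rw [mult_apply, coeff_sum_fourier]

theorem Bd.mult {s k : ℕ} {u : PerC L} {M c : ℝ} {S : Finset ℤ} {m : ℤ → ℂ} (hc : 0 ≤ c)
    (h : Bd (s + k) u M) (hm : ∀ l ∈ S, ‖m l‖ ≤ c * wt l ^ k) : Bd s (mult S m u) (c * M) := by
  refine h.of_coeff_le hc fun l => ?_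
  rw [coeff_mult]
  have hw := pow_pos (wt_pos l) s
  have hk := pow_pos (wt_pos l) k
  split_ifs with hl
  · rw [norm_mul, pow_add]
    calc wt l ^ s * (‖m l‖ * ‖coeff l u‖) ≤ wt l ^ s * (c * wt l ^ k * ‖coeff l u‖) := by
          gcongr; exact hm l hl
      _ = c * (wt l ^ s * wt l ^ k * ‖coeff l u‖) := by ring
  · rw [norm_zero, mul_zero]
    have := wt_pos l
    positivity

/-- `u` is a trigonometric polynomial with frequencies in `S`. -/
def Supp (S : Finset ℤ) (u : PerC L) : Prop := ∀ l ∉ S, coeff l u = 0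

theorem supp_mult (S : Finset ℤ) (m : ℤ → ℂ) (u : PerC L) : Supp S (PeriodicSobolev.mult S m u) :=
  fun l hl => by rw [coeff_mult, if_neg hl]

theorem Supp.eq_sum {S : Finset ℤ} {u : PerC L} (h : Supp S u) :
    u = ∑ k ∈ S, coeff k u • (fourier k : PerC L) := by
  refine coeff_ext fun l => ?_
  rw [coeff_sum_fourier]
  split_ifs with hl
  · rfl
  · exact h l hl

theorem Supp.sub {S : Finset ℤ} {u v : PerC L} (h : Supp S u) (h' : Supp S v) :
    Supp S (u - v) := fun l hl => by rw [map_sub, h l hl, h' l hl, sub_zero]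

theorem Supp.star {S : Finset ℤ} {u : PerC L} (h : Supp S u) :
    Supp (S.map (Equiv.neg ℤ).toEmbedding) (star u) := fun l hl => by
  rw [coeff_star, h, map_zero]
  intro h'
  exact hl (Finset.mem_map.2 ⟨-l, h', by simp⟩)

end Multipliers

/-! ### The frequency window. -/

section Frequencies

variable {N : ℕ}

theorem mem_freq (hE : Even N) {l : ℤ} : l ∈ freq N ↔ -(N : ℤ) ≤ 2 * l ∧ 2 * l < N := by
  obtain ⟨k, rfl⟩ := hE
  simp only [freq, Finset.mem_Ico]
  push_cast
  omega

theorem two_le_of_even (hN : 0 < N) (hE : Even N) : 2 ≤ N := by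
  obtain ⟨k, rfl⟩ := hE; omega

theorem abs_le_of_mem_freq (hE : Even N) {l : ℤ} (hl : l ∈ freq N) : |(l : ℝ)| ≤ N / 2 := by
  rw [mem_freq hE] at hl
  rw [abs_le]
  have h1 : (-(N : ℝ)) ≤ 2 * l := by exact_mod_cast hl.1
  have h2 : (2 * l : ℝ) ≤ N := by exact_mod_cast hl.2.le
  constructor <;> linarith

theorem wt_le_of_mem_freq (hN : 0 < N) (hE : Even N) {l : ℤ} (hl : l ∈ freq N) : wt l ≤ N := by
  have h := abs_le_of_mem_freq hE hl
  have h2 : (2 : ℝ) ≤ N := by exact_mod_cast two_le_of_even hN hE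
  unfold wt; linarith

theorem le_wt_of_notMem_freq (hE : Even N) {l : ℤ} (hl : l ∉ freq N) : (N : ℝ) / 2 ≤ wt l := by
  rw [mem_freq hE, not_and_or, not_le, not_lt] at hl
  unfold wt
  rcases hl with h | h
  · have h1 : (2 * l : ℝ) < -N := by exact_mod_cast h
    have := neg_abs_le (l : ℝ)
    linarith
  · have h1 : (N : ℝ) ≤ 2 * l := by exact_mod_cast h
    have := le_abs_self (l : ℝ)
    linarith

/-- Two elements of the half-open window differ by less than `N`, so each residue class modulo `N`
has at most one representative in it. -/
theorem abs_lt_of_mem_freq_of_mem_freq (hE : Even N) {l k : ℤ} (hl : l ∈ freq N)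
    (hk : k ∈ freq N) (h : (N : ℤ) ∣ l - k) : l = k := by
  rw [mem_freq hE] at hl hk
  have := Int.eq_zero_of_abs_lt_dvd h (by rw [abs_lt]; constructor <;> linarith)
  linarith

end Frequencies

/-! ### Truncation error and inverse inequality. -/

section Projection

variable {L : ℝ} [hL : Fact (0 < L)] {N : ℕ}

/-- Outside the window the weight is at least `N / 2`, so each surplus derivative buys a factor `2 /
N`. -/
theorem Bd.sub_proj (hN : 0 < N) (hE : Even N) {s k : ℕ} {u : PerC L} {M : ℝ}
    (h : Bd (s + k) u M) : Bd s (u - PeriodicSobolev.mult (freq N) 1 u) ((2 / N) ^ k * M) := by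
  refine h.of_coeff_le (by positivity) fun l => ?_
  rw [map_sub, coeff_mult]
  have hw := wt_pos l
  split_ifs with hl
  · simp only [Pi.one_apply, one_mul, sub_self, norm_zero, mul_zero]
    positivity
  · rw [sub_zero]
    have h1 := le_wt_of_notMem_freq hE hl
    have hN' : (0 : ℝ) < N := by exact_mod_cast hN
    have h2 : 1 ≤ (2 / N : ℝ) * wt l := by
      calc (1 : ℝ) = (2 / N) * (N / 2) := by field_simp
        _ ≤ _ := by gcongr
    have h3 : 1 ≤ ((2 / N : ℝ) * wt l) ^ k := one_le_pow₀ h2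
    calc wt l ^ s * ‖coeff l u‖ = 1 * (wt l ^ s * ‖coeff l u‖) := (one_mul _).symm
      _ ≤ ((2 / N : ℝ) * wt l) ^ k * (wt l ^ s * ‖coeff l u‖) := by gcongr
      _ = _ := by rw [mul_pow, pow_add]; ring

/-- The inverse inequality for trigonometric polynomials. -/
theorem Bd.inverse (hN : 0 < N) (hE : Even N) {s : ℕ} {u : PerC L} {M : ℝ} (h : Bd s u M)
    (hu : Supp (freq N) u) : Bd (s + 1) u (N * M) := by
  refine h.of_coeff_le (by positivity) fun l => ?_
  have hw := wt_pos l
  by_cases hl : l ∈ freq N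
  · rw [pow_succ]
    calc wt l ^ s * wt l * ‖coeff l u‖ = wt l * (wt l ^ s * ‖coeff l u‖) := by ring
      _ ≤ _ := by gcongr; exact wt_le_of_mem_freq hN hE hl
  · rw [hu l hl]; simp

end Projection

/-! ### Trigonometric interpolation and aliasing. -/

section Interpolation

variable {L : ℝ} [hL : Fact (0 < L)] {N : ℕ}

/-- The grid points on the circle. -/
def gridPt (L : ℝ) (N j : ℕ) : AddCircle L := ((j * (L / N) : ℝ) : AddCircle L)

/-- Discrete Fourier coefficients. -/
def dcoeff (N : ℕ) (l : ℤ) : PerC L →L[ℂ] ℂ :=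
  ∑ j : Fin N, (1 / N * fourier (-l) (gridPt L N j) : ℂ) • ContinuousMap.evalCLM ℂ (gridPt L N j)

theorem dcoeff_apply (l : ℤ) (u : PerC L) : dcoeff N l u
    = 1 / N * ∑ j : Fin N, u (gridPt L N j) * fourier (-l) (gridPt L N j) := by
  simp only [dcoeff, _root_.sum_apply, _root_.smul_apply, smul_eq_mul,
    Finset.mul_sum]
  refine Finset.sum_congr rfl fun j _ => ?_
  change _ * u (gridPt L N j) = _
  ring

theorem fourier_gridPt (hN : 0 < N) (l : ℤ) (j : ℕ) :
    (fourier l (gridPt L N j) : ℂ) = (Complex.exp (2 * Real.pi * Complex.I / N) ^ l) ^ j := by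
  have hL' : (L : ℂ) ≠ 0 := by exact_mod_cast hL.out.ne'
  have hN' : (N : ℂ) ≠ 0 := by exact_mod_cast hN.ne'
  rw [gridPt, fourier_coe_apply, ← Complex.exp_int_mul, ← Complex.exp_nat_mul]
  congr 1
  push_cast
  field_simp

/-- Geometric sum over the powers of an `N`-th root of unity: on the grid, frequencies are seen only
modulo `N`. -/
theorem dcoeff_fourier (hN : 0 < N) (l k : ℤ) :
    dcoeff N l (fourier k : PerC L) = if (N : ℤ) ∣ k - l then 1 else 0 := by
  have hN' : (N : ℂ) ≠ 0 := by exact_mod_cast hN.ne'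
  set ζ := Complex.exp (2 * Real.pi * Complex.I / N)
  have hζ : IsPrimitiveRoot ζ N := Complex.isPrimitiveRoot_exp N hN.ne'
  have h1 : dcoeff N l (fourier k : PerC L) = 1 / N * ∑ j ∈ Finset.range N, (ζ ^ (k - l)) ^ j := by
    rw [dcoeff_apply, ← Fin.sum_univ_eq_sum_range (fun j => (ζ ^ (k - l)) ^ j)]
    congr 1
    refine Finset.sum_congr rfl fun j _ => ?_
    rw [← fourier_add, fourier_gridPt hN, sub_eq_add_neg]
  rw [h1]
  split_ifs with h
  · rw [(hζ.zpow_eq_one_iff_dvd _).2 h]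
    simp [hN']
  · have h2 : ζ ^ (k - l) ≠ 1 := fun h' => h ((hζ.zpow_eq_one_iff_dvd _).1 h')
    have h3 : (ζ ^ (k - l)) ^ N = 1 := by
      rw [← zpow_natCast, zpow_comm, zpow_natCast, hζ.pow_eq_one, one_zpow]
    have h4 := mul_geom_sum (ζ ^ (k - l)) N
    rw [h3, sub_self] at h4
    rw [(mul_eq_zero.1 h4).resolve_left (sub_ne_zero.2 h2), mul_zero]

/-- Trigonometric interpolation of a continuous periodic function. -/
def interpC (N : ℕ) : PerC L →L[ℂ] PerC L :=
  ∑ l ∈ freq N, (dcoeff N l).smulRight (fourier l : PerC L)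

theorem interpC_apply (u : PerC L) :
    interpC N u = ∑ l ∈ freq N, dcoeff N l u • (fourier l : PerC L) := by
  simp only [interpC, _root_.sum_apply, ContinuousLinearMap.smulRight_apply]

theorem coeff_interpC (u : PerC L) (l : ℤ) :
    coeff l (interpC N u) = if l ∈ freq N then dcoeff N l u else 0 := by
  rw [interpC_apply, coeff_sum_fourier]

theorem supp_interpC (u : PerC L) : Supp (freq N) (interpC N u) := fun l hl => by
  rw [coeff_interpC, if_neg hl]

theorem Supp.interpC_eq (hN : 0 < N) (hE : Even N) {u : PerC L} (hu : Supp (freq N) u) :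
    interpC N u = u := by
  refine coeff_ext fun l => ?_
  rw [coeff_interpC]
  split_ifs with hl
  · conv_lhs => rw [hu.eq_sum]
    rw [map_sum]
    have : ∀ k ∈ freq N, dcoeff N l (coeff k u • (fourier k : PerC L))
        = if k = l then coeff k u else 0 := by
      intro k hk
      rw [map_smul, dcoeff_fourier hN, smul_eq_mul, mul_ite, mul_one, mul_zero]
      refine if_congr ⟨fun h => abs_lt_of_mem_freq_of_mem_freq hE hk hl h, ?_⟩ rfl rfl
      rintro rfl; simp
    rw [Finset.sum_congr rfl this, Finset.sum_ite_eq', if_pos hl]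
  · exact (hu l hl).symm

/-- A shifted frequency has at most one alias in the window, so folding the spectrum counts no term
twice. -/
theorem sum_sum_le_of_freq (hE : Even N) (G : Finset ℤ) (F : Finset ℤ) (j : ℤ) {a : ℤ → ℝ}
    (ha : ∀ k, 0 ≤ a k) :
    ∑ l ∈ F with l ∈ freq N, ∑ k ∈ G with (N : ℤ) ∣ j + k - l, a k ≤ ∑ k ∈ G, a k := by
  simp_rw [Finset.sum_filter (s := G)]
  rw [Finset.sum_comm]
  refine Finset.sum_le_sum fun k _ => ?_
  rw [← Finset.sum_filter, Finset.sum_const, nsmul_eq_mul]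
  have hc : (Finset.filter (fun l => (N : ℤ) ∣ j + k - l) (F.filter (· ∈ freq N))).card ≤ 1 := by
    rw [Finset.card_le_one]
    intro x hx y hy
    simp only [Finset.mem_filter] at hx hy
    refine abs_lt_of_mem_freq_of_mem_freq hE hx.1.2 hy.1.2 ?_
    have := dvd_sub hy.2 hx.2
    rwa [show j + k - y - (j + k - x) = x - y by ring] at this
  calc _ ≤ (1 : ℝ) * a k := by
        gcongr
        · exact ha k
        · exact_mod_cast hc
    _ = a k := one_mul _

theorem coeff_interpC_sum (hN : 0 < N) (G : Finset ℤ) (c : ℤ → ℂ) {l : ℤ} (j : ℤ)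
    (hl : l ∈ freq N) :
    coeff l (interpC N (∑ k ∈ G, c k • (fourier (j + k) : PerC L)))
      = ∑ k ∈ G with (N : ℤ) ∣ j + k - l, c k := by
  rw [coeff_interpC, if_pos hl, map_sum, Finset.sum_filter]
  refine Finset.sum_congr rfl fun k _ => ?_
  rw [map_smul, dcoeff_fourier hN, smul_eq_mul, mul_ite, mul_one, mul_zero]

/-- The aliases of `l` outside the window are `k = l + jN` with `j ≠ 0`. As `|l| ≤ N/2`, they
satisfy `|k| ≥ |j|N/2`, which leaves `(2/N)^s` times a convergent sum over `j`. -/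
theorem sum_inv_wt_alias_le (hN : 0 < N) (hE : Even N) {s : ℕ} (hs : 1 ≤ s) {l : ℤ}
    (hl : l ∈ freq N) (G : Finset ℤ) :
    ∑ k ∈ G with ((N : ℤ) ∣ k - l ∧ k ∉ freq N), ((wt k ^ s)⁻¹) ^ 2
      ≤ ((2 / N) ^ s * (2 * √wtSum)) ^ 2 := by
  have hN' : (0 : ℝ) < N := by exact_mod_cast hN
  have key : ∀ k ∈ G.filter (fun k => (N : ℤ) ∣ k - l ∧ k ∉ freq N),
      ((wt k ^ s)⁻¹) ^ 2 ≤ ((2 / N) ^ s) ^ 2 * (4 * (wt ((k - l) / N) ^ 2)⁻¹) := by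
    intro k hk
    simp only [Finset.mem_filter] at hk
    obtain ⟨_, ⟨j, hj⟩, hkf⟩ := hk
    have hj0 : j ≠ 0 := by
      rintro rfl
      rw [mul_zero, sub_eq_zero] at hj
      exact hkf (hj ▸ hl)
    have e : (k - l) / (N : ℤ) = j := by
      rw [hj, Int.mul_ediv_cancel_left _ (by exact_mod_cast hN.ne')]
    rw [e]
    have hj1 : 1 ≤ |(j : ℝ)| := by
      have : 1 ≤ |j| := Int.one_le_abs hj0
      exact_mod_cast this
    have hk1 : |(j : ℝ)| * (N / 2) ≤ wt k := by
      have h1 : (k : ℝ) = l + N * j := by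
        have : k = l + N * j := by linarith
        exact_mod_cast this
      have h2 := abs_le_of_mem_freq hE hl
      have h3 : |(N * j : ℝ)| ≤ |(k : ℝ)| + |(l : ℝ)| := by
        have : (N * j : ℝ) = k - l := by linarith
        rw [this]; exact abs_sub _ _
      rw [abs_mul, abs_of_pos hN'] at h3
      unfold wt
      nlinarith
    have hp : 0 < |(j : ℝ)| * (N / 2) := by positivity
    have hjs : |(j : ℝ)| ≤ |(j : ℝ)| ^ s := le_self_pow₀ hj1 (by omega)
    have h4 : (wt k ^ s)⁻¹ ≤ (2 / N) ^ s * (2 * (wt j)⁻¹) := by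
      calc (wt k ^ s)⁻¹ ≤ ((|(j : ℝ)| * (N / 2)) ^ s)⁻¹ := by
            apply inv_anti₀ (by positivity); gcongr
        _ = (2 / N) ^ s * (|(j : ℝ)| ^ s)⁻¹ := by
            rw [mul_pow, mul_inv, mul_comm, ← inv_pow, inv_div]
        _ ≤ (2 / N) ^ s * (|(j : ℝ)|)⁻¹ := by gcongr
        _ ≤ (2 / N) ^ s * (2 * (wt j)⁻¹) := by
            gcongr
            rw [← div_eq_mul_inv, inv_eq_one_div, div_le_div_iff₀ (by linarith) (wt_pos j)]
            unfold wt; linarith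
    have h5 : 0 ≤ (wt k ^ s)⁻¹ := by have := wt_pos k; positivity
    calc ((wt k ^ s)⁻¹) ^ 2 ≤ ((2 / N) ^ s * (2 * (wt j)⁻¹)) ^ 2 := pow_le_pow_left₀ h5 h4 2
      _ = _ := by rw [mul_pow, mul_pow, inv_pow]; norm_num
  refine (Finset.sum_le_sum key).trans ?_
  rw [← Finset.mul_sum, ← Finset.mul_sum]
  -- The number `j` determines the alias `k = l + jN`, so the sum over aliases is a sum over
  -- distinct `j`.
  have hinj : Set.InjOn (fun k : ℤ => (k - l) / (N : ℤ))
      (G.filter (fun k => (N : ℤ) ∣ k - l ∧ k ∉ freq N)) := by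
    intro x hx y hy hxy
    simp only [Finset.coe_filter, mem_ofPred_eq] at hx hy
    have h1 := Int.ediv_mul_cancel hx.2.1
    have h2 := Int.ediv_mul_cancel hy.2.1
    simp only at hxy
    rw [hxy] at h1
    linarith
  have h6 := sum_inv_wt_sq_le ((G.filter (fun k => (N : ℤ) ∣ k - l ∧ k ∉ freq N)).image
    (fun k : ℤ => (k - l) / (N : ℤ)))
  rw [Finset.sum_image hinj] at h6
  calc _ ≤ ((2 / N : ℝ) ^ s) ^ 2 * (4 * wtSum) := by gcongr
    _ = _ := by rw [mul_pow, mul_pow, Real.sq_sqrt wtSum_nonneg]; norm_num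

/-- Aliasing errors. -/
theorem Bd.interpC_tail (hN : 0 < N) (hE : Even N) {s k : ℕ} (hs : 1 ≤ s + k) {r : PerC L} {M : ℝ}
    (h : Bd (s + k) r M) (hr : ∀ l ∈ freq N, coeff l r = 0) :
    Bd s (interpC N r) (2 ^ (s + k) * (2 * √wtSum) * (1 / N) ^ k * M) := by
  have hN' : (0 : ℝ) < N := by exact_mod_cast hN
  have hsum := (h.lower hs).hasSum
  refine Bd.of_tendsto ((((interpC (L := L) N).continuous.tendsto r).comp hsum))
    (Eventually.of_forall fun G => ?_)
  have hM := h.1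
  rw [bd_iff]
  refine ⟨by positivity, fun F => ?_⟩
  have hw : ∀ l : ℤ, 0 < wt l ^ (s + k) := fun l => pow_pos (wt_pos l) _
  set v := ∑ k ∈ G, coeff k r • (fourier k : PerC L) with hv
  set D : ℝ := ((2 / N) ^ (s + k) * (2 * √wtSum)) ^ 2
  -- Cauchy–Schwarz over the aliases of `l`. The outer weight is at most `N^s`, which the alias
  -- factor `(2/N)^(s+k)` more than compensates; `N^(-k)` is left over.
  have hcoef : ∀ l ∈ freq N, (wt l ^ s * ‖coeff l (interpC N v)‖) ^ 2
      ≤ ((N : ℝ) ^ s) ^ 2 * (D * ∑ k' ∈ G with (N : ℤ) ∣ 0 + k' - l,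
        (wt k' ^ (s + k) * ‖coeff k' r‖) ^ 2) := by
    intro l hl
    have e0 : v = ∑ k ∈ G, coeff k r • (fourier (0 + k) : PerC L) := by simp [hv]
    have e1 : coeff l (interpC N v)
        = ∑ k' ∈ G with ((N : ℤ) ∣ k' - l ∧ k' ∉ freq N), coeff k' r := by
      rw [e0, coeff_interpC_sum hN G _ 0 hl]
      simp only [zero_add]
      refine (Finset.sum_subset (fun x hx => ?_) fun x hx hx' => ?_).symm
      · simp only [Finset.mem_filter] at hx ⊢
        exact ⟨hx.1, hx.2.1⟩
      · simp only [Finset.mem_filter, not_and, not_not] at hx hx'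
        exact hr x (hx' hx.1 hx.2)
    have h1 : ‖coeff l (interpC N v)‖ ^ 2 ≤ D * ∑ k' ∈ G with (N : ℤ) ∣ 0 + k' - l,
        (wt k' ^ (s + k) * ‖coeff k' r‖) ^ 2 := by
      rw [e1]
      have hcs := Finset.sum_mul_sq_le_sq_mul_sq
        (G.filter fun k' => (N : ℤ) ∣ k' - l ∧ k' ∉ freq N) (fun k' => (wt k' ^ (s + k))⁻¹)
        fun k' => wt k' ^ (s + k) * ‖coeff k' r‖
      have e2 : ∑ k' ∈ G with ((N : ℤ) ∣ k' - l ∧ k' ∉ freq N),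
          (wt k' ^ (s + k))⁻¹ * (wt k' ^ (s + k) * ‖coeff k' r‖)
          = ∑ k' ∈ G with ((N : ℤ) ∣ k' - l ∧ k' ∉ freq N), ‖coeff k' r‖ :=
        Finset.sum_congr rfl fun x _ => by rw [inv_mul_cancel_left₀ (hw x).ne']
      rw [e2] at hcs
      calc _ ≤ (∑ k' ∈ G with ((N : ℤ) ∣ k' - l ∧ k' ∉ freq N), ‖coeff k' r‖) ^ 2 :=
            pow_le_pow_left₀ (norm_nonneg _) (norm_sum_le _ _) 2
        _ ≤ _ := hcs
        _ ≤ _ := by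
            refine mul_le_mul (sum_inv_wt_alias_le hN hE hs hl G) ?_
              (Finset.sum_nonneg fun _ _ => sq_nonneg _) (sq_nonneg _)
            simp only [zero_add]
            refine Finset.sum_le_sum_of_subset_of_nonneg (fun x hx => ?_) fun _ _ _ => sq_nonneg _
            simp only [Finset.mem_filter] at hx ⊢
            exact ⟨hx.1, hx.2.1⟩
    rw [mul_pow]
    refine mul_le_mul ?_ h1 (sq_nonneg _) (sq_nonneg _)
    have := wt_le_of_mem_freq hN hE hl
    have := (wt_pos l).le
    gcongr
  have hF : ∑ l ∈ F, (wt l ^ s * ‖coeff l (interpC N v)‖) ^ 2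
      = ∑ l ∈ F with l ∈ freq N, (wt l ^ s * ‖coeff l (interpC N v)‖) ^ 2 := by
    rw [Finset.sum_filter]
    refine Finset.sum_congr rfl fun l _ => ?_
    split_ifs with hl
    · rfl
    · rw [supp_interpC v l hl]; simp
  change ∑ l ∈ F, (wt l ^ s * ‖coeff l (interpC N v)‖) ^ 2 ≤ _
  rw [hF]
  calc _ ≤ ∑ l ∈ F with l ∈ freq N, ((N : ℝ) ^ s) ^ 2 * (D * ∑ k' ∈ G with (N : ℤ) ∣ 0 + k' - l,
        (wt k' ^ (s + k) * ‖coeff k' r‖) ^ 2) :=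
        Finset.sum_le_sum fun l hl => hcoef l (Finset.mem_filter.1 hl).2
    _ = ((N : ℝ) ^ s) ^ 2 * (D * ∑ l ∈ F with l ∈ freq N, ∑ k' ∈ G with (N : ℤ) ∣ 0 + k' - l,
        (wt k' ^ (s + k) * ‖coeff k' r‖) ^ 2) := by rw [← Finset.mul_sum, ← Finset.mul_sum]
    _ ≤ ((N : ℝ) ^ s) ^ 2 * (D * M ^ 2) := by
        gcongr
        exact (sum_sum_le_of_freq hE G F 0 fun _ => sq_nonneg _).trans ((bd_iff.1 h).2 G)
    _ = _ := by
        simp only [D]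
        rw [← mul_pow, ← mul_pow]
        congr 1
        rw [div_pow, pow_add (N : ℝ), div_pow, one_pow]
        field_simp

theorem sub_proj_coeff {u : PerC L} {l : ℤ} (hl : l ∈ freq N) :
    coeff l (u - PeriodicSobolev.mult (freq N) 1 u) = 0 := by
  rw [map_sub, coeff_mult, if_pos hl]; simp

theorem sub_proj_bd {s : ℕ} {u : PerC L} {M : ℝ} (h : Bd s u M) :
    Bd s (u - PeriodicSobolev.mult (freq N) 1 u) M := by
  have := h.of_coeff_le (s' := s) (v := u - PeriodicSobolev.mult (freq N) 1 u) zero_le_one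
    fun l => by
      rw [map_sub, coeff_mult]
      have := wt_pos l
      split_ifs
      · simp; positivity
      · simp
  simpa using this

theorem interpC_eq_add (hN : 0 < N) (hE : Even N) (u : PerC L) :
    interpC N u = PeriodicSobolev.mult (freq N) 1 u
      + interpC N (u - PeriodicSobolev.mult (freq N) 1 u) := by
  rw [map_sub, (supp_mult _ _ _).interpC_eq hN hE]; abel

theorem proj_bd {s : ℕ} {S : Finset ℤ} {u : PerC L} {M : ℝ} {m : ℤ → ℂ} (h : Bd s u M)
    (hm : ∀ l ∈ S, ‖m l‖ ≤ 1) : Bd s (PeriodicSobolev.mult S m u) M := by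
  have := Bd.mult (s := s) (k := 0) zero_le_one h (S := S) (m := m) (by simpa using hm)
  simpa using this

/-- The constant in the interpolation estimates. -/
def interpConst (s : ℕ) : ℝ := 2 ^ s * (2 * √wtSum) + 2 ^ s

theorem interpConst_nonneg (s : ℕ) : 0 ≤ interpConst s := by unfold interpConst; positivity

/-- Interpolation reproduces the truncation exactly, so the error consists of the aliased tail minus
the tail itself. -/
theorem Bd.interpC_sub (hN : 0 < N) (hE : Even N) {s k : ℕ} (hs : 1 ≤ s + k) {u : PerC L} {M : ℝ}
    (h : Bd (s + k) u M) : Bd s (interpC N u - u) (interpConst (s + k) * ((1 / N) ^ k * M)) := by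
  have e : interpC N u - u = interpC N (u - PeriodicSobolev.mult (freq N) 1 u)
      - (u - PeriodicSobolev.mult (freq N) 1 u) := by
    conv_lhs => rw [interpC_eq_add hN hE u]
    abel
  rw [e]
  have hN' : (0 : ℝ) < N := by exact_mod_cast hN
  have hM := h.1
  refine ((sub_proj_bd h).interpC_tail hN hE hs fun l hl => sub_proj_coeff hl).sub
    (h.sub_proj hN hE) |>.mono ?_
  unfold interpConst
  have : ((2 : ℝ) / N) ^ k * M ≤ 2 ^ (s + k) * ((1 / N) ^ k * M) := by
    rw [div_pow, one_div, inv_pow, div_eq_mul_inv, mul_assoc]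
    have : (2 : ℝ) ^ k ≤ 2 ^ (s + k) := pow_le_pow_right₀ (by norm_num) (by omega)
    gcongr
  linarith

theorem Bd.interpC_one (hN : 0 < N) (hE : Even N) {u : PerC L} {M : ℝ} (h : Bd 1 u M) :
    Bd 1 (interpC N u) ((interpConst 1 + 1) * M) := by
  have h1 := (Bd.interpC_sub hN hE (s := 1) (k := 0) le_rfl h).add h
  rw [sub_add_cancel] at h1
  exact h1.mono (le_of_eq (by ring))

/-- The frequencies of `e` are distinct modulo `N` and remain so after a shift by `j`. Thus no two
of them are folded onto the same mode, and the interpolant has coefficients of `e` rearranged. -/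
theorem Bd.interpC_fourier_mul (hN : 0 < N) (hE : Even N) {S : Finset ℤ}
    (hS : ∀ k ∈ S, ∀ k' ∈ S, (N : ℤ) ∣ k - k' → k = k') {e : PerC L} (he : Supp S e) {M : ℝ}
    (h : Bd 0 e M) (j : ℤ) : Bd 0 (interpC N (fourier j * e)) M := by
  rw [bd_iff]
  refine ⟨h.1, fun F => ?_⟩
  have e1 : fourier j * e = ∑ k ∈ S, coeff k e • (fourier (j + k) : PerC L) := by
    conv_lhs => rw [he.eq_sum, Finset.mul_sum]
    exact Finset.sum_congr rfl fun k _ => by rw [mul_smul_comm, fourier_mul_fourier]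
  rw [e1]
  have hcoef : ∀ l ∈ freq N,
      (wt l ^ 0 * ‖coeff l (interpC N (∑ k ∈ S, coeff k e • (fourier (j + k) : PerC L)))‖) ^ 2
        ≤ ∑ k ∈ S with (N : ℤ) ∣ j + k - l, ‖coeff k e‖ ^ 2 := by
    intro l hl
    rw [coeff_interpC_sum hN S _ j hl, pow_zero, one_mul]
    have hc : (S.filter fun k => (N : ℤ) ∣ j + k - l).card ≤ 1 := by
      rw [Finset.card_le_one]
      intro x hx y hy
      simp only [Finset.mem_filter] at hx hy
      refine hS x hx.1 y hy.1 ?_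
      have := dvd_sub hx.2 hy.2
      ring_nf at this ⊢
      exact this
    refine (sq_le_sq₀ (norm_nonneg _) (Finset.sum_nonneg fun _ _ => norm_nonneg _)).2
      (norm_sum_le _ _) |>.trans ?_
    refine sq_sum_le_card_mul_sum_sq.trans ?_
    have h0 : 0 ≤ ∑ k ∈ S with (N : ℤ) ∣ j + k - l, ‖coeff k e‖ ^ 2 :=
      Finset.sum_nonneg fun _ _ => sq_nonneg _
    have h1 : ((S.filter fun k => (N : ℤ) ∣ j + k - l).card : ℝ) ≤ 1 := by exact_mod_cast hc
    exact mul_le_of_le_one_left h0 h1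
  have hF : ∀ v : PerC L, ∑ l ∈ F, (wt l ^ 0 * ‖coeff l (interpC N v)‖) ^ 2
      = ∑ l ∈ F with l ∈ freq N, (wt l ^ 0 * ‖coeff l (interpC N v)‖) ^ 2 := by
    intro v
    rw [Finset.sum_filter]
    refine Finset.sum_congr rfl fun l _ => ?_
    split_ifs with hl
    · rfl
    · rw [supp_interpC v l hl]; simp
  rw [hF]
  refine (Finset.sum_le_sum fun l hl => hcoef l (Finset.mem_filter.1 hl).2).trans ?_
  refine (sum_sum_le_of_freq hE S F j fun _ => sq_nonneg _).trans ?_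
  simpa using (bd_iff.1 h).2 S

theorem Bd.tendsto_sum_mul {v : PerC L} {M : ℝ} (h : Bd 1 v M) (e : PerC L) :
    Tendsto (fun G : Finset ℤ => (∑ l ∈ G, coeff l v • (fourier l : PerC L)) * e) atTop
      (𝓝 (v * e)) :=
  (continuous_mul_const e).continuousAt.tendsto.comp h.hasSum

theorem interpC_sum_mul (G : Finset ℤ) (v e : PerC L) :
    interpC N ((∑ l ∈ G, coeff l v • (fourier l : PerC L)) * e)
      = ∑ l ∈ G, coeff l v • interpC N (fourier l * e) := by
  rw [Finset.sum_mul, map_sum]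
  refine Finset.sum_congr rfl fun l _ => ?_
  rw [smul_mul_assoc]
  exact (interpC (L := L) N).map_smul _ _

/-- Interpolation has no `L²` bound on general continuous functions. On such products it has one:
the `H¹` factor is expanded in exponentials, and each shifted copy of `e` is folded without loss. -/
theorem Bd.interpC_mul_zero (hN : 0 < N) (hE : Even N) {S : Finset ℤ}
    (hS : ∀ k ∈ S, ∀ k' ∈ S, (N : ℤ) ∣ k - k' → k = k') {e v : PerC L}
    (he : Supp S e) {M M' : ℝ} (h : Bd 0 e M) (h' : Bd 1 v M') :
    Bd 0 (interpC N (v * e)) (√wtSum * M' * M) := by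
  have ht : Tendsto (fun G : Finset ℤ => interpC N ((∑ l ∈ G, coeff l v • (fourier l : PerC L)) * e))
      atTop (𝓝 (interpC N (v * e))) :=
    ((interpC (L := L) N).continuous.tendsto _).comp (h'.tendsto_sum_mul e)
  refine Bd.of_tendsto ht (Eventually.of_forall fun G => ?_)
  rw [interpC_sum_mul]
  have h2 : ∀ l ∈ G, Bd 0 (coeff l v • interpC N (fourier l * e)) (‖coeff l v‖ * M) :=
    fun l _ => (h.interpC_fourier_mul hN hE hS he l).smul _
  refine (Bd.sum G h2).mono ?_
  rw [← Finset.sum_mul]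
  exact mul_le_mul_of_nonneg_right (h'.sum_norm_coeff_le G) h.1

theorem Bd.interpC_mul (hN : 0 < N) (hE : Even N) {S : Finset ℤ}
    (hS : ∀ k ∈ S, ∀ k' ∈ S, (N : ℤ) ∣ k - k' → k = k') {s : ℕ} (hs : s ≤ 1) {e v : PerC L}
    (he : Supp S e) {M M' : ℝ} (h : Bd s e M) (h' : Bd 1 v M') :
    Bd s (interpC N (v * e)) ((interpConst 1 + 1) * mulConst 1 * (M' * M)) := by
  obtain rfl | rfl : s = 0 ∨ s = 1 := by omega
  · have h1 := h.interpC_mul_zero hN hE hS he h'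
    refine h1.mono ?_
    have h2 := interpConst_nonneg 1
    have h3 : 0 ≤ M' * M := mul_nonneg h'.1 h.1
    have h4 : 0 ≤ √wtSum := Real.sqrt_nonneg _
    have h5 : √wtSum ≤ mulConst 1 := by unfold mulConst; linarith
    have h6 : √wtSum ≤ (interpConst 1 + 1) * mulConst 1 := by nlinarith
    calc √wtSum * M' * M = √wtSum * (M' * M) := by ring
      _ ≤ _ := by gcongr
  · refine ((h'.mul le_rfl h).interpC_one hN hE).mono (le_of_eq (by ring))

end Interpolation

/-! ### Bounds that are uniform over families. -/

section Families

variable {L : ℝ} [hL : Fact (0 < L)] {ι : Type*}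

/-- A family of functions is bounded in `H^s` by a constant times `ρ`. -/
def BigO (s : ℕ) (u : ι → PerC L) (ρ : ι → ℝ) : Prop :=
  (∀ i, 0 ≤ ρ i) ∧ ∃ C : ℝ, 0 ≤ C ∧ ∀ i, Bd s (u i) (C * ρ i)

variable {s : ℕ} {u v : ι → PerC L} {ρ ρ' : ι → ℝ}

theorem BigO.congr (h : BigO s u ρ) (e : ∀ i, v i = u i) : BigO s v ρ :=
  ⟨h.1, h.2.imp fun _ hC => ⟨hC.1, fun i => (e i).symm ▸ hC.2 i⟩⟩

theorem BigO.mono (h : BigO s u ρ) (K : ℝ) (hK : 0 ≤ K) (h0 : ∀ i, 0 ≤ ρ' i)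
    (hρ : ∀ i, ρ i ≤ K * ρ' i) : BigO s u ρ' := by
  obtain ⟨h1, C, hC, h2⟩ := h
  refine ⟨h0, C * K, mul_nonneg hC hK, fun i => (h2 i).mono ?_⟩
  rw [mul_assoc]
  exact mul_le_mul_of_nonneg_left (hρ i) hC

theorem BigO.add (h : BigO s u ρ) (h' : BigO s v ρ) : BigO s (fun i => u i + v i) ρ := by
  obtain ⟨h1, C, hC, h2⟩ := h
  obtain ⟨_, C', hC', h2'⟩ := h'
  refine ⟨h1, C + C', add_nonneg hC hC', fun i => ?_⟩
  rw [add_mul]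
  exact (h2 i).add (h2' i)

theorem BigO.neg (h : BigO s u ρ) : BigO s (fun i => -u i) ρ :=
  ⟨h.1, h.2.imp fun _ hC => ⟨hC.1, fun i => (hC.2 i).neg⟩⟩

theorem BigO.sub (h : BigO s u ρ) (h' : BigO s v ρ) : BigO s (fun i => u i - v i) ρ := by
  simpa only [sub_eq_add_neg] using h.add h'.neg

theorem BigO.smul (h : BigO s u ρ) {c : ι → ℂ} (K : ℝ) (hK : 0 ≤ K) (h0 : ∀ i, 0 ≤ ρ' i)
    (hc : ∀ i, ‖c i‖ ≤ K * ρ' i) : BigO s (fun i => c i • u i) fun i => ρ' i * ρ i := by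
  obtain ⟨h1, C, hC, h2⟩ := h
  refine ⟨fun i => mul_nonneg (h0 i) (h1 i), K * C, mul_nonneg hK hC, fun i => ?_⟩
  refine ((h2 i).smul (c i)).mono ?_
  calc ‖c i‖ * (C * ρ i) ≤ (K * ρ' i) * (C * ρ i) :=
        mul_le_mul_of_nonneg_right (hc i) (mul_nonneg hC (h1 i))
    _ = _ := by ring

theorem BigO.const_smul (h : BigO s u ρ) (c : ℂ) : BigO s (fun i => c • u i) ρ := by
  have := h.smul (c := fun _ => c) (ρ' := fun _ => 1) ‖c‖ (norm_nonneg c) (fun _ => zero_le_one)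
    fun _ => by simp
  simpa using this

theorem BigO.star (h : BigO s u ρ) : BigO s (fun i => star (u i)) ρ :=
  ⟨h.1, h.2.imp fun _ hC => ⟨hC.1, fun i => (hC.2 i).star⟩⟩

theorem BigO.lower {s' : ℕ} (h : BigO s u ρ) (hs : s' ≤ s) : BigO s' u ρ :=
  ⟨h.1, h.2.imp fun _ hC => ⟨hC.1, fun i => (hC.2 i).lower hs⟩⟩

theorem BigO.mul (hs : 1 ≤ s) (h : BigO s u ρ) (h' : BigO s v ρ') :
    BigO s (fun i => u i * v i) fun i => ρ i * ρ' i := by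
  obtain ⟨h1, C, hC, h2⟩ := h
  obtain ⟨h1', C', hC', h2'⟩ := h'
  refine ⟨fun i => mul_nonneg (h1 i) (h1' i), mulConst s * (C * C'),
    mul_nonneg (mulConst_nonneg s) (mul_nonneg hC hC'), fun i => ?_⟩
  exact ((h2 i).mul hs (h2' i)).mono (le_of_eq (by ring))

theorem BigO.mul_low (hs : s ≤ 1) (h : BigO 1 u ρ) (h' : BigO s v ρ') :
    BigO s (fun i => u i * v i) fun i => ρ i * ρ' i := by
  obtain ⟨h1, C, hC, h2⟩ := h
  obtain ⟨h1', C', hC', h2'⟩ := h'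
  refine ⟨fun i => mul_nonneg (h1 i) (h1' i), mulConst 1 * (C * C'),
    mul_nonneg (mulConst_nonneg 1) (mul_nonneg hC hC'), fun i => ?_⟩
  exact ((h2 i).mul_low hs (h2' i)).mono (le_of_eq (by ring))

theorem BigO.mul_one (hs : 1 ≤ s) (h : BigO s u ρ) (h' : BigO s v fun _ => 1) :
    BigO s (fun i => u i * v i) ρ := by
  simpa using h.mul hs h'

theorem BigO.one_mul (hs : 1 ≤ s) (h : BigO s u fun _ => 1) (h' : BigO s v ρ) :
    BigO s (fun i => u i * v i) ρ := by
  simpa using h.mul hs h'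

theorem BigO.one_mul_low (hs : s ≤ 1) (h : BigO 1 u fun _ => 1) (h' : BigO s v ρ) :
    BigO s (fun i => u i * v i) ρ := by
  simpa using h.mul_low hs h'

theorem BigO.mult {k : ℕ} (h : BigO (s + k) u ρ) {S : ι → Finset ℤ} {m : ι → ℤ → ℂ} (K : ℝ)
    (hK : 0 ≤ K) (h0 : ∀ i, 0 ≤ ρ' i) (hm : ∀ i, ∀ l ∈ S i, ‖m i l‖ ≤ K * ρ' i * wt l ^ k) :
    BigO s (fun i => PeriodicSobolev.mult (S i) (m i) (u i)) fun i => ρ' i * ρ i := by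
  obtain ⟨h1, C, hC, h2⟩ := h
  refine ⟨fun i => mul_nonneg (h0 i) (h1 i), K * C, mul_nonneg hK hC, fun i => ?_⟩
  exact ((h2 i).mult (mul_nonneg hK (h0 i)) (hm i)).mono (le_of_eq (by ring))

theorem BigO.mult_one (h : BigO s u ρ) {S : ι → Finset ℤ} {m : ι → ℤ → ℂ}
    (hm : ∀ i, ∀ l ∈ S i, ‖m i l‖ ≤ 1) :
    BigO s (fun i => PeriodicSobolev.mult (S i) (m i) (u i)) ρ :=
  ⟨h.1, h.2.imp fun _ hC => ⟨hC.1, fun i => proj_bd (hC.2 i) (hm i)⟩⟩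

theorem BigO.expTail (hs : 1 ≤ s) (h : BigO s u fun _ => 1) (m : ℕ) :
    BigO s (fun i => PeriodicSobolev.expTail m (u i)) fun _ => 1 := by
  obtain ⟨_, C, hC, h2⟩ := h
  refine ⟨fun _ => zero_le_one, Real.exp (mulConst s * (C * 1)), (Real.exp_pos _).le, fun i => ?_⟩
  rw [_root_.mul_one]
  exact bd_expTail hs (h2 i) m

theorem bigO_const {w : PerC L} {M : ℝ} (h : Bd s w M) : BigO s (fun _ : ι => w) fun _ => 1 :=
  ⟨fun _ => zero_le_one, M, h.1, fun _ => by simpa using h⟩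

theorem cexp_eq_one_add (y : PerC L) : cexp y = 1 + y * PeriodicSobolev.expTail 1 y := by
  have := cexp_eq 1 y
  simpa using this

theorem BigO.cexp (hs : 1 ≤ s) (h : BigO s u fun _ => 1) :
    BigO s (fun i => PeriodicSobolev.cexp (u i)) fun _ => 1 :=
  ((bigO_const (bd_one s)).add (h.mul_one hs (h.expTail hs 1))).congr fun _ => cexp_eq_one_add _

theorem BigO.extract (h : BigO s u ρ) : ∃ C : ℝ, 0 ≤ C ∧ ∀ i, Bd s (u i) (C * ρ i) := h.2

end Families

/-! ### Comparison of forced free Schrödinger equations. -/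

section Duhamel

variable {L : ℝ} [hL : Fact (0 < L)]

/-- The frequency `2πl/L`. -/
def freqL (L : ℝ) (l : ℤ) : ℝ := 2 * Real.pi * l / L

theorem bd_of_supp {F : Finset ℤ} {s : ℕ} {u : PerC L} {M : ℝ} (hu : Supp F u)
    (h : ‖wvec F s u‖ ≤ M) : Bd s u M := by
  have hM : 0 ≤ M := (norm_nonneg _).trans h
  rw [bd_iff]
  refine ⟨hM, fun G => ?_⟩
  have h2 : ‖wvec F s u‖ ^ 2 ≤ M ^ 2 := pow_le_pow_left₀ (norm_nonneg _) h 2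
  rw [norm_wvec_sq] at h2
  refine le_trans ?_ h2
  have e : ∑ l ∈ G, (wt l ^ s * ‖coeff l u‖) ^ 2
      = ∑ l ∈ G with l ∈ F, (wt l ^ s * ‖coeff l u‖) ^ 2 := by
    rw [Finset.sum_filter]
    refine Finset.sum_congr rfl fun l _ => ?_
    split_ifs with hl
    · rfl
    · rw [hu l hl]; simp
  rw [e]
  exact Finset.sum_le_sum_of_subset_of_nonneg (fun l hl => (Finset.mem_filter.1 hl).2)
    fun _ _ _ => sq_nonneg _

/-- Comparison of two solutions of forced free Schrödinger equations, mode by mode. -/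
theorem duhamel_compare {F : Finset ℤ} {s : ℕ} {τ ρ : ℝ} (hτ : 0 ≤ τ) {y g R : ℝ → PerC L}
    {Y G : ℝ → ℤ → ℂ}
    (hy : ∀ l ∈ F, ∀ r ∈ Icc 0 τ, HasDerivWithinAt (fun r => coeff l (y r))
      (-Complex.I * ((freqL L l : ℂ) ^ 2 * coeff l (y r) + coeff l (g r))) (Icc 0 τ) r)
    (hY : ∀ l ∈ F, ∀ r ∈ Icc 0 τ, HasDerivWithinAt (fun r => Y r l)
      (-Complex.I * ((freqL L l : ℂ) ^ 2 * Y r l + G r l)) (Icc 0 τ) r)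
    (h0 : ∀ l ∈ F, Y 0 l = coeff l (y 0))
    (hR : ∀ r ∈ Icc 0 τ, ∀ l ∈ F, coeff l (R r) = coeff l (g r) - G r l)
    (hRb : ∀ r ∈ Icc 0 τ, Bd s (R r) ρ) {z : PerC L} (hz : Supp F z)
    (hzc : ∀ l ∈ F, coeff l z = coeff l (y τ) - Y τ l) : Bd s z (τ * ρ) := by
  refine bd_of_supp hz ?_
  -- In the interaction picture the free part drops out: the derivative of `D` is the weighted
  -- residual up to unimodular factors. The mean value inequality then bounds `D τ`, whose norm is
  -- the one wanted.
  set D : ℝ → EuclideanSpace ℂ F := fun r => WithLp.toLp 2 fun l : F =>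
    ((wt l ^ s : ℝ) : ℂ) * (Complex.exp (Complex.I * (freqL L l : ℂ) ^ 2 * r) *
      (coeff (l : ℤ) (y r) - Y r l)) with hD
  set D' : ℝ → EuclideanSpace ℂ F := fun r => WithLp.toLp 2 fun l : F =>
    ((wt l ^ s : ℝ) : ℂ) * (Complex.exp (Complex.I * (freqL L l : ℂ) ^ 2 * r) *
      (-Complex.I * coeff (l : ℤ) (R r))) with hD'
  have hexp : ∀ (l : ℤ) (r : ℝ), ‖Complex.exp (Complex.I * (freqL L l : ℂ) ^ 2 * r)‖ = 1 := by
    intro l r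
    have : Complex.I * (freqL L l : ℂ) ^ 2 * r = Complex.I * ((freqL L l ^ 2 * r : ℝ) : ℂ) := by
      push_cast; ring
    rw [this, Complex.norm_exp_I_mul_ofReal]
  have hder : ∀ r ∈ Icc 0 τ, HasDerivWithinAt D (D' r) (Icc 0 τ) r := by
    intro r hr
    have hpi : HasDerivWithinAt (fun (r : ℝ) (l : F) => ((wt l ^ s : ℝ) : ℂ) *
        (Complex.exp (Complex.I * (freqL L l : ℂ) ^ 2 * r) * (coeff (l : ℤ) (y r) - Y r l)))
        (fun l : F => ((wt l ^ s : ℝ) : ℂ) * (Complex.exp (Complex.I * (freqL L l : ℂ) ^ 2 * r) *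
          (-Complex.I * coeff (l : ℤ) (R r)))) (Icc 0 τ) r := by
      rw [hasDerivWithinAt_pi]
      intro l
      have e1 : HasDerivWithinAt (fun r : ℝ => Complex.exp (Complex.I * (freqL L l : ℂ) ^ 2 * r))
          (Complex.exp (Complex.I * (freqL L l : ℂ) ^ 2 * r) *
            (Complex.I * (freqL L l : ℂ) ^ 2 * 1)) (Icc 0 τ) r :=
        ((Complex.ofRealCLM.hasDerivAt (x := r)).const_mul _).cexp.hasDerivWithinAt
      have e2 := (e1.mul ((hy l l.2 r hr).sub (hY l l.2 r hr))).const_mul ((wt l ^ s : ℝ) : ℂ)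
      convert! e2 using 1
      rw [hR r hr l l.2]
      simp only [Pi.sub_apply]
      ring
    exact (PiLp.continuousLinearEquiv 2 ℝ
      (fun _ : F => ℂ)).symm.toContinuousLinearMap.hasFDerivAt.comp_hasDerivWithinAt r hpi
  have hbound : ∀ r ∈ Ico 0 τ, ‖D' r‖ ≤ ρ := by
    intro r hr
    have hr' : r ∈ Icc 0 τ := Ico_subset_Icc_self hr
    refine le_trans (le_of_eq ?_) ((hRb r hr').2 F)
    rw [EuclideanSpace.norm_eq, EuclideanSpace.norm_eq]
    congr 1
    refine Finset.sum_congr rfl fun l _ => ?_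
    rw [wvec_apply]
    simp only [hD', norm_mul, hexp, _root_.one_mul, norm_neg, Complex.norm_I]
  have h1 := norm_image_sub_le_of_norm_deriv_le_segment' hder hbound τ (right_mem_Icc.2 hτ)
  have h2 : D 0 = 0 := by
    ext l
    simp [hD, h0 l l.2]
  rw [h2, sub_zero, sub_zero, mul_comm] at h1
  refine le_trans (le_of_eq ?_) h1
  rw [EuclideanSpace.norm_eq, EuclideanSpace.norm_eq]
  congr 1
  refine Finset.sum_congr rfl fun l _ => ?_
  rw [wvec_apply, hzc l l.2]
  simp only [hD, norm_mul, hexp, _root_.one_mul]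

end Duhamel

/-! ### Scalar symbols: quadrature errors and the telescoping correction. -/

section Symbols

theorem norm_cexp_I_mul (x : ℝ) : ‖Complex.exp (Complex.I * x)‖ = 1 :=
  Complex.norm_exp_I_mul_ofReal x

theorem norm_cexp_sub_cexp_le (x y : ℝ) :
    ‖Complex.exp (Complex.I * x) - Complex.exp (Complex.I * y)‖ ≤ |x - y| := by
  have e : Complex.exp (Complex.I * x) - Complex.exp (Complex.I * y)
      = Complex.exp (Complex.I * y) * (Complex.exp (Complex.I * ((x - y : ℝ) : ℂ)) - 1) := by
    rw [mul_sub, ← Complex.exp_add, mul_one]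
    congr 2
    push_cast; ring
  rw [e, norm_mul, norm_cexp_I_mul, one_mul]
  exact Real.norm_exp_I_mul_ofReal_sub_one_le

theorem norm_cexp_sub_linear_le (x : ℝ) :
    ‖Complex.exp (Complex.I * x) - 1 - Complex.I * x‖ ≤ 3 * x ^ 2 := by
  by_cases h : |x| ≤ 1
  · have h1 := Complex.norm_exp_sub_one_sub_id_le (x := Complex.I * x) (by simpa using h)
    rw [norm_mul, Complex.norm_I, one_mul, Complex.norm_real, Real.norm_eq_abs, sq_abs] at h1
    nlinarith [sq_nonneg x]
  · push Not at h
    have h1 : ‖Complex.exp (Complex.I * x) - 1 - Complex.I * x‖ ≤ |x| + |x| := by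
      refine (norm_sub_le _ _).trans (add_le_add Real.norm_exp_I_mul_ofReal_sub_one_le ?_)
      simp
    have h2 : |x| ≤ x ^ 2 := by
      rw [← sq_abs]; nlinarith
    nlinarith

/-- `∫₀^τ e^{iκ(r-τ)} dr`. -/
def duhamelZero (κ τ : ℝ) : ℂ := ∫ r in (0 : ℝ)..τ, Complex.exp (Complex.I * (κ * (r - τ) : ℝ))

/-- `∫₀^τ e^{iκ(r-τ)} (r - τ/2)/τ dr`. -/
def duhamelOne (κ τ : ℝ) : ℂ :=
  ∫ r in (0 : ℝ)..τ, Complex.exp (Complex.I * (κ * (r - τ) : ℝ)) * (((r - τ / 2) / τ : ℝ) : ℂ)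

theorem integral_linear_mid (τ : ℝ) : ∫ r in (0 : ℝ)..τ, (((r - τ / 2) : ℝ) : ℂ) = 0 := by
  rw [intervalIntegral.integral_ofReal, intervalIntegral.integral_sub (by simp) (by simp),
    integral_id, intervalIntegral.integral_const]
  norm_num

  ring

/-- Midpoint rule: the first-order term around `τ/2` has integral zero and can be subtracted,
leaving the quadratic remainder of the exponential. -/
theorem norm_duhamelZero_sub_le {κ τ : ℝ} (hτ : 0 < τ) :
    ‖duhamelZero κ τ - τ * Complex.exp (Complex.I * (-(κ * τ) / 2 : ℝ))‖ ≤ τ * (κ * τ) ^ 2 := by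
  set E := Complex.exp (Complex.I * (-(κ * τ) / 2 : ℝ)) with hE
  have e1 : duhamelZero κ τ - τ * E = ∫ r in (0 : ℝ)..τ,
      (Complex.exp (Complex.I * (κ * (r - τ) : ℝ)) - E - E * Complex.I * κ * ((r - τ / 2 : ℝ) : ℂ)) := by
    rw [intervalIntegral.integral_sub, intervalIntegral.integral_sub,
      intervalIntegral.integral_const_mul, integral_linear_mid, intervalIntegral.integral_const]
    · simp [duhamelZero]
    · exact (by fun_prop : Continuous _).intervalIntegrable _ _
    · simp
    · exact (by fun_prop : Continuous _).intervalIntegrable _ _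
    · exact (by fun_prop : Continuous _).intervalIntegrable _ _
  rw [e1]
  have h := intervalIntegral.norm_integral_le_of_norm_le_const (a := 0) (b := τ)
    (C := (κ * τ) ^ 2) (f := fun r : ℝ => Complex.exp (Complex.I * (κ * (r - τ) : ℝ)) - E
      - E * Complex.I * κ * ((r - τ / 2 : ℝ) : ℂ)) (fun r hr => ?_)
  · rw [sub_zero, abs_of_pos hτ] at h
    linarith
  · rw [uIoc_of_le hτ.le] at hr
    have e2 : Complex.exp (Complex.I * (κ * (r - τ) : ℝ)) - E
        - E * Complex.I * κ * ((r - τ / 2 : ℝ) : ℂ)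
        = E * (Complex.exp (Complex.I * ((κ * (r - τ / 2) : ℝ) : ℂ)) - 1
          - Complex.I * ((κ * (r - τ / 2) : ℝ) : ℂ)) := by
      have e3 : Complex.exp (Complex.I * (κ * (r - τ) : ℝ))
          = E * Complex.exp (Complex.I * ((κ * (r - τ / 2) : ℝ) : ℂ)) := by
        rw [hE, ← Complex.exp_add]
        congr 1
        push_cast; ring
      rw [e3]
      push_cast; ring
    rw [e2, norm_mul, hE, norm_cexp_I_mul, one_mul]
    refine (norm_cexp_sub_linear_le _).trans ?_
    have : (r - τ / 2) ^ 2 ≤ (τ / 2) ^ 2 := by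
      rw [sq_le_sq, abs_of_pos (by linarith : 0 < τ / 2), abs_le]
      constructor <;> linarith [hr.1, hr.2]
    have h3 : 0 ≤ κ ^ 2 := sq_nonneg κ
    rw [mul_pow, mul_pow]
    nlinarith

/-- The weight `(r - τ/2)/τ` has mean zero, so the midpoint value of the exponential may be
subtracted; this gains the factor `κτ`. -/
theorem norm_duhamelOne_le {κ τ : ℝ} (hτ : 0 < τ) (hκ : 0 ≤ κ) :
    ‖duhamelOne κ τ‖ ≤ τ * (κ * τ) := by
  set E := Complex.exp (Complex.I * (-(κ * τ) / 2 : ℝ)) with hE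
  have e1 : duhamelOne κ τ = ∫ r in (0 : ℝ)..τ,
      (Complex.exp (Complex.I * (κ * (r - τ) : ℝ)) - E) * (((r - τ / 2) / τ : ℝ) : ℂ) := by
    have e0 : ∫ r in (0 : ℝ)..τ, (((r - τ / 2) / τ : ℝ) : ℂ) = 0 := by
      have := integral_linear_mid τ
      simp only [Complex.ofReal_div, intervalIntegral.integral_div]
      rw [this, zero_div]
    simp only [sub_mul]
    rw [intervalIntegral.integral_sub, intervalIntegral.integral_const_mul, e0, mul_zero, sub_zero]
    · rfl
    · exact (by fun_prop : Continuous _).intervalIntegrable _ _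
    · exact (by fun_prop : Continuous _).intervalIntegrable _ _
  rw [e1]
  have h := intervalIntegral.norm_integral_le_of_norm_le_const (a := 0) (b := τ)
    (C := (κ * τ)) (f := fun r : ℝ => (Complex.exp (Complex.I * (κ * (r - τ) : ℝ)) - E)
      * (((r - τ / 2) / τ : ℝ) : ℂ)) (fun r hr => ?_)
  · rw [sub_zero, abs_of_pos hτ] at h
    linarith
  · rw [uIoc_of_le hτ.le] at hr
    have h1 := norm_cexp_sub_cexp_le (κ * (r - τ)) (-(κ * τ) / 2)
    have h2 : |r - τ / 2| ≤ τ / 2 := by rw [abs_le]; constructor <;> linarith [hr.1, hr.2]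
    have h3 : |κ * (r - τ) - -(κ * τ) / 2| ≤ κ * τ := by
      have : κ * (r - τ) - -(κ * τ) / 2 = κ * (r - τ / 2) := by ring
      rw [this, abs_mul, abs_of_nonneg hκ]
      exact mul_le_mul_of_nonneg_left (by linarith) hκ
    have h4 : ‖(((r - τ / 2) / τ : ℝ) : ℂ)‖ ≤ 1 := by
      rw [Complex.norm_real, Real.norm_eq_abs, abs_div, abs_of_pos hτ, div_le_one hτ]
      linarith
    rw [norm_mul]
    calc _ ≤ (κ * τ) * 1 := mul_le_mul (h1.trans h3) h4 (norm_nonneg _)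
          (mul_nonneg hκ hτ.le)
      _ = κ * τ := mul_one _

/-- The modulus is `2 sin(θ/2)`, and Jordan's inequality applies up to `θ = π`. The upper limit is
what the step restriction has to guarantee. -/
theorem le_norm_cexp_sub_one {θ : ℝ} (h0 : 0 ≤ θ) (hπ : θ ≤ Real.pi) :
    2 / Real.pi * θ ≤ ‖Complex.exp (Complex.I * (-θ : ℝ)) - 1‖ := by
  rw [Complex.norm_exp_I_mul_ofReal_sub_one, neg_div, Real.sin_neg, mul_neg, norm_neg]
  have h1 := Real.mul_le_sin (x := θ / 2) (by linarith) (by linarith)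
  refine le_trans ?_ (le_abs_self _)
  linarith

/-- The symbol of the dominant part of the local error. -/
def defectSym (κ τ : ℝ) : ℂ :=
  -Complex.I * (duhamelZero κ τ - τ * Complex.exp (Complex.I * (-(κ * τ) / 2 : ℝ)))

/-- The symbol of the correction absorbing the dominant part of the local error. -/
def corrSym (κ τ : ℝ) : ℂ := defectSym κ τ / (Complex.exp (Complex.I * (-(κ * τ) : ℝ)) - 1)

theorem norm_defectSym_le {κ τ : ℝ} (hτ : 0 < τ) : ‖defectSym κ τ‖ ≤ τ * (κ * τ) ^ 2 := by
  rw [defectSym, norm_mul, norm_neg, Complex.norm_I, one_mul]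
  exact norm_duhamelZero_sub_le hτ

/-- The defect is quadratic in `κτ` while the denominator vanishes only linearly, so one power of
`κτ` survives the division. -/
theorem norm_corrSym_le {κ τ : ℝ} (hτ : 0 < τ) (hκ : 0 ≤ κ) (hπ : κ * τ ≤ Real.pi) :
    ‖corrSym κ τ‖ ≤ 2 * (τ * (κ * τ)) := by
  have hθ : 0 ≤ κ * τ := mul_nonneg hκ hτ.le
  rw [corrSym, norm_div]
  -- At the zero mode the denominator vanishes, and division by zero returns `0`.
  by_cases h0 : κ * τ = 0
  · rw [h0]; simp
  have hpos : 0 < κ * τ := lt_of_le_of_ne hθ (Ne.symm h0)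
  have h1 := le_norm_cexp_sub_one hθ hπ
  have h2 := norm_defectSym_le (κ := κ) hτ
  have hp := Real.pi_pos
  have hd : 0 < 2 / Real.pi * (κ * τ) := by positivity
  rw [div_le_iff₀ (hd.trans_le h1)]
  refine h2.trans ?_
  have h3 : (1 : ℝ) ≤ 2 * (2 / Real.pi) := by
    rw [← mul_div_assoc, le_div_iff₀ hp]
    linarith [Real.pi_le_four]
  calc τ * (κ * τ) ^ 2 = 1 * (τ * (κ * τ) ^ 2) := (one_mul _).symm
    _ ≤ 2 * (2 / Real.pi) * (τ * (κ * τ) ^ 2) := by gcongr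
    _ = 2 * (τ * (κ * τ)) * (2 / Real.pi * (κ * τ)) := by ring
    _ ≤ _ := by gcongr

/-- The convention for division by zero does no harm at `κτ = 0`, because the defect vanishes there
as well. -/
theorem corrSym_mul {κ τ : ℝ} (hτ : 0 < τ) (hκ : 0 ≤ κ) (hπ : κ * τ ≤ Real.pi) :
    corrSym κ τ * (Complex.exp (Complex.I * (-(κ * τ) : ℝ)) - 1) = defectSym κ τ := by
  have hθ : 0 ≤ κ * τ := mul_nonneg hκ hτ.le
  by_cases h0 : κ * τ = 0
  · have h2 := norm_defectSym_le (κ := κ) hτ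
    rw [h0] at h2
    have : defectSym κ τ = 0 := by
      rw [← norm_le_zero_iff]; simpa using h2
    rw [this, h0]; simp
  have hpos : 0 < κ * τ := lt_of_le_of_ne hθ (Ne.symm h0)
  have h1 := le_norm_cexp_sub_one hθ hπ
  have hp := Real.pi_pos
  have hd : 0 < 2 / Real.pi * (κ * τ) := by positivity
  rw [corrSym, div_mul_cancel₀]
  exact norm_pos_iff.1 (hd.trans_le h1)

end Symbols

/-! ### The scheme on trigonometric polynomials and the data of a solution. -/

section Scheme

variable {L : ℝ} [hL : Fact (0 < L)]

/-- The right-hand side `V u + β |u|² u`. -/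
def force (V : PerC L) (β : ℝ) (u : PerC L) : PerC L := V * u + (β : ℂ) • (u * star u * u)

/-- Half a step of the free flow. -/
def freeSym (L τ : ℝ) (l : ℤ) : ℂ := Complex.exp (Complex.I * (-(freqL L l ^ 2 * τ) / 2 : ℝ))

/-- Half a step of the free flow, restricted to `freq N`. -/
def free (N : ℕ) (τ : ℝ) : PerC L →L[ℂ] PerC L := mult (freq N) (freeSym L τ)

/-- The orthogonal projection to the frequencies in `freq N`. -/
def proj (N : ℕ) : PerC L →L[ℂ] PerC L := mult (freq N) 1

/-- The flow of the cubic nonlinearity. -/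
def nonlin (β τ : ℝ) (w : PerC L) : PerC L :=
  w * cexp ((-(Complex.I * τ * β)) • (w * star w))

/-- One step of the scheme on trigonometric polynomials. -/
def strang (V : PerC L) (β : ℝ) (N : ℕ) (τ : ℝ) (φ : PerC L) : PerC L :=
  free N τ (cexp ((-(Complex.I * τ)) • V) * interpC N (nonlin β τ (free N τ φ)))

/-- The dominant part of the local error. -/
def defect (N : ℕ) (τ : ℝ) : PerC L →L[ℂ] PerC L :=
  mult (freq N) fun l => defectSym (freqL L l ^ 2) τ

/-- The correction absorbing the dominant part of the local error. -/
def corr (N : ℕ) (τ : ℝ) : PerC L →L[ℂ] PerC L :=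
  mult (freq N) fun l => corrSym (freqL L l ^ 2) τ

theorem norm_freeSym (τ : ℝ) (l : ℤ) : ‖freeSym L τ l‖ = 1 := norm_cexp_I_mul _

theorem freeSym_sq (τ : ℝ) (l : ℤ) :
    freeSym L τ l * freeSym L τ l = Complex.exp (Complex.I * (-(freqL L l ^ 2 * τ) : ℝ)) := by
  rw [freeSym, ← Complex.exp_add]
  congr 1
  push_cast; ring

theorem freqL_sq_le (l : ℤ) : freqL L l ^ 2 ≤ (2 * Real.pi / L) ^ 2 * wt l ^ 2 := by
  have e : freqL L l ^ 2 = (2 * Real.pi / L) ^ 2 * |(l : ℝ)| ^ 2 := by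
    rw [freqL, sq_abs]; ring
  rw [e]
  gcongr
  unfold wt; linarith

/-- Resolved frequencies satisfy `|μ_l| ≤ π/h`, and `τ ≤ h²/π` turns this into exactly the range
where the denominator `e^{-iκτ} - 1` stays controlled. -/
theorem freqL_sq_mul_le {N : ℕ} (hN : 0 < N) (hE : Even N) {τ : ℝ}
    (hcfl : τ ≤ (L / N) ^ 2 / Real.pi) {l : ℤ} (hl : l ∈ freq N) :
    freqL L l ^ 2 * τ ≤ Real.pi := by
  have hL' := hL.out
  have hN' : (0 : ℝ) < N := by exact_mod_cast hN
  have hp := Real.pi_pos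
  have h1 := abs_le_of_mem_freq hE hl
  have h2 : |(l : ℝ)| ^ 2 ≤ (N / 2) ^ 2 := pow_le_pow_left₀ (abs_nonneg _) h1 2
  have e : freqL L l ^ 2 = (2 * Real.pi / L) ^ 2 * |(l : ℝ)| ^ 2 := by
    rw [freqL, sq_abs]; ring
  calc freqL L l ^ 2 * τ ≤ freqL L l ^ 2 * ((L / N) ^ 2 / Real.pi) := by gcongr
    _ ≤ (2 * Real.pi / L) ^ 2 * (N / 2) ^ 2 * ((L / N) ^ 2 / Real.pi) := by rw [e]; gcongr
    _ = Real.pi := by field_simp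

/-- Regularity of a solution of the Gross-Pitaevskii equation on the circle. -/
structure TimeData (T β : ℝ) (σ : ℕ) (V : PerC L) (u : ℝ → PerC L) : Prop where
  real : star V = V
  bdV : ∃ C, Bd (2 + σ) V C
  bdu : ∃ C, ∀ t ∈ Icc 0 T, Bd (4 + σ) (u t) C
  lip : ∃ C, 0 ≤ C ∧ ∀ t ∈ Icc 0 T, ∀ s ∈ Icc 0 T, Bd (2 + σ) (u t - u s) (C * |t - s|)
  second : ∃ C, 0 ≤ C ∧ ∀ t τ θ : ℝ, 0 ≤ t → 0 < τ → t + τ ≤ T → 0 ≤ θ → θ ≤ 1 →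
    Bd σ (u (t + θ * τ) - ((1 - θ : ℝ) : ℂ) • u t - ((θ : ℝ) : ℂ) • u (t + τ)) (C * τ ^ 2)
  ode : ∀ l, ∀ t ∈ Icc 0 T, HasDerivWithinAt (fun t => coeff l (u t))
    (-Complex.I * ((freqL L l : ℂ) ^ 2 * coeff l (u t) + coeff l (force V β (u t)))) (Icc 0 T) t

end Scheme

/-! ### Second differences in time. -/

section SecondDifferences

variable {L : ℝ} [hL : Fact (0 < L)] {ι : Type*}

/-- Values at two times and at an intermediate time of a function of time that is Lipschitz in `H¹`
and has second differences of order two in `H^s`. -/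
structure SecDiff (s : ℕ) (τ θ : ι → ℝ) (a₀ a₁ a : ι → PerC L) : Prop where
  bd₀ : BigO 1 a₀ fun _ => 1
  bd₁ : BigO 1 a₁ fun _ => 1
  bd : BigO 1 a fun _ => 1
  lip : BigO 1 (fun i => a₁ i - a₀ i) τ
  second : BigO s (fun i => a i - ((1 - θ i : ℝ) : ℂ) • a₀ i - ((θ i : ℝ) : ℂ) • a₁ i)
    fun i => τ i ^ 2

variable {s : ℕ} {τ θ : ι → ℝ} {a₀ a₁ a b₀ b₁ b : ι → PerC L}

theorem SecDiff.add (h : SecDiff s τ θ a₀ a₁ a) (h' : SecDiff s τ θ b₀ b₁ b) :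
    SecDiff s τ θ (fun i => a₀ i + b₀ i) (fun i => a₁ i + b₁ i) fun i => a i + b i where
  bd₀ := h.bd₀.add h'.bd₀
  bd₁ := h.bd₁.add h'.bd₁
  bd := h.bd.add h'.bd
  lip := (h.lip.add h'.lip).congr fun i => by abel
  second := (h.second.add h'.second).congr fun i => by rw [smul_add, smul_add]; abel

theorem SecDiff.const_smul (h : SecDiff s τ θ a₀ a₁ a) (c : ℂ) :
    SecDiff s τ θ (fun i => c • a₀ i) (fun i => c • a₁ i) fun i => c • a i where
  bd₀ := h.bd₀.const_smul c
  bd₁ := h.bd₁.const_smul c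
  bd := h.bd.const_smul c
  lip := (h.lip.const_smul c).congr fun i => by rw [smul_sub]
  second := (h.second.const_smul c).congr fun i => by
    rw [smul_sub, smul_sub, smul_comm c, smul_comm c]

theorem SecDiff.star (h : SecDiff s τ θ a₀ a₁ a) :
    SecDiff s τ θ (fun i => star (a₀ i)) (fun i => star (a₁ i)) fun i => star (a i) where
  bd₀ := h.bd₀.star
  bd₁ := h.bd₁.star
  bd := h.bd.star
  lip := h.lip.star.congr fun i => by rw [star_sub]
  second := h.second.star.congr fun i => by simp

theorem secDiff_const {w : PerC L} {M : ℝ} (hw : Bd 1 w M) (hτ : ∀ i, 0 ≤ τ i) :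
    SecDiff s τ θ (fun _ => w) (fun _ => w) fun _ => w where
  bd₀ := bigO_const hw
  bd₁ := bigO_const hw
  bd := bigO_const hw
  lip := ⟨hτ, 0, le_rfl, fun i => by simpa using bd_zero 1⟩
  second := ⟨fun _ => sq_nonneg _, 0, le_rfl, fun i => by
    have : w - ((1 - θ i : ℝ) : ℂ) • w - ((θ i : ℝ) : ℂ) • w = 0 := by
      push_cast; module
    beta_reduce; rw [this]; simpa using bd_zero s⟩

/-- With linear interpolants `ā`, `b̄`, the second difference of `ab` is `(a - ā)b + ā(b - b̄) -
θ(1-θ)(a₁-a₀)(b₁-b₀)`. The last term is `O(τ²)` by the Lipschitz bounds in `H¹`. -/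
theorem SecDiff.mul (hs : s ≤ 1) (hθ : ∀ i, 0 ≤ θ i) (hθ' : ∀ i, θ i ≤ 1)
    (h : SecDiff s τ θ a₀ a₁ a) (h' : SecDiff s τ θ b₀ b₁ b) :
    SecDiff s τ θ (fun i => a₀ i * b₀ i) (fun i => a₁ i * b₁ i) fun i => a i * b i where
  bd₀ := h.bd₀.mul_one le_rfl h'.bd₀
  bd₁ := h.bd₁.mul_one le_rfl h'.bd₁
  bd := h.bd.mul_one le_rfl h'.bd
  lip := ((h.lip.mul_one le_rfl h'.bd₁).add (h.bd₀.one_mul le_rfl h'.lip)).congr fun i => by ring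
  second := by
    have hc : ∀ i, ‖((θ i : ℝ) : ℂ)‖ ≤ 1 * (1 : ℝ) := fun i => by
      rw [Complex.norm_real, Real.norm_eq_abs, abs_of_nonneg (hθ i)]; linarith [hθ' i]
    have hc' : ∀ i, ‖((1 - θ i : ℝ) : ℂ)‖ ≤ 1 * (1 : ℝ) := fun i => by
      rw [Complex.norm_real, Real.norm_eq_abs, abs_of_nonneg] <;> linarith [hθ i, hθ' i]
    have hm : BigO 1 (fun i => ((1 - θ i : ℝ) : ℂ) • a₀ i + ((θ i : ℝ) : ℂ) • a₁ i) fun _ => 1 := by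
      have h1 := h.bd₀.smul (ρ' := fun _ => 1) 1 zero_le_one (fun _ => zero_le_one) hc'
      have h2 := h.bd₁.smul (ρ' := fun _ => 1) 1 zero_le_one (fun _ => zero_le_one) hc
      simpa using h1.add h2
    have h1 := h'.bd.one_mul_low hs h.second
    have h2 := hm.one_mul_low hs h'.second
    have h3 : BigO s (fun i => ((θ i : ℝ) : ℂ) • ((1 - θ i : ℝ) : ℂ) •
        ((a₁ i - a₀ i) * (b₁ i - b₀ i))) fun i => τ i ^ 2 := by
      have h4 := ((h.lip.mul le_rfl h'.lip).smul (ρ' := fun _ => 1) 1 zero_le_one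
        (fun _ => zero_le_one) hc').smul (ρ' := fun _ => 1) 1 zero_le_one
        (fun _ => zero_le_one) hc
      simpa [sq] using h4.lower hs
    refine ((h1.add h2).sub h3).congr fun i => ?_
    ext x
    simp
    ring

end SecondDifferences

/-! ### Estimates of the force. -/

section ForceBounds

variable {L : ℝ} [hL : Fact (0 < L)] {ι : Type*} {V : PerC L} {β : ℝ}

theorem bigO_force {s : ℕ} (hs : 1 ≤ s) {M : ℝ} (hV : Bd s V M) {u : ι → PerC L}
    (hu : BigO s u fun _ => 1) : BigO s (fun i => force V β (u i)) fun _ => 1 :=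
  ((bigO_const hV).mul_one hs hu).add
    (((hu.mul_one hs hu.star).mul_one hs hu).const_smul _)

theorem bigO_force_sub {s : ℕ} (hs : 1 ≤ s) {M : ℝ} (hV : Bd s V M) {u v : ι → PerC L}
    {ρ : ι → ℝ} (hu : BigO s u fun _ => 1) (hv : BigO s v fun _ => 1)
    (huv : BigO s (fun i => u i - v i) ρ) :
    BigO s (fun i => force V β (u i) - force V β (v i)) ρ := by
  have h1 := (bigO_const (ι := ι) hV).one_mul hs huv
  have h2 := (((hu.mul_one hs hu.star).one_mul hs huv).add
    ((hv.mul_one hs hu.star).one_mul hs huv)).add ((hv.mul_one hs hv).one_mul hs huv.star)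
  refine (h1.add (h2.const_smul (β : ℂ))).congr fun i => ?_
  ext x
  simp [force]
  ring

/-- The difference is multiplied only by functions bounded in `H¹`, so it may be measured in `L²`
alone. -/
theorem bigO_force_sub_low {s : ℕ} (hs : s ≤ 1) {M : ℝ} (hV : Bd 1 V M) {u v : ι → PerC L}
    {ρ : ι → ℝ} (hu : BigO 1 u fun _ => 1) (hv : BigO 1 v fun _ => 1)
    (huv : BigO s (fun i => u i - v i) ρ) :
    BigO s (fun i => force V β (u i) - force V β (v i)) ρ := by
  have h1 := (bigO_const (ι := ι) hV).one_mul_low hs huv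
  have h2 := (((hu.mul_one le_rfl hu.star).one_mul_low hs huv).add
    ((hv.mul_one le_rfl hu.star).one_mul_low hs huv)).add
    ((hv.mul_one le_rfl hv).one_mul_low hs huv.star)
  refine (h1.add (h2.const_smul (β : ℂ))).congr fun i => ?_
  ext x
  simp [force]
  ring

theorem SecDiff.force {s : ℕ} (hs : s ≤ 1) {τ θ : ι → ℝ} {u₀ u₁ u : ι → PerC L}
    (hτ : ∀ i, 0 ≤ τ i) (hθ : ∀ i, 0 ≤ θ i) (hθ' : ∀ i, θ i ≤ 1) {M : ℝ} (hV : Bd 1 V M)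
    (h : SecDiff s τ θ u₀ u₁ u) :
    SecDiff s τ θ (fun i => force V β (u₀ i)) (fun i => force V β (u₁ i))
      fun i => PeriodicSobolev.force V β (u i) :=
  ((secDiff_const hV hτ).mul hs hθ hθ' h).add
    (((h.mul hs hθ hθ' h.star).mul hs hθ hθ' h).const_smul _)

end ForceBounds

/-! ### Time regularity of the force along the solution. -/

section TimeBounds

variable {L : ℝ} [hL : Fact (0 < L)] {T β : ℝ} {σ : ℕ} {V : PerC L} {u : ℝ → PerC L}

theorem TimeData.bigO (D : TimeData T β σ V u) {ι : Type*} {t : ι → ℝ}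
    (ht : ∀ i, t i ∈ Icc 0 T) : BigO (4 + σ) (fun i => u (t i)) fun _ => 1 := by
  obtain ⟨C, hC⟩ := D.bdu
  refine ⟨fun _ => zero_le_one, max C 0, le_max_right _ _, fun i => ?_⟩
  exact (hC _ (ht i)).mono (by simp)

theorem TimeData.bigO_sub (D : TimeData T β σ V u) {ι : Type*} {t s ρ : ι → ℝ}
    (ht : ∀ i, t i ∈ Icc 0 T) (hs : ∀ i, s i ∈ Icc 0 T) (hρ : ∀ i, |t i - s i| ≤ ρ i) :
    BigO (2 + σ) (fun i => u (t i) - u (s i)) ρ := by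
  obtain ⟨C, hC, h⟩ := D.lip
  exact ⟨fun i => (abs_nonneg _).trans (hρ i), C, hC, fun i =>
    (h _ (ht i) _ (hs i)).mono (mul_le_mul_of_nonneg_left (hρ i) hC)⟩

theorem TimeData.bigO_force (D : TimeData T β σ V u) {ι : Type*} {t : ι → ℝ}
    (ht : ∀ i, t i ∈ Icc 0 T) : BigO (2 + σ) (fun i => force V β (u (t i))) fun _ => 1 := by
  obtain ⟨C, hC⟩ := D.bdV
  exact PeriodicSobolev.bigO_force (by omega) hC ((D.bigO ht).lower (by omega))

theorem TimeData.bigO_force_sub (D : TimeData T β σ V u) {ι : Type*} {t s ρ : ι → ℝ}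
    (ht : ∀ i, t i ∈ Icc 0 T) (hs : ∀ i, s i ∈ Icc 0 T) (hρ : ∀ i, |t i - s i| ≤ ρ i) :
    BigO (2 + σ) (fun i => force V β (u (t i)) - force V β (u (s i))) ρ := by
  obtain ⟨C, hC⟩ := D.bdV
  exact PeriodicSobolev.bigO_force_sub (by omega) hC ((D.bigO ht).lower (by omega))
    ((D.bigO hs).lower (by omega)) (D.bigO_sub ht hs hρ)

/-- An interval `[t, t + τ]` in `[0, T]` with an intermediate point. -/
structure SubInterval (T : ℝ) where
  t : ℝ
  τ : ℝ
  θ : ℝ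
  t_nonneg : 0 ≤ t
  τ_pos : 0 < τ
  le_T : t + τ ≤ T
  θ_nonneg : 0 ≤ θ
  θ_le : θ ≤ 1

/-- The force is a polynomial in `u`, its conjugate and the constant-in-time `V`, and
second-difference bounds are stable under sums, products and conjugation. -/
theorem TimeData.force_second (D : TimeData T β σ V u) (hσ : σ ≤ 1) :
    ∃ C, 0 ≤ C ∧ ∀ i : SubInterval T, Bd σ (force V β (u (i.t + i.θ * i.τ))
      - ((1 - i.θ : ℝ) : ℂ) • force V β (u i.t)
      - ((i.θ : ℝ) : ℂ) • force V β (u (i.t + i.τ))) (C * i.τ ^ 2) := by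
  have h0 : ∀ i : SubInterval T, i.t ∈ Icc 0 T := fun i =>
    ⟨i.t_nonneg, by linarith [i.le_T, i.τ_pos]⟩
  have h1 : ∀ i : SubInterval T, i.t + i.τ ∈ Icc 0 T := fun i =>
    ⟨by linarith [i.t_nonneg, i.τ_pos], i.le_T⟩
  have hs : ∀ i : SubInterval T, i.t + i.θ * i.τ ∈ Icc 0 T := fun i => by
    have e1 := mul_nonneg i.θ_nonneg i.τ_pos.le
    have e2 := mul_le_of_le_one_left i.τ_pos.le i.θ_le
    exact ⟨by linarith [i.t_nonneg], by linarith [i.le_T]⟩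
  obtain ⟨C, hC, hsec⟩ := D.second
  obtain ⟨M, hM⟩ := D.bdV
  have hS : SecDiff σ (fun i : SubInterval T => i.τ) (fun i => i.θ) (fun i => u i.t)
      (fun i => u (i.t + i.τ)) (fun i => u (i.t + i.θ * i.τ)) :=
    { bd₀ := (D.bigO h0).lower (by omega)
      bd₁ := (D.bigO h1).lower (by omega)
      bd := (D.bigO hs).lower (by omega)
      lip := (D.bigO_sub h1 h0 fun i => by
        rw [add_sub_cancel_left, abs_of_pos i.τ_pos]).lower (by omega)
      second := ⟨fun i => sq_nonneg _, C, hC, fun i =>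
        hsec i.t i.τ i.θ i.t_nonneg i.τ_pos i.le_T i.θ_nonneg i.θ_le⟩ }
  exact (hS.force hσ (fun i => i.τ_pos.le) (fun i => i.θ_nonneg) (fun i => i.θ_le)
    (hM.lower (by omega)) (β := β)).second.2

end TimeBounds

/-! ### Explicit solution of a single forced mode. -/

section ForcedMode

/-- The solution of a forced mode equation. -/
theorem hasDerivAt_forced (κ : ℝ) {G : ℝ → ℂ} (hG : Continuous G) (c : ℂ) (r : ℝ) :
    HasDerivAt (fun r : ℝ => Complex.exp (Complex.I * (-(κ * r) : ℝ)) *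
      (c - Complex.I * ∫ x in (0 : ℝ)..r, Complex.exp (Complex.I * (κ * x : ℝ)) * G x))
      (-Complex.I * (κ * (Complex.exp (Complex.I * (-(κ * r) : ℝ)) *
        (c - Complex.I * ∫ x in (0 : ℝ)..r, Complex.exp (Complex.I * (κ * x : ℝ)) * G x)) + G r))
      r := by
  have hc : Continuous fun x : ℝ => Complex.exp (Complex.I * (κ * x : ℝ)) * G x := by fun_prop
  have h1 := (hc.integral_hasStrictDerivAt 0 r).hasDerivAt
  have h2 : HasDerivAt (fun r : ℝ => Complex.exp (Complex.I * (-(κ * r) : ℝ)))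
      (Complex.exp (Complex.I * (-(κ * r) : ℝ)) * (Complex.I * (-(κ * 1) : ℝ))) r :=
    (((((hasDerivAt_id r).const_mul κ).neg).ofReal_comp).const_mul Complex.I).cexp
  have h3 := h2.mul ((h1.const_mul Complex.I).const_sub c)
  convert! h3 using 1
  have e : Complex.exp (Complex.I * (-(κ * r) : ℝ)) * Complex.exp (Complex.I * (κ * r : ℝ)) = 1 := by
    rw [← Complex.exp_add, ← Complex.exp_zero]
    congr 1
    push_cast; ring
  push_cast at e ⊢
  linear_combination Complex.I * G r * e

/-- For a force that is affine in time, Duhamel's integral is exactly two multipliers, one for the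
midpoint value and one for the increment. -/
theorem forced_linear_value (κ : ℝ) {τ : ℝ} (α δ c : ℂ) :
    Complex.exp (Complex.I * (-(κ * τ) : ℝ)) * (c - Complex.I * ∫ x in (0 : ℝ)..τ,
      Complex.exp (Complex.I * (κ * x : ℝ)) * (α + (((x - τ / 2) / τ : ℝ) : ℂ) * δ))
      = Complex.exp (Complex.I * (-(κ * τ) : ℝ)) * c
        - Complex.I * (duhamelZero κ τ * α + duhamelOne κ τ * δ) := by
  have e : Complex.exp (Complex.I * (-(κ * τ) : ℝ)) * ∫ x in (0 : ℝ)..τ,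
      Complex.exp (Complex.I * (κ * x : ℝ)) * (α + (((x - τ / 2) / τ : ℝ) : ℂ) * δ)
      = duhamelZero κ τ * α + duhamelOne κ τ * δ := by
    rw [duhamelZero, duhamelOne, ← intervalIntegral.integral_const_mul,
      ← intervalIntegral.integral_mul_const, ← intervalIntegral.integral_mul_const,
      ← intervalIntegral.integral_add]
    · congr 1
      ext x
      have e1 : Complex.exp (Complex.I * (κ * (x - τ) : ℝ))
          = Complex.exp (Complex.I * (-(κ * τ) : ℝ)) * Complex.exp (Complex.I * (κ * x : ℝ)) := by
        rw [← Complex.exp_add]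
        congr 1
        push_cast; ring
      rw [e1]; ring
    · exact (by fun_prop : Continuous _).intervalIntegrable _ _
    · exact (by fun_prop : Continuous _).intervalIntegrable _ _
  rw [← e]; ring

end ForcedMode

/-- A time step of an admissible discretisation. -/
structure StepIdx (L T : ℝ) where
  N : ℕ
  τ : ℝ
  t : ℝ
  N_pos : 0 < N
  even : Even N
  τ_pos : 0 < τ
  cfl : τ ≤ (L / N) ^ 2 / Real.pi
  t_nonneg : 0 ≤ t
  le_T : t + τ ≤ T

namespace StepIdx

variable {L T : ℝ} [hL : Fact (0 < L)] (i : StepIdx L T)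

/-- The mesh size. -/
def h : ℝ := L / i.N

theorem cast_pos : (0 : ℝ) < i.N := by exact_mod_cast i.N_pos

theorem h_pos : 0 < i.h := div_pos hL.out i.cast_pos

theorem h_le : i.h ≤ L := by
  have : (1 : ℝ) ≤ i.N := by exact_mod_cast i.N_pos
  exact div_le_self hL.out.le this

theorem τ_le_sq : i.τ ≤ i.h ^ 2 := by
  refine i.cfl.trans ?_
  have h1 : 1 ≤ Real.pi := by linarith [Real.pi_gt_three]
  exact div_le_self (sq_nonneg _) h1

theorem τ_sq_le : i.τ ^ 2 ≤ i.h ^ 4 := by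
  calc i.τ ^ 2 ≤ (i.h ^ 2) ^ 2 := pow_le_pow_left₀ i.τ_pos.le i.τ_le_sq 2
    _ = i.h ^ 4 := by ring

theorem τ_le_T : i.τ ≤ T := by linarith [i.t_nonneg, i.le_T]

theorem mem_left : i.t ∈ Icc 0 T := ⟨i.t_nonneg, by linarith [i.τ_pos, i.le_T]⟩

theorem mem_right : i.t + i.τ ∈ Icc 0 T := ⟨by linarith [i.τ_pos, i.t_nonneg], i.le_T⟩

theorem mem_mid : i.t + i.τ / 2 ∈ Icc 0 T :=
  ⟨by linarith [i.τ_pos, i.t_nonneg], by linarith [i.τ_pos, i.le_T]⟩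

theorem h4_nonneg : 0 ≤ i.h ^ 4 := pow_nonneg i.h_pos.le 4

theorem τh4_nonneg : 0 ≤ i.τ * i.h ^ 4 := mul_nonneg i.τ_pos.le i.h4_nonneg

end StepIdx

/-! ### Expansion of the exact flow over a step and over half a step. -/

section ExactFlow

variable {L : ℝ} [hL : Fact (0 < L)] {T β : ℝ} {σ : ℕ} {V : PerC L} {u : ℝ → PerC L}

theorem TimeData.ode_shift (D : TimeData T β σ V u) {t τ : ℝ} (ht : 0 ≤ t) (hT : t + τ ≤ T) (l : ℤ)
    {r : ℝ} (hr : r ∈ Icc 0 τ) : HasDerivWithinAt (fun r => coeff l (u (t + r)))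
      (-Complex.I * ((freqL L l : ℂ) ^ 2 * coeff l (u (t + r))
        + coeff l (force V β (u (t + r))))) (Icc 0 τ) r := by
  have h1 := D.ode l (t + r) ⟨by linarith [hr.1], by linarith [hr.2]⟩
  have h2 : HasDerivWithinAt (fun r => t + r) 1 (Icc 0 τ) r :=
    ((hasDerivAt_id r).const_add t).hasDerivWithinAt
  have h3 : MapsTo (fun r => t + r) (Icc 0 τ) (Icc 0 T) := fun x hx =>
    ⟨by linarith [hx.1], by linarith [hx.2]⟩
  have := HasDerivWithinAt.scomp r h1 h2 h3
  simpa [Function.comp_def] using this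

/-- The force is replaced by its affine interpolant, whose mode integrals are known. The multiplier
of the midpoint value splits into the midpoint rule, which the scheme reproduces, and the defect.
The defect is evaluated at the left endpoint so that it can telescope from step to step. -/
theorem exact_step (D : TimeData T β σ V u) (hσ : σ ≤ 1) :
    BigO σ (fun i : StepIdx L T => proj i.N (u (i.t + i.τ)) -
      (free i.N i.τ (free i.N i.τ (proj i.N (u i.t)))
        - (Complex.I * i.τ) • free i.N i.τ (force V β (u (i.t + i.τ / 2)))
        + defect i.N i.τ (force V β (u i.t)))) fun i => i.τ * i.h ^ 4 := by
  obtain ⟨C, hC, hsec⟩ := D.force_second hσ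
  set f₀ : StepIdx L T → PerC L := fun i => force V β (u i.t) with hf₀
  set f₁ : StepIdx L T → PerC L := fun i => force V β (u (i.t + i.τ)) with hf₁
  set fm : StepIdx L T → PerC L := fun i => force V β (u (i.t + i.τ / 2)) with hfm
  set Z : StepIdx L T → PerC L := fun i => proj i.N (u (i.t + i.τ)) -
    (free i.N i.τ (free i.N i.τ (proj i.N (u i.t)))
      - Complex.I • (mult (freq i.N) (fun l => duhamelZero (freqL L l ^ 2) i.τ) (fm i)
        + mult (freq i.N) (fun l => duhamelOne (freqL L l ^ 2) i.τ) (f₁ i - f₀ i))) with hZ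
  have hZb : BigO σ Z fun i => i.τ * i.h ^ 4 := by
    refine ⟨fun i => i.τh4_nonneg, 2 * C, by positivity, fun i => ?_⟩
    -- Difference of the second-difference estimates at `θ = r/τ` and `θ = 1/2`: this recentres the
    -- linear interpolant at the true midpoint value.
    have hb : ∀ r ∈ Icc 0 i.τ, Bd σ (force V β (u (i.t + r)) - fm i
        - (((r - i.τ / 2) / i.τ : ℝ) : ℂ) • (f₁ i - f₀ i)) (2 * C * i.τ ^ 2) := by
      intro r hr
      have hτ := i.τ_pos
      have e1 := hsec ⟨i.t, i.τ, r / i.τ, i.t_nonneg, i.τ_pos, i.le_T, div_nonneg hr.1 hτ.le,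
        (div_le_one hτ).2 hr.2⟩
      have e2 := hsec ⟨i.t, i.τ, 1 / 2, i.t_nonneg, i.τ_pos, i.le_T, by norm_num, by norm_num⟩
      dsimp only at e1 e2
      rw [div_mul_cancel₀ _ hτ.ne'] at e1
      rw [one_div_mul_eq_div] at e2
      have e3 := e1.sub e2
      have hr2 : ((r - i.τ / 2) / i.τ : ℝ) = r / i.τ - 1 / 2 := by field_simp
      convert! e3 using 1
      · rw [hr2]
        simp only [hfm, hf₁, hf₀]
        push_cast
        module
      · ring
    have := duhamel_compare (F := freq i.N) i.τ_pos.le (y := fun r => u (i.t + r))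
      (g := fun r => force V β (u (i.t + r)))
      (R := fun r => force V β (u (i.t + r)) - fm i
        - (((r - i.τ / 2) / i.τ : ℝ) : ℂ) • (f₁ i - f₀ i))
      (Y := fun r l => Complex.exp (Complex.I * (-(freqL L l ^ 2 * r) : ℝ)) *
        (coeff l (u i.t) - Complex.I * ∫ x in (0 : ℝ)..r,
          Complex.exp (Complex.I * (freqL L l ^ 2 * x : ℝ)) *
            (coeff l (fm i) + (((x - i.τ / 2) / i.τ : ℝ) : ℂ) * coeff l (f₁ i - f₀ i))))
      (G := fun r l => coeff l (fm i) + (((r - i.τ / 2) / i.τ : ℝ) : ℂ) * coeff l (f₁ i - f₀ i))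
      (z := Z i) (s := σ) (fun l _ r hr => D.ode_shift i.t_nonneg i.le_T l hr)
      (fun l _ r hr => by
        have := (hasDerivAt_forced (freqL L l ^ 2) (G := fun x => coeff l (fm i)
          + (((x - i.τ / 2) / i.τ : ℝ) : ℂ) * coeff l (f₁ i - f₀ i)) (by fun_prop)
          (coeff l (u i.t)) r).hasDerivWithinAt (s := Icc 0 i.τ)
        simpa using this)
      (fun l _ => by simp)
      (fun r _ l _ => by simp only [map_sub, map_smul, smul_eq_mul]; ring) hb
      (by
        intro l hl
        simp [hZ, proj, free, coeff_mult, hl])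
      (fun l hl => by
        rw [forced_linear_value, ← freeSym_sq]
        simp only [hZ, proj, free, map_sub, map_add, map_smul, coeff_mult, if_pos hl, smul_eq_mul,
          Pi.one_apply, one_mul]
        ring)
    refine this.mono ?_
    have := mul_le_mul_of_nonneg_left i.τ_sq_le i.τ_pos.le
    nlinarith
  have h1 := D.bigO_force_sub (ι := StepIdx L T) (fun i => i.mem_mid) (fun i => i.mem_left)
    (ρ := fun i => i.τ) fun i => by
      rw [add_sub_cancel_left, abs_of_pos (by linarith [i.τ_pos])]; linarith [i.τ_pos]
  have h2 := D.bigO_force_sub (ι := StepIdx L T) (fun i => i.mem_right) (fun i => i.mem_left)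
    (ρ := fun i => i.τ) fun i => by rw [add_sub_cancel_left, abs_of_pos i.τ_pos]
  rw [add_comm] at h1 h2
  set K : ℝ := (2 * Real.pi / L) ^ 2
  have hK : 0 ≤ K := sq_nonneg _
  -- One factor `κτ` of the defect is bounded by `π ≤ 4`, the other costs two derivatives. The third
  -- power of `τ` is the Lipschitz bound of the force in `H^{2+σ}`.
  have h3 : BigO σ (fun i : StepIdx L T => defect i.N i.τ (fm i - f₀ i))
      fun i => i.τ ^ 2 * i.τ := by
    refine h1.mult (k := 2) (4 * K) (by positivity) (fun i => sq_nonneg _) fun i l hl => ?_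
    have hτ := i.τ_pos
    have e1 := norm_defectSym_le (κ := freqL L l ^ 2) hτ
    have e2 := freqL_sq_mul_le i.N_pos i.even i.cfl hl
    have e3 := freqL_sq_le (L := L) l
    have e4 : 0 ≤ freqL L l ^ 2 := sq_nonneg _
    calc _ ≤ i.τ * (freqL L l ^ 2 * i.τ) ^ 2 := e1
      _ = i.τ * ((freqL L l ^ 2 * i.τ) * (freqL L l ^ 2 * i.τ)) := by ring
      _ ≤ i.τ * (4 * ((K * wt l ^ 2) * i.τ)) := by
          gcongr
          exact e2.trans Real.pi_le_four
      _ = _ := by ring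
  have h4 : BigO σ (fun i : StepIdx L T =>
      mult (freq i.N) (fun l => duhamelOne (freqL L l ^ 2) i.τ) (f₁ i - f₀ i))
      fun i => i.τ ^ 2 * i.τ := by
    refine h2.mult (k := 2) K (by positivity) (fun i => sq_nonneg _) fun i l hl => ?_
    have hτ := i.τ_pos
    have e1 := norm_duhamelOne_le (κ := freqL L l ^ 2) hτ (sq_nonneg _)
    have e3 := freqL_sq_le (L := L) l
    calc _ ≤ i.τ * (freqL L l ^ 2 * i.τ) := e1
      _ ≤ i.τ * ((K * wt l ^ 2) * i.τ) := by gcongr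
      _ = _ := by ring
  have h5 : BigO σ (fun i : StepIdx L T => defect i.N i.τ (fm i - f₀ i) - Complex.I •
      mult (freq i.N) (fun l => duhamelOne (freqL L l ^ 2) i.τ) (f₁ i - f₀ i))
      fun i => i.τ * i.h ^ 4 :=
    (h3.sub (h4.const_smul _)).mono 1 zero_le_one (fun i => i.τh4_nonneg) fun i => by
      have := mul_le_mul_of_nonneg_left i.τ_sq_le i.τ_pos.le
      linarith
  refine (hZb.add h5).congr fun i => ?_
  have e0 : mult (freq i.N) (fun l => duhamelZero (freqL L l ^ 2) i.τ) (fm i)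
      = Complex.I • defect i.N i.τ (fm i) + (i.τ : ℂ) • free i.N i.τ (fm i) := by
    refine coeff_ext fun l => ?_
    simp only [defect, free, map_add, map_smul, coeff_mult, smul_eq_mul]
    split_ifs
    · rw [defectSym, freeSym]
      have := Complex.I_mul_I
      linear_combination ((duhamelZero (freqL L l ^ 2) i.τ - i.τ * Complex.exp (Complex.I *
        (-(freqL L l ^ 2 * i.τ) / 2 : ℝ))) * coeff l (fm i)) * this
    · simp
  simp only [hZ]
  rw [e0, map_sub (defect i.N i.τ)]
  have hI : Complex.I • Complex.I • defect i.N i.τ (fm i) = -defect i.N i.τ (fm i) := by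
    rw [smul_smul, Complex.I_mul_I, neg_one_smul]
  rw [smul_add, smul_add, hI, mul_smul]
  abel

/-- The comparison equation has the freely transported midpoint force as forcing, so its solution is
linear in `r` in the interaction picture and equals the free flow minus `(iτ/2)f(v)` at `r = τ/2`.
The residual is `O(τ)`: by Lipschitz continuity in time, and because `|1 - e^{iκs}| ≤ κ|s|` costs
two derivatives of the force. -/
theorem half_step (D : TimeData T β σ V u) :
    BigO σ (fun i : StepIdx L T => free i.N i.τ (proj i.N (u i.t)) -
      (u (i.t + i.τ / 2) + (Complex.I * (i.τ / 2)) • force V β (u (i.t + i.τ / 2))))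
      fun i => i.h ^ 4 := by
  set fm : StepIdx L T → PerC L := fun i => force V β (u (i.t + i.τ / 2)) with hfm
  set K : ℝ := (2 * Real.pi / L) ^ 2
  have hK : 0 ≤ K := sq_nonneg _
  set Z : StepIdx L T → PerC L := fun i => proj i.N (u (i.t + i.τ / 2)) -
    (free i.N i.τ (proj i.N (u i.t)) - (Complex.I * (i.τ / 2)) • proj i.N (fm i)) with hZ
  obtain ⟨C₁, hC₁, hl⟩ := (D.bigO_force_sub (ι := StepIdx L T × Icc 0 T × Icc 0 T)
    (t := fun p => p.2.1) (s := fun p => p.2.2) (ρ := fun p => |(p.2.1 : ℝ) - p.2.2|)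
    (fun p => p.2.1.2) (fun p => p.2.2.2) fun p => le_rfl).extract
  obtain ⟨_, C₂, hC₂, hf⟩ := D.bigO_force (ι := StepIdx L T) (fun i => i.mem_mid)
  have hZb : BigO σ Z fun i => i.h ^ 4 := by
    refine ⟨fun i => i.h4_nonneg, C₁ + K * C₂, by positivity, fun i => ?_⟩
    have hτ := i.τ_pos
    have hb : ∀ r ∈ Icc 0 (i.τ / 2), Bd σ (force V β (u (i.t + r)) - fm i
        + mult (freq i.N) (fun l => 1 - Complex.exp (Complex.I *
          (-(freqL L l ^ 2 * (r - i.τ / 2)) : ℝ))) (fm i)) ((C₁ + K * C₂) * i.τ) := by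
      intro r hr
      have hr' : i.t + r ∈ Icc 0 T :=
        ⟨by linarith [hr.1, i.t_nonneg], by linarith [hr.2, i.le_T]⟩
      have e1 := (hl (i, ⟨i.t + r, hr'⟩, ⟨i.t + i.τ / 2, i.mem_mid⟩)).lower
        (s' := σ) (by omega)
      have hra : |i.t + r - (i.t + i.τ / 2)| ≤ i.τ := by
        rw [abs_le]; constructor <;> linarith [hr.1, hr.2]
      have e2 := hf i
      rw [add_comm 2 σ] at e2
      have e3 := e2.mult (S := freq i.N) (m := fun l => 1 - Complex.exp (Complex.I *
          (-(freqL L l ^ 2 * (r - i.τ / 2)) : ℝ))) (c := K * i.τ) (by positivity) (fun l _ => by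
        have h1 := norm_cexp_sub_cexp_le 0 (-(freqL L l ^ 2 * (r - i.τ / 2)))
        rw [Complex.ofReal_zero, mul_zero, Complex.exp_zero] at h1
        refine h1.trans ?_
        have h2 : |r - i.τ / 2| ≤ i.τ := by rw [abs_le]; constructor <;> linarith [hr.1, hr.2]
        rw [zero_sub, neg_neg, abs_mul, abs_of_nonneg (sq_nonneg _)]
        calc _ ≤ (K * wt l ^ 2) * i.τ :=
              mul_le_mul (freqL_sq_le l) h2 (abs_nonneg _)
                (mul_nonneg hK (sq_nonneg _))
          _ = _ := by ring)
      refine (e1.add e3).mono ?_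
      have := mul_le_mul_of_nonneg_left hra hC₁
      dsimp only
      linarith
    have := duhamel_compare (F := freq i.N) (by linarith : 0 ≤ i.τ / 2)
      (y := fun r => u (i.t + r)) (g := fun r => force V β (u (i.t + r)))
      (R := fun r => force V β (u (i.t + r)) - fm i
        + mult (freq i.N) (fun l => 1 - Complex.exp (Complex.I *
          (-(freqL L l ^ 2 * (r - i.τ / 2)) : ℝ))) (fm i))
      (Y := fun r l => Complex.exp (Complex.I * (-(freqL L l ^ 2 * r) : ℝ)) * coeff l (u i.t)
        - Complex.I * r * (Complex.exp (Complex.I * (-(freqL L l ^ 2 * (r - i.τ / 2)) : ℝ))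
          * coeff l (fm i)))
      (G := fun r l => Complex.exp (Complex.I * (-(freqL L l ^ 2 * (r - i.τ / 2)) : ℝ))
        * coeff l (fm i)) (z := Z i) (s := σ)
      (fun l _ r hr => D.ode_shift i.t_nonneg (by linarith [i.le_T]) l hr)
      (fun l _ r hr => by
        have h1 : HasDerivAt (fun r : ℝ => Complex.exp (Complex.I * (-(freqL L l ^ 2 * r) : ℝ)))
            (Complex.exp (Complex.I * (-(freqL L l ^ 2 * r) : ℝ))
              * (Complex.I * (-(freqL L l ^ 2 * 1) : ℝ))) r :=
          (((((hasDerivAt_id r).const_mul _).neg).ofReal_comp).const_mul Complex.I).cexp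
        have h2 : HasDerivAt (fun r : ℝ =>
            Complex.exp (Complex.I * (-(freqL L l ^ 2 * (r - i.τ / 2)) : ℝ)))
            (Complex.exp (Complex.I * (-(freqL L l ^ 2 * (r - i.τ / 2)) : ℝ))
              * (Complex.I * (-(freqL L l ^ 2 * 1) : ℝ))) r :=
          ((((((hasDerivAt_id r).sub_const (i.τ / 2)).const_mul _).neg).ofReal_comp).const_mul
            Complex.I).cexp
        have h3 : HasDerivAt (fun r : ℝ => (r : ℂ)) 1 r := Complex.ofRealCLM.hasDerivAt
        have h4 := ((h1.mul_const (coeff l (u i.t))).sub ((h3.const_mul Complex.I).mul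
          (h2.mul_const (coeff l (fm i))))).hasDerivWithinAt (s := Icc 0 (i.τ / 2))
        convert! h4 using 1
        push_cast
        ring)
      (fun l _ => by simp)
      (fun r _ l hl => by
        simp only [map_add, map_sub, coeff_mult, if_pos hl]; ring) hb
      (by
        intro l hl
        simp [hZ, proj, free, coeff_mult, hl])
      (fun l hl => by
        simp only [hZ, proj, free, map_sub, map_smul, coeff_mult, if_pos hl, smul_eq_mul,
          Pi.one_apply, one_mul, sub_self, mul_zero, neg_zero, Complex.ofReal_zero,
          Complex.exp_zero, freeSym]
        push_cast
        ring_nf)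
    refine this.mono ?_
    have h5 := mul_le_mul_of_nonneg_left i.τ_sq_le (by positivity : 0 ≤ C₁ + K * C₂)
    have h6 : 0 ≤ (C₁ + K * C₂) * i.τ ^ 2 := by positivity
    nlinarith
  have h1 : BigO σ (fun i : StepIdx L T => u (i.t + i.τ / 2) - proj i.N (u (i.t + i.τ / 2)))
      fun i => i.h ^ 4 := by
    obtain ⟨_, C, hC, hu⟩ := D.bigO (ι := StepIdx L T) (fun i => i.mem_mid)
    refine ⟨fun i => i.h4_nonneg, (2 / L) ^ 4 * C, by have := hL.out; positivity, fun i => ?_⟩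
    have e := hu i
    rw [add_comm] at e
    refine (e.sub_proj i.N_pos i.even).mono (le_of_eq ?_)
    have := hL.out.ne'
    have := i.cast_pos.ne'
    simp only [StepIdx.h]
    field_simp
  -- The force has only `2 + σ` derivatives, so truncation gives `h²`; the prefactor `τ ≤ h²`
  -- supplies the rest.
  have h2 : BigO σ (fun i : StepIdx L T => (Complex.I * (i.τ / 2)) • (fm i - proj i.N (fm i)))
      fun i => i.h ^ 4 := by
    refine ⟨fun i => i.h4_nonneg, (2 / L) ^ 2 * C₂, by have := hL.out; positivity, fun i => ?_⟩
    have e := hf i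
    rw [add_comm] at e
    refine ((e.sub_proj i.N_pos i.even).smul _).mono ?_
    have h3 := hL.out
    have h4 := i.cast_pos
    have h5 : ‖Complex.I * ((i.τ : ℂ) / 2)‖ ≤ i.h ^ 2 := by
      rw [norm_mul, Complex.norm_I, one_mul, norm_div, Complex.norm_real, Real.norm_eq_abs,
        abs_of_pos i.τ_pos]
      have := i.τ_le_sq
      have := i.τ_pos
      simp; linarith
    calc _ ≤ i.h ^ 2 * ((2 / i.N) ^ 2 * (C₂ * 1)) := by gcongr
      _ = _ := by simp only [StepIdx.h]; field_simp
  refine ((hZb.neg.sub h1).sub h2).congr fun i => ?_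
  simp only [hZ, smul_sub]
  abel

end ExactFlow

/-! ### Frequencies modulo `N`. -/

section Residues

variable {N : ℕ}

theorem freq_inj (hE : Even N) :
    ∀ k ∈ freq N, ∀ k' ∈ freq N, (N : ℤ) ∣ k - k' → k = k' :=
  fun _ hk _ hk' h => abs_lt_of_mem_freq_of_mem_freq hE hk hk' h

/-- Needed for complex conjugates: the reflected window contains `N/2` instead of `-N/2`, so it is
not the window itself, but its elements are still distinct modulo `N`. -/
theorem neg_freq_inj (hE : Even N) : ∀ k ∈ (freq N).map (Equiv.neg ℤ).toEmbedding,
    ∀ k' ∈ (freq N).map (Equiv.neg ℤ).toEmbedding, (N : ℤ) ∣ k - k' → k = k' := by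
  intro k hk k' hk' h
  rw [Finset.mem_map] at hk hk'
  obtain ⟨a, ha, rfl⟩ := hk
  obtain ⟨b, hb, rfl⟩ := hk'
  simp only [Equiv.coe_toEmbedding, Equiv.neg_apply] at h ⊢
  rw [abs_lt_of_mem_freq_of_mem_freq hE hb ha (by convert h using 1; ring)]

end Residues

/-! ### Algebraic expansions of the splitting. -/

section LocalError

variable {L : ℝ} [hL : Fact (0 < L)] {T β : ℝ} {σ : ℕ} {V : PerC L} {u : ℝ → PerC L}

theorem bigO_small_smul {ι : Type*} {s : ℕ} {w : ι → PerC L} {τ : ι → ℝ} (hτ : ∀ i, 0 ≤ τ i)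
    (h : BigO s w fun _ => 1) (c : ℂ) : BigO s (fun i => (c * τ i) • w i) τ := by
  have := h.smul (c := fun i => c * τ i) (ρ' := τ) ‖c‖ (norm_nonneg c) hτ fun i => by
    rw [norm_mul, Complex.norm_real, Real.norm_eq_abs, abs_of_nonneg (hτ i)]
  simpa using this

theorem BigO.to_one {ι : Type*} {s : ℕ} {w : ι → PerC L} {τ : ι → ℝ} (h : BigO s w τ) {K : ℝ}
    (hK : 0 ≤ K) (hτ : ∀ i, τ i ≤ K) : BigO s w fun _ => 1 :=
  h.mono K hK (fun _ => zero_le_one) fun i => by simpa using hτ i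

theorem nonlin_sub (τ : ℝ) (w : PerC L) : nonlin β τ w - w
    = w * ((-(Complex.I * τ * β)) • (w * star w) *
      expTail 1 ((-(Complex.I * τ * β)) • (w * star w))) := by
  rw [nonlin, cexp_eq_one_add]; ring

/-- Second-order expansion of the splitting of the potential and of the nonlinearity. -/
theorem cexp_mul_nonlin (τ : ℝ) (V w : PerC L) (Z : PerC L)
    (hZ : Z = (-(Complex.I * τ)) • V + (-(Complex.I * τ * β)) • (w * star w)) :
    cexp ((-(Complex.I * τ)) • V) * nonlin β τ w
      = w - (Complex.I * τ) • force V β w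
        - ((τ : ℂ) ^ 2 / 2) • ((V + (β : ℂ) • (w * star w)) ^ 2 * w)
        + Z * Z * Z * expTail 3 Z * w := by
  -- Both substeps are multiplications by exponentials, so they merge without a commutator error.
  have e1 : cexp ((-(Complex.I * τ)) • V) * nonlin β τ w = cexp Z * w := by
    rw [nonlin, hZ, cexp_add]; ring
  rw [e1, cexp_eq 3 Z]
  have e2 : (∑ k ∈ Finset.range 3, ((k.factorial : ℂ)⁻¹) • Z ^ k)
      = 1 + Z + (2⁻¹ : ℂ) • (Z * Z) := by
    simp [Finset.sum_range_succ, sq]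
  rw [e2]
  have e3 : Z ^ 3 = Z * Z * Z := by ring
  rw [e3, add_mul, mul_assoc (Z * Z * Z)]
  congr 1
  · rw [hZ]
    ext x
    simp [force]
    have hI := Complex.I_sq
    linear_combination ((2⁻¹ : ℂ) * (τ : ℂ) ^ 2 * (V x + β * (w x * (starRingEnd ℂ) (w x))) ^ 2 *
      w x) * hI

/-- Write `f(v) = g v` with `g = V + β|v|²` real. The perturbed point is `(1 + iτg/2)v`, whose
modulus changes only at second order in `τ`. Hence the first-order change of `iτ f` is `-τ²g²v/2`,
precisely the opposite of the quadratic term of the exponential, and what remains is cubic. -/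
theorem force_perturb (hV : star V = V) (τ : ℝ) (v : PerC L) :
    (Complex.I * τ) • force V β (v + (Complex.I * (τ / 2)) • force V β v)
      + ((τ : ℂ) ^ 2 / 2) • ((V + (β : ℂ) • (v * star v)) ^ 2 * v)
    = (Complex.I * τ) • force V β v + (Complex.I * τ ^ 3 * (β / 4)) •
      ((V + (β : ℂ) • (v * star v)) ^ 2 * v * star v *
        (v + (Complex.I * (τ / 2)) • force V β v)) := by
  ext x
  have hx : (starRingEnd ℂ) (V x) = V x := by
    have := congrArg (fun f : PerC L => f x) hV
    simpa using this
  simp [force, hx]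
  have hI := Complex.I_sq
  have hI3 : Complex.I ^ 3 = -Complex.I := by rw [pow_succ, hI]; ring
  have hI4 : Complex.I ^ 4 = 1 := Complex.I_pow_four
  ring_nf
  simp only [hI, hI3, hI4]
  ring

end LocalError

/-! ### Local error and stability of one step. -/

section StrangError

variable {L : ℝ} [hL : Fact (0 < L)] {T β : ℝ} {σ : ℕ} {V : PerC L} {u : ℝ → PerC L}

theorem bigO_proj {ι : Type*} {s : ℕ} {w : ι → PerC L} {ρ : ι → ℝ} {N : ι → ℕ}
    (h : BigO s w ρ) : BigO s (fun i => proj (N i) (w i)) ρ :=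
  h.mult_one fun _ _ _ => by simp

theorem bigO_free {ι : Type*} {s : ℕ} {w : ι → PerC L} {ρ τ : ι → ℝ} {N : ι → ℕ}
    (h : BigO s w ρ) : BigO s (fun i => free (N i) (τ i) (w i)) ρ :=
  h.mult_one fun _ _ _ => (norm_freeSym _ _).le

theorem bigO_interpC_sub {ι : Type*} {s : ℕ} {w : ι → PerC L} {ρ : ι → ℝ} (i₀ : ι → StepIdx L T)
    (h : BigO (4 + s) w ρ) :
    BigO s (fun i => interpC (i₀ i).N (w i) - w i) fun i => ρ i * (i₀ i).h ^ 4 := by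
  obtain ⟨h1, C, hC, h2⟩ := h
  have hLp := hL.out
  refine ⟨fun i => mul_nonneg (h1 i) (i₀ i).h4_nonneg, interpConst (s + 4) * C * (1 / L) ^ 4,
    mul_nonneg (mul_nonneg (interpConst_nonneg _) hC) (by positivity), fun i => ?_⟩
  have e := h2 i
  rw [add_comm] at e
  refine (e.interpC_sub (i₀ i).N_pos (i₀ i).even (by omega)).mono (le_of_eq ?_)
  have := (i₀ i).cast_pos.ne'
  simp only [StepIdx.h]
  field_simp

/-- The scheme is expanded to second order at `w`, the freely propagated half step, and then moved
to the midpoint solution `v`; the terms of order `τ²` cancel by `force_perturb`. The result matches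
the midpoint-rule part of `exact_step`, so only the defect is left. -/
theorem local_error (D : TimeData T β σ V u) (hσ : σ ≤ 1) :
    BigO σ (fun i : StepIdx L T => proj i.N (u (i.t + i.τ)) -
      (strang V β i.N i.τ (proj i.N (u i.t)) + defect i.N i.τ (force V β (u i.t))))
      fun i => i.τ * i.h ^ 4 := by
  have hτ0 : ∀ i : StepIdx L T, 0 ≤ i.τ := fun i => i.τ_pos.le
  have hT : ∀ i : StepIdx L T, i.τ ≤ |T| := fun i => i.τ_le_T.trans (le_abs_self T)
  obtain ⟨M, hV⟩ := D.bdV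
  have hV1 : Bd 1 V M := hV.lower (by omega)
  set v : StepIdx L T → PerC L := fun i => u (i.t + i.τ / 2) with hv
  set fm : StepIdx L T → PerC L := fun i => force V β (v i) with hfm
  set w : StepIdx L T → PerC L := fun i => free i.N i.τ (proj i.N (u i.t)) with hw
  set z : StepIdx L T → PerC L := fun i => v i + (Complex.I * (i.τ / 2)) • fm i with hz
  set X : StepIdx L T → PerC L := fun i => (-(Complex.I * i.τ * β)) • (w i * star (w i)) with hX
  set Y : StepIdx L T → PerC L := fun i => (-(Complex.I * i.τ)) • V with hY
  have bw : BigO (4 + σ) w fun _ => 1 := bigO_free (bigO_proj (D.bigO fun i => i.mem_left))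
  have bw1 : BigO 1 w fun _ => 1 := bw.lower (by omega)
  have bv : BigO 1 v fun _ => 1 := (D.bigO fun i => i.mem_mid).lower (by omega)
  have bfm : BigO 1 fm fun _ => 1 := bigO_force le_rfl hV1 bv
  have bz' : BigO 1 (fun i : StepIdx L T => (Complex.I * (i.τ / 2)) • fm i) fun i => i.τ :=
    (bigO_small_smul hτ0 bfm (Complex.I / 2)).congr fun i => by congr 1; ring
  have bz : BigO 1 z fun _ => 1 := bv.add (bz'.to_one (abs_nonneg T) hT)
  have bX : BigO (4 + σ) X fun i => i.τ :=
    (bigO_small_smul hτ0 (bw.mul_one (by omega) bw.star) (-(Complex.I * β))).congr fun i => by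
      simp only [hX]; congr 1; ring
  have bY : BigO 1 Y fun i => i.τ :=
    (bigO_small_smul hτ0 (bigO_const hV1) (-Complex.I)).congr fun i => by
      simp only [hY]; congr 1; ring
  have bX1 : BigO (4 + σ) X fun _ => 1 := bX.to_one (abs_nonneg T) hT
  have bY1 : BigO 1 Y fun _ => 1 := bY.to_one (abs_nonneg T) hT
  have hwz : BigO σ (fun i => w i - z i) fun i => i.h ^ 4 := half_step D
  -- interpolation
  have h1 : BigO (4 + σ) (fun i => nonlin β i.τ (w i) - w i) fun i => i.τ :=
    (bw.one_mul (by omega) (bX.mul_one (by omega) (bX1.expTail (by omega) 1))).congr fun i =>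
      nonlin_sub _ _
  -- Interpolation is exact on `w`, so only the increment `nonlin w - w`, of size `τ` in `H^{4+σ}`,
  -- is aliased. This is the source of the extra factor `τ`.
  have h2 : BigO σ (fun i => interpC i.N (nonlin β i.τ (w i)) - nonlin β i.τ (w i))
      fun i => i.τ * i.h ^ 4 := by
    refine (bigO_interpC_sub (fun i => i) h1).congr fun i => ?_
    have hsw : Supp (freq i.N) (w i) := supp_mult _ _ _
    rw [map_sub, hsw.interpC_eq i.N_pos i.even]
    abel
  -- The potential multiplies after interpolation and is never interpolated, so `H¹` regularity of
  -- its exponential is enough here.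
  have h3 : BigO σ (fun i => cexp (Y i) * interpC i.N (nonlin β i.τ (w i))
      - cexp (Y i) * nonlin β i.τ (w i)) fun i => i.τ * i.h ^ 4 :=
    ((bY1.cexp le_rfl).one_mul_low hσ h2).congr fun i => by ring
  -- cubic remainder
  have bZ : BigO 1 (fun i => Y i + X i) fun i => i.τ := bY.add (bX.lower (by omega))
  have bZ1 : BigO 1 (fun i => Y i + X i) fun _ => 1 := bZ.to_one (abs_nonneg T) hT
  have hτ3 : ∀ i : StepIdx L T, i.τ * i.τ * i.τ ≤ 1 * (i.τ * i.h ^ 4) := fun i => by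
    have := mul_le_mul_of_nonneg_left i.τ_sq_le (hτ0 i)
    nlinarith
  have h4 : BigO σ (fun i => (Y i + X i) * (Y i + X i) * (Y i + X i) * expTail 3 (Y i + X i) * w i)
      fun i => i.τ * i.h ^ 4 :=
    (((((bZ.mul le_rfl bZ).mul le_rfl bZ).mul_one le_rfl (bZ1.expTail le_rfl 3)).mul_one le_rfl
      bw1).lower hσ).mono 1 zero_le_one (fun i => i.τh4_nonneg) hτ3
  -- comparison with the values at the midpoint
  have h5 : BigO σ (fun i => (Complex.I * i.τ) • (force V β (w i) - force V β (z i)))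
      fun i => i.τ * i.h ^ 4 := by
    refine (bigO_force_sub_low hσ hV1 bw1 bz hwz).smul 1 zero_le_one hτ0 fun i => ?_
    rw [norm_mul, Complex.norm_I, Complex.norm_real, Real.norm_eq_abs, abs_of_nonneg (hτ0 i)]
  -- Order `h²` suffices, since this difference enters only in the quadratic term with prefactor
  -- `τ²`.
  have hwv : BigO σ (fun i => w i - v i) fun i => i.h ^ 2 := by
    have e1 := hwz.mono (ρ' := fun i => i.h ^ 2) (L ^ 2) (sq_nonneg L) (fun i => sq_nonneg _)
      fun i => by
        have := pow_le_pow_left₀ i.h_pos.le i.h_le 2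
        have h0 : 0 ≤ i.h ^ 2 := sq_nonneg _
        nlinarith
    have e2 := (bz'.lower hσ).mono (ρ' := fun i => i.h ^ 2) 1 zero_le_one (fun i => sq_nonneg _)
      fun i => by simpa using i.τ_le_sq
    exact (e1.add e2).congr fun i => by simp only [hz]; abel
  have bg : ∀ {a : StepIdx L T → PerC L}, BigO 1 a (fun _ => 1) →
      BigO 1 (fun i => V + (β : ℂ) • (a i * star (a i))) fun _ => 1 := fun ha =>
    (bigO_const hV1).add ((ha.mul_one le_rfl ha.star).const_smul _)
  have hg : BigO σ (fun i => (V + (β : ℂ) • (w i * star (w i)))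
      - (V + (β : ℂ) • (v i * star (v i)))) fun i => i.h ^ 2 :=
    (((bw1.star.one_mul_low hσ hwv).add (bv.one_mul_low hσ hwv.star)).const_smul (β : ℂ)).congr
      fun i => by rw [star_sub]; ext x; simp; ring
  have h6 : BigO σ (fun i => (V + (β : ℂ) • (w i * star (w i))) ^ 2 * w i
      - (V + (β : ℂ) • (v i * star (v i))) ^ 2 * v i) fun i => i.h ^ 2 := by
    have e1 := ((bg bw1).mul_one le_rfl (bg bw1)).one_mul_low hσ hwv
    have e2 := (((bg bw1).mul_one le_rfl bv).one_mul_low hσ hg).add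
      (((bg bv).mul_one le_rfl bv).one_mul_low hσ hg)
    exact (e1.add e2).congr fun i => by ring
  have h7 : BigO σ (fun i => ((i.τ : ℂ) ^ 2 / 2) • ((V + (β : ℂ) • (w i * star (w i))) ^ 2 * w i
      - (V + (β : ℂ) • (v i * star (v i))) ^ 2 * v i)) fun i => i.τ * i.h ^ 4 := by
    refine (h6.smul (ρ' := fun i => i.τ ^ 2) 1 zero_le_one (fun i => sq_nonneg _) fun i => ?_).mono
      1 zero_le_one (fun i => i.τh4_nonneg) fun i => ?_
    · rw [norm_div, norm_pow, Complex.norm_real, Real.norm_eq_abs, sq_abs]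
      have := sq_nonneg i.τ
      simp; linarith
    · have e1 := mul_le_mul_of_nonneg_left i.τ_le_sq (hτ0 i)
      have e2 : 0 ≤ i.h ^ 2 := sq_nonneg _
      nlinarith
  have h8 : BigO σ (fun i => (Complex.I * i.τ ^ 3 * (β / 4)) •
      ((V + (β : ℂ) • (v i * star (v i))) ^ 2 * v i * star (v i) * z i))
      fun i => i.τ * i.h ^ 4 := by
    have e1 := ((((((bg bv).mul_one le_rfl (bg bv)).mul_one le_rfl bv).mul_one le_rfl
      bv.star).mul_one le_rfl bz).lower hσ)
    refine ((e1.smul (c := fun i => Complex.I * i.τ ^ 3 * (β / 4)) (ρ' := fun i => i.τ * i.τ * i.τ)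
      (|β| / 4) (by positivity)
      (fun i => by have := hτ0 i; positivity) fun i => ?_).mono 1 zero_le_one
      (fun i => i.τh4_nonneg) fun i => ?_).congr fun i => ?_
    · rw [norm_mul, norm_mul, norm_pow, norm_div, Complex.norm_I, Complex.norm_real,
        Complex.norm_real, Real.norm_eq_abs, Real.norm_eq_abs, abs_of_nonneg (hτ0 i)]
      simp
      exact le_of_eq (by ring)
    · simpa using hτ3 i
    · simp only [sq]
  have h9 : BigO σ (fun i => cexp (Y i) * interpC i.N (nonlin β i.τ (w i))
      - (w i - (Complex.I * i.τ) • fm i)) fun i => i.τ * i.h ^ 4 := by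
    refine ((((h3.add h4).sub h5).sub h7).sub h8).congr fun i => ?_
    have e1 := cexp_mul_nonlin (β := β) i.τ V (w i) (Y i + X i) rfl
    have e2 := force_perturb (β := β) D.real i.τ (v i)
    change (Complex.I * i.τ) • force V β (z i) + _ = (Complex.I * i.τ) • fm i
      + (Complex.I * i.τ ^ 3 * (β / 4)) • (_ * z i) at e2
    rw [show cexp (Y i) * nonlin β i.τ (w i) = _ from e1, smul_sub, smul_sub]
    have e3 := eq_sub_of_add_eq e2
    rw [e3]
    abel
  have h10 := bigO_free (N := fun i : StepIdx L T => i.N) (τ := fun i => i.τ) h9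
  refine ((exact_step D hσ).sub h10).congr fun i => ?_
  have e4 : strang V β i.N i.τ (proj i.N (u i.t))
      = free i.N i.τ (cexp (Y i) * interpC i.N (nonlin β i.τ (w i))) := rfl
  rw [e4, map_sub, map_sub, map_smul]
  abel

/-- Data for comparing the scheme started from the exact solution and from `φ`. -/
structure StabIdx (L T : ℝ) (σ : ℕ) (u : ℝ → PerC L) (K : ℝ) [Fact (0 < L)] extends
    StepIdx L T where
  φ : PerC L
  M : ℝ
  bd : Bd 1 φ K
  err : Bd σ (proj N (u t) - φ) M

/-- The nonlinear substep changes the difference `d` of two inputs to `d + τ(B₁d + B₂d̄)` with `B₁`,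
`B₂` bounded in `H¹`. Interpolation fixes `d`, and on the products it is bounded in `H^σ` because
`d` and `d̄` have frequencies distinct modulo `N`. The potential contributes another `O(τ)`. -/
theorem stability (D : TimeData T β σ V u) (hσ : σ ≤ 1) (K : ℝ) :
    BigO σ (fun i : StabIdx L T σ u K => strang V β i.N i.τ (proj i.N (u i.t))
      - strang V β i.N i.τ i.φ - free i.N i.τ (free i.N i.τ (proj i.N (u i.t) - i.φ)))
      fun i => i.τ * i.M := by
  have hτ0 : ∀ i : StabIdx L T σ u K, 0 ≤ i.τ := fun i => i.τ_pos.le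
  have hT : ∀ i : StabIdx L T σ u K, i.τ ≤ |T| := fun i => i.τ_le_T.trans (le_abs_self T)
  have hM0 : ∀ i : StabIdx L T σ u K, 0 ≤ i.M := fun i => i.err.1
  obtain ⟨CV, hV⟩ := D.bdV
  have hV1 : Bd 1 V CV := hV.lower (by omega)
  set w : StabIdx L T σ u K → PerC L := fun i => free i.N i.τ (proj i.N (u i.t)) with hw
  set w' : StabIdx L T σ u K → PerC L := fun i => free i.N i.τ i.φ with hw'
  have bw : BigO 1 w fun _ => 1 :=
    (bigO_free (bigO_proj (D.bigO fun i : StabIdx L T σ u K => i.mem_left))).lower (by omega)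
  have bφ : BigO 1 (fun i : StabIdx L T σ u K => i.φ) fun _ => 1 :=
    ⟨fun _ => zero_le_one, |K|, abs_nonneg K, fun i => i.bd.mono (by simpa using le_abs_self K)⟩
  have bw' : BigO 1 w' fun _ => 1 := bigO_free bφ
  set d : StabIdx L T σ u K → PerC L := fun i => w i - w' i with hd
  have bd' : BigO σ (fun i : StabIdx L T σ u K => proj i.N (u i.t) - i.φ) fun i => i.M :=
    ⟨hM0, 1, zero_le_one, fun i => by simpa using i.err⟩
  have bd : BigO σ d fun i => i.M := (bigO_free (N := fun i => i.N) (τ := fun i => i.τ) bd').congr fun i => by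
    simp only [hd, hw, hw', map_sub]
  set X : StabIdx L T σ u K → PerC L := fun i => (-(Complex.I * i.τ * β)) • (w i * star (w i))
    with hX
  set X' : StabIdx L T σ u K → PerC L := fun i => (-(Complex.I * i.τ * β)) • (w' i * star (w' i))
    with hX'
  set Y : StabIdx L T σ u K → PerC L := fun i => (-(Complex.I * i.τ)) • V with hY
  have bX : BigO 1 X fun _ => 1 :=
    ((bigO_small_smul hτ0 (bw.mul_one le_rfl bw.star) (-(Complex.I * β))).congr fun i => by
      simp only [hX]; congr 1; ring).to_one (abs_nonneg T) hT
  have bX' : BigO 1 X' fun _ => 1 :=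
    ((bigO_small_smul hτ0 (bw'.mul_one le_rfl bw'.star) (-(Complex.I * β))).congr fun i => by
      simp only [hX']; congr 1; ring).to_one (abs_nonneg T) hT
  have bY : BigO 1 Y fun i => i.τ :=
    (bigO_small_smul hτ0 (bigO_const hV1) (-Complex.I)).congr fun i => by
      simp only [hY]; congr 1; ring
  have bY1 : BigO 1 Y fun _ => 1 := bY.to_one (abs_nonneg T) hT
  -- A divided difference: `w'(e^X - e^{X'}) = A(X - X')`. Since `X - X'` is `τ` times a combination
  -- of `d` and its conjugate, this exhibits the coefficients `B₁` and `B₂`.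
  set A : StabIdx L T σ u K → PerC L := fun i => w' i * (cexp (X' i) * expTail 1 (X i - X' i))
    with hA
  have bA : BigO 1 A fun _ => 1 :=
    bw'.mul_one le_rfl ((bX'.cexp le_rfl).mul_one le_rfl ((bX.sub bX').expTail le_rfl 1))
  set B₁ : StabIdx L T σ u K → PerC L := fun i =>
    (-(Complex.I * β)) • (w i * star (w i) * expTail 1 (X i) + A i * star (w i)) with hB₁
  set B₂ : StabIdx L T σ u K → PerC L := fun i => (-(Complex.I * β)) • (A i * w' i) with hB₂
  have bB₁ : BigO 1 B₁ fun _ => 1 := (((bw.mul_one le_rfl bw.star).mul_one le_rfl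
    (bX.expTail le_rfl 1)).add (bA.mul_one le_rfl bw.star)).const_smul _
  have bB₂ : BigO 1 B₂ fun _ => 1 := (bA.mul_one le_rfl bw').const_smul _
  have hdiff : ∀ i, nonlin β i.τ (w i) - nonlin β i.τ (w' i)
      = d i + (i.τ : ℂ) • (B₁ i * d i + B₂ i * star (d i)) := by
    intro i
    have e1 : cexp (X i) = cexp (X' i) + cexp (X' i) * ((X i - X' i) * expTail 1 (X i - X' i)) := by
      rw [cexp_sub_mul (X i) (X' i), cexp_eq_one_add (X i - X' i)]; ring
    have e2 : cexp (X i) = 1 + X i * expTail 1 (X i) := cexp_eq_one_add _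
    have e3 : nonlin β i.τ (w i) - nonlin β i.τ (w' i)
        = d i * cexp (X i) + w' i * (cexp (X i) - cexp (X' i)) := by
      change w i * cexp (X i) - w' i * cexp (X' i) = _
      simp only [hd]; ring
    have e4 : cexp (X i) - cexp (X' i)
        = cexp (X' i) * ((X i - X' i) * expTail 1 (X i - X' i)) := by
      rw [e1]; ring
    rw [e3, e4, e2]
    have e5 : X i - X' i = (-(Complex.I * i.τ * β)) • (d i * star (w i) + w' i * star (d i)) := by
      simp only [hX, hX', hd, star_sub, ← smul_sub]
      congr 1
      ring
    have e6 : w' i * (cexp (X' i) * ((X i - X' i) * expTail 1 (X i - X' i)))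
        = A i * (X i - X' i) := by simp only [hA]; ring
    rw [e6, e5]
    have e7 : X i * expTail 1 (X i)
        = (-(Complex.I * i.τ * β)) • (w i * star (w i) * expTail 1 (X i)) := by
      conv_lhs => enter [1]; rw [hX]
      rw [smul_mul_assoc]
    rw [e7]
    simp only [hB₁, hB₂]
    generalize expTail 1 (X i) = E₁
    generalize A i = A₁
    ext x
    simp
    ring
  have hsd : ∀ i, Supp (freq i.N) (d i) := fun i => (supp_mult _ _ _).sub (supp_mult _ _ _)
  have hI : BigO σ (fun i => interpC i.N (B₁ i * d i) + interpC i.N (B₂ i * star (d i)))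
      fun i => i.M := by
    obtain ⟨_, C₀, hC₀, h0⟩ := bd
    obtain ⟨_, C₁, hC₁, h1⟩ := bB₁
    obtain ⟨_, C₂, hC₂, h2⟩ := bB₂
    have hc : 0 ≤ (interpConst 1 + 1) * mulConst 1 :=
      mul_nonneg (add_nonneg (interpConst_nonneg 1) zero_le_one) (mulConst_nonneg 1)
    refine ⟨hM0, (interpConst 1 + 1) * mulConst 1 * (C₁ * C₀)
      + (interpConst 1 + 1) * mulConst 1 * (C₂ * C₀), by positivity, fun i => ?_⟩
    refine (((h0 i).interpC_mul i.N_pos i.even (freq_inj i.even) hσ (hsd i) (h1 i)).add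
      ((h0 i).star.interpC_mul i.N_pos i.even (neg_freq_inj i.even) hσ (hsd i).star (h2 i))).mono
      (le_of_eq (by ring))
  have hI' : BigO σ (fun i => (i.τ : ℂ) •
      (interpC i.N (B₁ i * d i) + interpC i.N (B₂ i * star (d i)))) fun i => i.τ * i.M :=
    hI.smul 1 zero_le_one hτ0 fun i => by
      rw [Complex.norm_real, Real.norm_eq_abs, abs_of_nonneg (hτ0 i), one_mul]
  have h1 := (bY1.cexp le_rfl).one_mul_low hσ hI'
  have h2 := (bY.mul_one le_rfl (bY1.expTail le_rfl 1)).mul_low hσ bd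
  refine (bigO_free (N := fun i => i.N) (τ := fun i => i.τ) (h1.add h2)).congr fun i => ?_
  have e8 : strang V β i.N i.τ (proj i.N (u i.t)) - strang V β i.N i.τ i.φ
      = free i.N i.τ (cexp (Y i) * interpC i.N (nonlin β i.τ (w i) - nonlin β i.τ (w' i))) := by
    rw [map_sub, mul_sub, map_sub]; rfl
  have e9 : free i.N i.τ (proj i.N (u i.t) - i.φ) = d i := by simp only [hd, hw, hw', map_sub]
  rw [e8, e9, ← map_sub, hdiff, map_add, map_smul, map_add, (hsd i).interpC_eq i.N_pos i.even]
  congr 1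
  have e10 : cexp (Y i) = 1 + Y i * expTail 1 (Y i) := cexp_eq_one_add _
  generalize (i.τ : ℂ) • (interpC i.N (B₁ i * d i) + interpC i.N (B₂ i * star (d i))) = Q
  have e11 : cexp (Y i) * d i = d i + Y i * expTail 1 (Y i) * d i := by rw [e10]; ring
  rw [mul_add, e11]
  abel

end StrangError

/-! ### Telescoping, Gronwall argument and bootstrap. -/

section Convergence

variable {L : ℝ} [hL : Fact (0 < L)] {T β : ℝ} {σ : ℕ} {V : PerC L} {u : ℝ → PerC L}

/-- The symbol is at most `2κτ²`: the factor `κ` costs two derivatives, and `τ² ≤ h⁴`. -/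
theorem bigO_corr {ι : Type*} (i₀ : ι → StepIdx L T) {s : ℕ} {w : ι → PerC L} {ρ : ι → ℝ}
    (h : BigO (2 + s) w ρ) :
    BigO s (fun i => corr (i₀ i).N (i₀ i).τ (w i)) fun i => (i₀ i).h ^ 4 * ρ i := by
  rw [add_comm] at h
  set K : ℝ := (2 * Real.pi / L) ^ 2
  have hK : 0 ≤ K := sq_nonneg _
  refine h.mult (k := 2) (2 * K) (by positivity) (fun i => (i₀ i).h4_nonneg) fun i l hl => ?_
  have hτ := (i₀ i).τ_pos
  have e1 := norm_corrSym_le (κ := freqL L l ^ 2) hτ (sq_nonneg _)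
    (freqL_sq_mul_le (i₀ i).N_pos (i₀ i).even (i₀ i).cfl hl)
  have e2 := freqL_sq_le (L := L) l
  have hw := wt_pos l
  calc _ ≤ 2 * ((i₀ i).τ * (freqL L l ^ 2 * (i₀ i).τ)) := e1
    _ ≤ 2 * ((i₀ i).τ * (K * wt l ^ 2 * (i₀ i).τ)) := by gcongr
    _ = 2 * K * (i₀ i).τ ^ 2 * wt l ^ 2 := by ring
    _ ≤ 2 * K * (i₀ i).h ^ 4 * wt l ^ 2 := by gcongr; exact (i₀ i).τ_sq_le

/-- The reason for introducing `corr`: the defect is the difference between the freely propagated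
correction and the correction itself, hence telescopes along the scheme. -/
theorem defect_eq (i : StepIdx L T) (f : PerC L) :
    defect i.N i.τ f = free i.N i.τ (free i.N i.τ (corr i.N i.τ f)) - corr i.N i.τ f := by
  refine coeff_ext fun l => ?_
  simp only [defect, free, corr, map_sub, coeff_mult]
  split_ifs with hl
  · have e := corrSym_mul (κ := freqL L l ^ 2) i.τ_pos (sq_nonneg _)
      (freqL_sq_mul_le i.N_pos i.even i.cfl hl)
    rw [← freeSym_sq] at e
    rw [← e]; ring
  · simp

/-- The correction at time `t` travels with the error under the free flow, which preserves norms.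
Replacing it by the correction at `t + τ` costs only `O(τ h⁴)`, because the force is Lipschitz in
`H^{2+σ}`. So the defect no longer appears as a source. -/
theorem modified_error_step (D : TimeData T β σ V u) (hσ : σ ≤ 1) (K : ℝ) :
    ∃ C, 0 ≤ C ∧ ∀ (i : StepIdx L T) (φ : PerC L) (M : ℝ), Bd 1 φ K →
      Bd σ (proj i.N (u i.t) - φ + corr i.N i.τ (force V β (u i.t))) M →
      Bd σ (proj i.N (u (i.t + i.τ)) - strang V β i.N i.τ φ
        + corr i.N i.τ (force V β (u (i.t + i.τ)))) (M + C * i.τ * (M + i.h ^ 4)) := by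
  obtain ⟨_, C₁, hC₁, h1⟩ := local_error D hσ
  obtain ⟨_, C₂, hC₂, h2⟩ := stability D hσ K
  obtain ⟨_, C₃, hC₃, h3⟩ := bigO_corr (fun i : StepIdx L T => i)
    (D.bigO_force fun i : StepIdx L T => i.mem_left)
  obtain ⟨_, C₄, hC₄, h4⟩ := bigO_corr (fun i : StepIdx L T => i)
    (D.bigO_force_sub (ρ := fun i => i.τ) (fun i : StepIdx L T => i.mem_right)
      (fun i => i.mem_left) fun i => by rw [add_sub_cancel_left, abs_of_pos i.τ_pos])
  refine ⟨C₁ + C₂ + C₂ * C₃ + C₄, by positivity, fun i φ M hb hM => ?_⟩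
  have e0 : Bd σ (proj i.N (u i.t) - φ) (M + C₃ * (i.h ^ 4 * 1)) := by
    have := hM.sub (h3 i)
    rwa [add_sub_cancel_right] at this
  have e2 := h2 ⟨i, φ, _, hb, e0⟩
  have e5 : Bd σ (free i.N i.τ (free i.N i.τ
      (proj i.N (u i.t) - φ + corr i.N i.τ (force V β (u i.t))))) M :=
    proj_bd (proj_bd hM fun l _ => (norm_freeSym _ _).le) fun l _ => (norm_freeSym _ _).le
  have e6 := (((h1 i).add e2).add e5).add (h4 i)
  have hτ := i.τ_pos
  have hh := i.h4_nonneg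
  have hM0 := hM.1
  have e7 : Bd σ (proj i.N (u (i.t + i.τ)) - strang V β i.N i.τ φ
        + corr i.N i.τ (force V β (u (i.t + i.τ))))
      (C₁ * (i.τ * i.h ^ 4) + C₂ * (i.τ * (M + C₃ * (i.h ^ 4 * 1))) + M
        + C₄ * (i.h ^ 4 * i.τ)) := by
    convert! e6 using 1
    simp only [defect_eq, map_sub, map_add]
    abel
  refine e7.mono ?_
  have p1 : 0 ≤ C₁ * i.τ * M := by positivity
  have p2 : 0 ≤ C₂ * i.τ * i.h ^ 4 := by positivity
  have p3 : 0 ≤ C₂ * C₃ * i.τ * M := by positivity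
  have p4 : 0 ≤ C₄ * i.τ * M := by positivity
  nlinarith

/-- The iterates of the scheme. -/
def strangSeq (V : PerC L) (β : ℝ) (N : ℕ) (τ : ℝ) (φ : PerC L) : ℕ → PerC L
  | 0 => φ
  | n + 1 => strang V β N τ (strangSeq V β N τ φ n)

theorem supp_strangSeq (V : PerC L) (β : ℝ) (N : ℕ) (τ : ℝ) (φ : PerC L) (hφ : Supp (freq N) φ)
    (n : ℕ) : Supp (freq N) (strangSeq V β N τ φ n) := by
  cases n with
  | zero => exact hφ
  | succ n => exact supp_mult _ _ _

/-- Admissible discretisations, up to the `n`-th time step. -/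
structure Adm (L T : ℝ) (N : ℕ) (τ : ℝ) (n : ℕ) : Prop where
  N_pos : 0 < N
  even : Even N
  τ_pos : 0 < τ
  cfl : τ ≤ (L / N) ^ 2 / Real.pi
  le_T : n * τ ≤ T

theorem Adm.mono {N : ℕ} {τ : ℝ} {m n : ℕ} (h : Adm L T N τ n) (hm : m ≤ n) : Adm L T N τ m where
  N_pos := h.N_pos
  even := h.even
  τ_pos := h.τ_pos
  cfl := h.cfl
  le_T := by
    have : (m : ℝ) ≤ n := by exact_mod_cast hm
    exact (mul_le_mul_of_nonneg_right this h.τ_pos.le).trans h.le_T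

theorem Adm.mem {N : ℕ} {τ : ℝ} {n : ℕ} (h : Adm L T N τ n) : (n * τ : ℝ) ∈ Icc 0 T :=
  ⟨mul_nonneg (Nat.cast_nonneg n) h.τ_pos.le, h.le_T⟩

/-- The time step from `t_n` to `t_{n+1}`. -/
def Adm.idx {N : ℕ} {τ : ℝ} {n : ℕ} (h : Adm L T N τ (n + 1)) : StepIdx L T where
  N := N
  τ := τ
  t := n * τ
  N_pos := h.N_pos
  even := h.even
  τ_pos := h.τ_pos
  cfl := h.cfl
  t_nonneg := mul_nonneg (Nat.cast_nonneg n) h.τ_pos.le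
  le_T := by have := h.le_T; push_cast at this; linarith

theorem Adm.τ_sq_le {N : ℕ} {τ : ℝ} {n : ℕ} (h : Adm L T N τ n) : τ ^ 2 ≤ (L / N) ^ 4 := by
  have h1 : τ ≤ (L / N) ^ 2 :=
    h.cfl.trans (div_le_self (sq_nonneg _) (by linarith [Real.pi_gt_three]))
  calc τ ^ 2 ≤ ((L / N) ^ 2) ^ 2 := pow_le_pow_left₀ h.τ_pos.le h1 2
    _ = _ := by ring

theorem initial_error (D : TimeData T β σ V u) : ∃ C, 0 ≤ C ∧ ∀ (N : ℕ) (τ : ℝ),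
    Adm L T N τ 0 → Bd σ (proj N (u 0) - interpC N (u 0)) (C * (L / N) ^ 4) := by
  obtain ⟨B, hB⟩ := D.bdu
  have hLp := hL.out
  refine ⟨((2 / L) ^ 4 + interpConst (σ + 4) * (1 / L) ^ 4) * |B|, by
    have := interpConst_nonneg (σ + 4); positivity, fun N τ hA => ?_⟩
  have h0 : (0 : ℝ) ∈ Icc 0 T := by simpa using hA.mem
  have hN : (0 : ℝ) < N := by exact_mod_cast hA.N_pos
  have e := (hB 0 h0).mono (le_abs_self B)
  rw [add_comm] at e
  have e1 := (e.sub_proj hA.N_pos hA.even).add (e.interpC_sub hA.N_pos hA.even (by omega))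
  have e2 := e1.neg
  convert! e2 using 1
  · simp only [proj]; abel
  · field_simp

/-- The correction must also be removed at the last time `t_n`, from which no further step inside
`[0, T]` need start; `bigO_corr` is tied to steps and does not cover this. -/
theorem corr_bd (D : TimeData T β σ V u) : ∃ C, 0 ≤ C ∧ ∀ (N : ℕ) (τ : ℝ) (n : ℕ),
    Adm L T N τ n → Bd σ (corr N τ (force V β (u (n * τ)))) (C * (L / N) ^ 4) := by
  obtain ⟨_, C, hC, h⟩ := D.bigO_force (ι := Icc 0 T) (t := fun t => t) fun t => t.2
  set K : ℝ := (2 * Real.pi / L) ^ 2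
  have hK : 0 ≤ K := sq_nonneg _
  refine ⟨2 * K * C, by positivity, fun N τ n hA => ?_⟩
  have e := h ⟨n * τ, hA.mem⟩
  rw [add_comm] at e
  have hτ := hA.τ_pos
  have e3 := e.mult (S := freq N) (m := fun l => corrSym (freqL L l ^ 2) τ)
    (c := 2 * K * (L / N) ^ 4) (by positivity) fun l hl => by
      have e1 := norm_corrSym_le (κ := freqL L l ^ 2) hτ (sq_nonneg _)
        (freqL_sq_mul_le hA.N_pos hA.even hA.cfl hl)
      have e2 := freqL_sq_le (L := L) l
      have hw := wt_pos l
      calc _ ≤ 2 * (τ * (freqL L l ^ 2 * τ)) := e1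
        _ ≤ 2 * (τ * (K * wt l ^ 2 * τ)) := by gcongr
        _ = 2 * K * τ ^ 2 * wt l ^ 2 := by ring
        _ ≤ 2 * K * (L / N) ^ 4 * wt l ^ 2 := by gcongr; exact hA.τ_sq_le
  exact e3.mono (le_of_eq (by simp only [mul_one]; ring))

/-- Convergence as long as the iterates stay bounded in `H¹`. -/
theorem conditional_convergence (D : TimeData T β σ V u) (hσ : σ ≤ 1) (K : ℝ) :
    ∃ C, 0 ≤ C ∧ ∀ (N : ℕ) (τ : ℝ) (n : ℕ), Adm L T N τ n →
      (∀ m < n, Bd 1 (strangSeq V β N τ (interpC N (u 0)) m) K) →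
      Bd σ (proj N (u (n * τ)) - strangSeq V β N τ (interpC N (u 0)) n) (C * (L / N) ^ 4) := by
  obtain ⟨C₀, hC₀, h0⟩ := initial_error D
  obtain ⟨Cq, hCq, hq⟩ := corr_bd D
  obtain ⟨C, hC, hstep⟩ := modified_error_step D hσ K
  -- Discrete Gronwall for the modified error: the exponential absorbs the factors `1 + Cτ`, while
  -- `C₀`, `Cq` and `C t_n` collect the initial error, the initial correction and the accumulated
  -- sources.
  have key : ∀ (N : ℕ) (τ : ℝ) (n : ℕ), Adm L T N τ n →
      (∀ m < n, Bd 1 (strangSeq V β N τ (interpC N (u 0)) m) K) →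
      Bd σ (proj N (u (n * τ)) - strangSeq V β N τ (interpC N (u 0)) n
        + corr N τ (force V β (u (n * τ))))
        (Real.exp (C * (n * τ)) * (C₀ + Cq + C * (n * τ)) * (L / N) ^ 4) := by
    intro N τ n
    induction n with
    | zero =>
      intro hA _
      have e1 := (h0 N τ hA).add (by simpa using hq N τ 0 hA)
      simp only [Nat.cast_zero, zero_mul, mul_zero, Real.exp_zero, add_zero, one_mul]
      convert! e1 using 1
      ring
    | succ n ih =>
      intro hA hm
      have hA' := hA.mono (Nat.le_succ n)
      have e1 := hstep hA.idx (strangSeq V β N τ (interpC N (u 0)) n) _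
        (hm n (Nat.lt_succ_self n))
        (ih hA' fun m hmn => hm m (hmn.trans (Nat.lt_succ_self n)))
      have ht : ((n + 1 : ℕ) : ℝ) * τ = n * τ + τ := by push_cast; ring
      rw [ht]
      refine Bd.mono e1 ?_
      change Real.exp (C * (n * τ)) * (C₀ + Cq + C * (n * τ)) * (L / N) ^ 4 + C * τ *
        (Real.exp (C * (n * τ)) * (C₀ + Cq + C * (n * τ)) * (L / N) ^ 4 + (L / N) ^ 4) ≤ _
      have hτ := hA.τ_pos
      have hnτ : 0 ≤ n * τ := hA'.mem.1
      have hexp : Real.exp (C * (n * τ + τ)) = Real.exp (C * (n * τ)) * Real.exp (C * τ) := by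
        rw [← Real.exp_add]; ring_nf
      have h1 : 1 + C * τ ≤ Real.exp (C * τ) := by linarith [Real.add_one_le_exp (C * τ)]
      have h2 : 1 ≤ Real.exp (C * (n * τ + τ)) := Real.one_le_exp (by positivity)
      have hH : (0 : ℝ) ≤ (L / N) ^ 4 := by positivity
      have hE : 0 < Real.exp (C * (n * τ)) := Real.exp_pos _
      have h3 : Real.exp (C * (n * τ)) * (1 + C * τ) ≤ Real.exp (C * (n * τ + τ)) := by
        rw [hexp]; gcongr
      have h4 : 0 ≤ C₀ + Cq + C * (n * τ) := by positivity
      calc _ = (Real.exp (C * (n * τ)) * (1 + C * τ)) * (C₀ + Cq + C * (n * τ)) * (L / N) ^ 4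
            + 1 * (C * τ) * (L / N) ^ 4 := by ring
        _ ≤ Real.exp (C * (n * τ + τ)) * (C₀ + Cq + C * (n * τ)) * (L / N) ^ 4
            + Real.exp (C * (n * τ + τ)) * (C * τ) * (L / N) ^ 4 := by gcongr
        _ = _ := by ring
  refine ⟨Real.exp (C * |T|) * (C₀ + Cq + C * |T|) + Cq, by positivity, fun N τ n hA hm => ?_⟩
  have e1 := (key N τ n hA hm).sub (hq N τ n hA)
  rw [add_sub_cancel_right] at e1
  refine e1.mono ?_
  have hT : n * τ ≤ |T| := hA.le_T.trans (le_abs_self T)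
  have hnτ : 0 ≤ n * τ := hA.mem.1
  rw [add_mul]
  gcongr

/-- The iterates stay bounded in `H¹` for small `h`. -/
theorem strangSeq_bounded (D : TimeData T β 0 V u) : ∃ h₀ K : ℝ, 0 < h₀ ∧
    ∀ (N : ℕ) (τ : ℝ) (n : ℕ), Adm L T N τ n → L / N < h₀ →
      Bd 1 (strangSeq V β N τ (interpC N (u 0)) n) K := by
  obtain ⟨B, hB⟩ := D.bdu
  -- The radius `B + 1` is fixed before the constant `C` and the threshold for `h` are chosen, so
  -- the induction is not circular.
  obtain ⟨C, hC, hconv⟩ := conditional_convergence D zero_le_one (B + 1)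
  have hLp := hL.out
  -- As `N = L/h`, the inverse inequality turns `C h⁴` in `L²` into `L C h³` in `H¹`; below this
  -- threshold that is at most `1`.
  refine ⟨min 1 (1 / (L * C + 1)), B + 1, by positivity, fun N τ n => ?_⟩
  induction n using Nat.strong_induction_on with
  | _ n ih =>
    intro hA hh
    have hN : (0 : ℝ) < N := by exact_mod_cast hA.N_pos
    have e1 := hconv N τ n hA fun m hm => ih m hm (hA.mono hm.le) hh
    have e2 := e1.inverse hA.N_pos hA.even ((supp_mult _ _ _).sub
      (supp_strangSeq V β N τ _ (supp_interpC _) n))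
    have e3 : Bd 1 (proj N (u (n * τ))) B := proj_bd ((hB _ hA.mem).lower (by omega)) (by simp)
    have e4 := e3.sub e2
    rw [sub_sub_cancel] at e4
    refine e4.mono (add_le_add le_rfl ?_)
    have h1 : L / N < 1 := hh.trans_le (min_le_left _ _)
    have h2 : L / N < 1 / (L * C + 1) := hh.trans_le (min_le_right _ _)
    have h3 : 0 < L / N := by positivity
    have h4 : (L / N) ^ 3 ≤ L / N := by
      calc (L / N) ^ 3 = (L / N) ^ 2 * (L / N) := by ring
        _ ≤ 1 * (L / N) := by gcongr; exact pow_le_one₀ h3.le h1.le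
        _ = L / N := one_mul _
    calc (N : ℝ) * (C * (L / N) ^ 4) = L * C * (L / N) ^ 3 := by field_simp
      _ ≤ L * C * (1 / (L * C + 1)) := by gcongr; exact h4.trans h2.le
      _ ≤ 1 := by
          rw [mul_one_div, div_le_one (by positivity)]; linarith

theorem sub_proj_h {s k : ℕ} {w : PerC L} {M : ℝ} {N : ℕ} (hN : 0 < N) (hE : Even N)
    (h : Bd (s + k) w M) : Bd s (w - proj N w) ((2 / L) ^ k * M * (L / N) ^ k) := by
  refine (h.sub_proj hN hE).mono (le_of_eq ?_)
  have h1 := hL.out.ne'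
  have h2 : (2 / N : ℝ) = 2 / L * (L / N) := by field_simp
  rw [h2, mul_pow]
  ring

theorem convergence (D : TimeData T β σ V u) (hσ : σ ≤ 1) (K : ℝ) :
    ∃ C, 0 ≤ C ∧ ∀ (N : ℕ) (τ : ℝ) (n : ℕ), Adm L T N τ n →
      (∀ m < n, Bd 1 (strangSeq V β N τ (interpC N (u 0)) m) K) →
      Bd σ (u (n * τ) - strangSeq V β N τ (interpC N (u 0)) n) (C * (L / N) ^ 4) := by
  obtain ⟨B, hB⟩ := D.bdu
  obtain ⟨C, hC, hconv⟩ := conditional_convergence D hσ K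
  have hLp := hL.out
  refine ⟨(2 / L) ^ 4 * |B| + C, by positivity, fun N τ n hA hm => ?_⟩
  have e1 := hconv N τ n hA hm
  have e0 := (hB _ hA.mem).mono (le_abs_self B)
  rw [add_comm] at e0
  have e2 := (sub_proj_h hA.N_pos hA.even e0).add e1
  rw [sub_add_sub_cancel] at e2
  exact e2.mono (le_of_eq (by ring))

/-- The inverse inequality is applied to the trigonometric polynomial part of the error and costs
one power of `h`; the truncation tail is `O(h³)` in `H¹` anyway. -/
theorem convergence_one_of_zero (D : TimeData T β 0 V u) (K : ℝ) :
    ∃ C, 0 ≤ C ∧ ∀ (N : ℕ) (τ : ℝ) (n : ℕ), Adm L T N τ n →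
      (∀ m < n, Bd 1 (strangSeq V β N τ (interpC N (u 0)) m) K) →
      Bd 1 (u (n * τ) - strangSeq V β N τ (interpC N (u 0)) n) (C * (L / N) ^ 3) := by
  obtain ⟨B, hB⟩ := D.bdu
  obtain ⟨C, hC, hconv⟩ := conditional_convergence D zero_le_one K
  have hLp := hL.out
  refine ⟨(2 / L) ^ 3 * |B| + C * L, by positivity, fun N τ n hA hm => ?_⟩
  have hN : (0 : ℝ) < N := by exact_mod_cast hA.N_pos
  have e1 := (hconv N τ n hA hm).inverse hA.N_pos hA.even ((supp_mult _ _ _).sub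
      (supp_strangSeq V β N τ _ (supp_interpC _) n))
  have e0 : Bd (1 + 3) (u (n * τ)) |B| := (hB _ hA.mem).mono (le_abs_self B)
  have e2 := (sub_proj_h hA.N_pos hA.even e0).add e1
  rw [sub_add_sub_cancel] at e2
  exact e2.mono (le_of_eq (by field_simp))

end Convergence

/-! ### Weak derivatives tested against periodic functions. -/

section WeakDerivatives

variable {a b : ℝ}

theorem integral_vol (hab : a < b) (f : ℝ → ℂ) : ∫ x, f x ∂(vol a b) = ∫ x in a..b, f x := by
  rw [intervalIntegral.integral_of_le hab.le, integral_Ioc_eq_integral_Ioo]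

theorem exists_deriv_smoothTransition_le : ∃ M, 0 ≤ M ∧ ∀ x, |deriv Real.smoothTransition x| ≤
    M * (Icc (0 : ℝ) 1).indicator 1 x := by
  have h0 : ∀ x, x ∉ Icc (0 : ℝ) 1 → deriv Real.smoothTransition x = 0 := by
    intro x hx
    by_cases h : x < 0
    · have : Real.smoothTransition =ᶠ[𝓝 x] fun _ => 0 := by
        filter_upwards [Iio_mem_nhds h] with y hy
        exact Real.smoothTransition.zero_of_nonpos (le_of_lt hy)
      rw [this.deriv_eq, deriv_const]
    · have h1 : 1 < x := by
        by_contra h1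
        exact hx ⟨not_lt.1 h, not_lt.1 h1⟩
      have : Real.smoothTransition =ᶠ[𝓝 x] fun _ => 1 := by
        filter_upwards [Ioi_mem_nhds h1] with y hy
        exact Real.smoothTransition.one_of_one_le (le_of_lt hy)
      rw [this.deriv_eq, deriv_const]
  have hc : Continuous (deriv Real.smoothTransition) :=
    (Real.smoothTransition.contDiff (n := 1)).continuous_deriv le_rfl
  obtain ⟨M, hM⟩ := isCompact_Icc.exists_bound_of_continuousOn (s := Icc (0 : ℝ) 1) hc.continuousOn
  refine ⟨max M 0, le_max_right _ _, fun x => ?_⟩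
  by_cases hx : x ∈ Icc (0 : ℝ) 1
  · rw [indicator_of_mem hx, Pi.one_apply, mul_one]
    exact (hM x hx).trans (le_max_left _ _)
  · rw [indicator_of_notMem hx, h0 x hx]; simp

/-- A smooth cutoff function on `(a, b)` with transition layers of width `ε`. -/
def cutoff (a b ε x : ℝ) : ℝ :=
  Real.smoothTransition ((x - a) / ε - 1) * Real.smoothTransition ((b - x) / ε - 1)

theorem contDiff_cutoff (ε : ℝ) : ContDiff ℝ ∞ (cutoff a b ε) := by
  have h := Real.smoothTransition.contDiff (n := ⊤)
  exact (h.comp (((contDiff_id.sub contDiff_const).div_const ε).sub contDiff_const)).mul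
    (h.comp (((contDiff_const.sub contDiff_id).div_const ε).sub contDiff_const))

theorem abs_cutoff_le (ε x : ℝ) : |cutoff a b ε x| ≤ 1 := by
  rw [cutoff, abs_mul, abs_of_nonneg (Real.smoothTransition.nonneg _),
    abs_of_nonneg (Real.smoothTransition.nonneg _)]
  exact mul_le_one₀ (Real.smoothTransition.le_one _) (Real.smoothTransition.nonneg _)
    (Real.smoothTransition.le_one _)

theorem cutoff_eq_zero {ε x : ℝ} (hε : 0 < ε) (hx : x ∉ Icc (a + ε) (b - ε)) :
    cutoff a b ε x = 0 := by
  by_cases h : a + ε ≤ x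
  · have h1 : b - ε < x := by by_contra h1; exact hx ⟨h, not_lt.1 h1⟩
    rw [cutoff, Real.smoothTransition.zero_of_nonpos (x := (b - x) / ε - 1), mul_zero]
    rw [sub_nonpos, div_le_one hε]; linarith
  · rw [cutoff, Real.smoothTransition.zero_of_nonpos, zero_mul]
    rw [sub_nonpos, div_le_one hε]; linarith

theorem tsupport_cutoff_subset {ε : ℝ} (hε : 0 < ε) :
    tsupport (cutoff a b ε) ⊆ Icc (a + ε) (b - ε) := by
  refine closure_minimal (fun x hx => ?_) isClosed_Icc
  by_contra h
  exact hx (cutoff_eq_zero hε h)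

theorem cutoff_eventually {x : ℝ} (hx : x ∈ Ioo a b) :
    ∀ᶠ ε in 𝓝[>] (0 : ℝ), cutoff a b ε x = 1 := by
  have h1 : 0 < min (x - a) (b - x) / 2 := by
    have := hx.1; have := hx.2
    have : 0 < min (x - a) (b - x) := lt_min (by linarith) (by linarith)
    linarith
  filter_upwards [Ioo_mem_nhdsGT h1] with ε hε
  have h2 : 2 * ε ≤ x - a := by linarith [hε.2, min_le_left (x - a) (b - x)]
  have h3 : 2 * ε ≤ b - x := by linarith [hε.2, min_le_right (x - a) (b - x)]
  rw [cutoff, Real.smoothTransition.one_of_one_le, Real.smoothTransition.one_of_one_le, mul_one]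
  · rw [le_sub_iff_add_le, le_div_iff₀ hε.1]; linarith
  · rw [le_sub_iff_add_le, le_div_iff₀ hε.1]; linarith

theorem integral_deriv_cutoff (hab : a < b) {ε : ℝ} (hε : 0 < ε) :
    ∫ x, ((deriv (cutoff a b ε) x : ℝ) : ℂ) ∂(vol a b) = 0 := by
  rw [integral_complex_ofReal]
  have h := contDiff_cutoff (a := a) (b := b) ε
  have h1 : Continuous (deriv (cutoff a b ε)) := h.continuous_deriv (by exact_mod_cast le_top)
  have h2 : ∫ x, deriv (cutoff a b ε) x ∂(vol a b) = ∫ x in a..b, deriv (cutoff a b ε) x := by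
    rw [intervalIntegral.integral_of_le hab.le, integral_Ioc_eq_integral_Ioo]
  rw [h2, intervalIntegral.integral_deriv_eq_sub
    (fun x _ => h.differentiable (by simp) x) (h1.intervalIntegrable _ _),
    cutoff_eq_zero hε (fun hx => by linarith [hx.2]), cutoff_eq_zero hε fun hx => by linarith [hx.1]]
  simp

theorem abs_deriv_cutoff_le {M : ℝ} (hM0 : 0 ≤ M) (hM : ∀ x, |deriv Real.smoothTransition x| ≤
    M * (Icc (0 : ℝ) 1).indicator 1 x) {ε : ℝ} (hε : 0 < ε) (x : ℝ) :
    |deriv (cutoff a b ε) x| ≤ (Icc a (a + 2 * ε)).indicator (fun _ => M / ε) x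
      + (Icc (b - 2 * ε) b).indicator (fun _ => M / ε) x := by
  have hd : ∀ y, HasDerivAt Real.smoothTransition (deriv Real.smoothTransition y) y := fun y =>
    ((Real.smoothTransition.contDiff (n := 1)).differentiable one_ne_zero y).hasDerivAt
  have h1 : HasDerivAt (fun x => Real.smoothTransition ((x - a) / ε - 1))
      (deriv Real.smoothTransition ((x - a) / ε - 1) * (1 / ε)) x :=
    (hd _).comp x ((((hasDerivAt_id x).sub_const a).div_const ε).sub_const 1)
  have h2 : HasDerivAt (fun x => Real.smoothTransition ((b - x) / ε - 1))
      (deriv Real.smoothTransition ((b - x) / ε - 1) * (-1 / ε)) x :=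
    (hd _).comp x ((((hasDerivAt_id x).const_sub b).div_const ε).sub_const 1)
  have h3 : HasDerivAt (cutoff a b ε) _ x := h1.mul h2
  have key : ∀ (y : ℝ) (A : Set ℝ), (y ∈ Icc (0 : ℝ) 1 → x ∈ A) →
      |deriv Real.smoothTransition y| * (1 / ε) ≤ A.indicator (fun _ => M / ε) x := by
    intro y A hA
    have := hM y
    by_cases hy : y ∈ Icc (0 : ℝ) 1
    · rw [indicator_of_mem hy, Pi.one_apply, mul_one] at this
      rw [indicator_of_mem (hA hy), mul_one_div]
      gcongr
    · rw [indicator_of_notMem hy, mul_zero] at this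
      rw [le_antisymm this (abs_nonneg _), zero_mul]
      exact indicator_nonneg (fun _ _ => by positivity) x
  rw [h3.deriv]
  refine (abs_add_le _ _).trans (add_le_add ?_ ?_)
  · rw [abs_mul, abs_mul, abs_of_pos (one_div_pos.2 hε),
      abs_of_nonneg (Real.smoothTransition.nonneg _)]
    refine (mul_le_of_le_one_right (by positivity) (Real.smoothTransition.le_one _)).trans
      (key _ _ fun h => ?_)
    have h1 := h.1; have h2 := h.2
    rw [sub_nonneg, le_div_iff₀ hε] at h1
    rw [sub_le_iff_le_add, div_le_iff₀ hε] at h2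
    constructor <;> linarith
  · rw [abs_mul, abs_mul, abs_of_nonneg (Real.smoothTransition.nonneg _), abs_div, abs_neg, abs_one,
      abs_of_pos hε]
    refine (mul_le_of_le_one_left (by positivity) (Real.smoothTransition.le_one _)).trans
      (key _ _ fun h => ?_)
    have h1 := h.1; have h2 := h.2
    rw [sub_nonneg, le_div_iff₀ hε] at h1
    rw [sub_le_iff_le_add, div_le_iff₀ hε] at h2
    constructor <;> linarith

/-- The derivative of the cutoff acts like a point mass at `a` minus one at `b`. Its integral
vanishes, so `F a` can be subtracted, and in both transition layers `F` is close to the common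
boundary value. -/
theorem tendsto_integral_mul_deriv_cutoff (hab : a < b) {F : ℝ → ℂ} (hF : ContinuousOn F (Icc a b))
    (hFab : F a = F b) :
    Tendsto (fun ε => ∫ x, F x * ((deriv (cutoff a b ε) x : ℝ) : ℂ) ∂(vol a b)) (𝓝[>] 0) (𝓝 0) := by
  obtain ⟨M, hM0, hM⟩ := exists_deriv_smoothTransition_le
  have hFi : Integrable F (vol a b) :=
    (hF.integrableOn_Icc).mono_set Ioo_subset_Icc_self
  rw [Metric.tendsto_nhds]
  intro δ hδ
  -- Each layer has width `2ε` and height `M/ε`, so the total mass is at most `4M`; the summand `1`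
  -- guards against `M = 0`.
  set δ' : ℝ := δ / (4 * M + 1) / 2 with hδ'
  have hδ'0 : 0 < δ' := by positivity
  have ha := Metric.continuousWithinAt_iff.1 (hF a (left_mem_Icc.2 hab.le)) δ' hδ'0
  have hb := Metric.continuousWithinAt_iff.1 (hF b (right_mem_Icc.2 hab.le)) δ' hδ'0
  obtain ⟨ra, hra, ha⟩ := ha
  obtain ⟨rb, hrb, hb⟩ := hb
  have hr : 0 < min ra rb / 2 := by positivity
  filter_upwards [Ioo_mem_nhdsGT hr] with ε hε
  have hε0 := hε.1
  have hεa : 2 * ε < ra := by linarith [hε.2, min_le_left ra rb]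
  have hεb : 2 * ε < rb := by linarith [hε.2, min_le_right ra rb]
  have hdc : Continuous (deriv (cutoff a b ε)) :=
    (contDiff_cutoff ε).continuous_deriv (by exact_mod_cast le_top)
  have hbd : ∀ x, ‖((deriv (cutoff a b ε) x : ℝ) : ℂ)‖ ≤ M / ε + M / ε := fun x => by
    rw [Complex.norm_real]
    refine (abs_deriv_cutoff_le hM0 hM hε0 x).trans (add_le_add ?_ ?_) <;>
    exact indicator_le_self' (fun _ _ => by positivity) x
  have hmeas : AEStronglyMeasurable (fun x => ((deriv (cutoff a b ε) x : ℝ) : ℂ)) (vol a b) :=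
    (Complex.continuous_ofReal.comp hdc).aestronglyMeasurable
  have hi1 : Integrable (fun x => F x * ((deriv (cutoff a b ε) x : ℝ) : ℂ)) (vol a b) :=
    hFi.mul_bdd hmeas (Eventually.of_forall hbd)
  have hi2 : Integrable (fun x => F a * ((deriv (cutoff a b ε) x : ℝ) : ℂ)) (vol a b) :=
    (integrable_const (F a)).mul_bdd hmeas (Eventually.of_forall hbd)
  have e1 : ∫ x, F x * ((deriv (cutoff a b ε) x : ℝ) : ℂ) ∂(vol a b)
      = ∫ x, (F x - F a) * ((deriv (cutoff a b ε) x : ℝ) : ℂ) ∂(vol a b) := by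
    simp only [sub_mul]
    rw [integral_sub hi1 hi2, integral_const_mul, integral_deriv_cutoff hab hε0, mul_zero, sub_zero]
  have e2 : ∀ x ∈ Ioo a b, ‖(F x - F a) * ((deriv (cutoff a b ε) x : ℝ) : ℂ)‖ ≤
      δ' * ((Icc a (a + 2 * ε)).indicator (fun _ => M / ε) x
      + (Icc (b - 2 * ε) b).indicator (fun _ => M / ε) x) := by
    intro x hx
    have hx' := Ioo_subset_Icc_self hx
    rw [norm_mul, Complex.norm_real]
    have h1 := abs_deriv_cutoff_le (a := a) (b := b) hM0 hM hε0 x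
    by_cases hxa : x ∈ Icc a (a + 2 * ε)
    · have h2 : ‖F x - F a‖ ≤ δ' := by
        rw [← dist_eq_norm]
        refine (ha hx' ?_).le
        rw [Real.dist_eq, abs_of_nonneg] <;> linarith [hxa.1, hxa.2]
      exact mul_le_mul h2 h1 (norm_nonneg _) hδ'0.le
    · by_cases hxb : x ∈ Icc (b - 2 * ε) b
      · have h2 : ‖F x - F a‖ ≤ δ' := by
          rw [hFab, ← dist_eq_norm]
          refine (hb hx' ?_).le
          rw [Real.dist_eq, abs_of_nonpos] <;> linarith [hxb.1, hxb.2]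
        exact mul_le_mul h2 h1 (norm_nonneg _) hδ'0.le
      · rw [indicator_of_notMem hxa, indicator_of_notMem hxb, add_zero] at h1 ⊢
        rw [Real.norm_eq_abs, le_antisymm h1 (abs_nonneg _)]; simp
  have hint : ∀ c d : ℝ, Integrable ((Icc c d).indicator fun _ => M / ε) (vol a b) := fun c d =>
    (integrable_const _).indicator measurableSet_Icc
  have hle : ∀ c : ℝ, ∫ x, (Icc c (c + 2 * ε)).indicator (fun _ => M / ε) x ∂(vol a b) ≤ 2 * M := by
    intro c
    rw [integral_indicator_const _ measurableSet_Icc, smul_eq_mul]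
    have h1 : (vol a b).real (Icc c (c + 2 * ε)) ≤ 2 * ε := by
      rw [Measure.real, Measure.restrict_apply measurableSet_Icc]
      refine ENNReal.toReal_le_of_le_ofReal (by positivity) ((measure_mono inter_subset_left).trans ?_)
      rw [Real.volume_Icc]
      exact le_of_eq (by congr 1; ring)
    calc _ ≤ 2 * ε * (M / ε) := by gcongr
      _ = 2 * M := by field_simp
  have e3 : ‖∫ x, (F x - F a) * ((deriv (cutoff a b ε) x : ℝ) : ℂ) ∂(vol a b)‖ ≤ δ' * (4 * M) := by
    refine (norm_integral_le_of_norm_le (((hint _ _).add (hint _ _)).const_mul δ')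
      ((ae_restrict_iff' measurableSet_Ioo).2 (Eventually.of_forall e2))).trans ?_
    rw [integral_const_mul]
    refine mul_le_mul_of_nonneg_left ?_ hδ'0.le
    simp only [Pi.add_apply]
    rw [integral_add (hint _ _) (hint _ _)]
    have := hle a
    have h2 := hle (b - 2 * ε)
    rw [sub_add_cancel] at h2
    linarith
  rw [dist_zero_right, e1]
  refine e3.trans_lt ?_
  rw [hδ', div_div, div_mul_eq_mul_div, div_lt_iff₀ (by positivity)]
  nlinarith

/-- The derivative of a test function is again a test function. This reduces higher weak derivatives
to repeated first-order ones. -/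
theorem _root_.GPE.IsWeakDeriv.step {k : ℕ} {u v w : ℝ → ℂ} (h : IsWeakDeriv a b k u v)
    (h' : IsWeakDeriv a b (k + 1) u w) : IsWeakDeriv a b 1 v w := by
  intro φ h1 h2 h3
  have hd : ContDiff ℝ ∞ (deriv φ) := by
    have := (contDiff_infty_iff_deriv.1 h1).2; exact this
  have e1 := h (deriv φ) hd h2.deriv ((tsupport_deriv_subset).trans h3)
  have e2 := h' φ h1 h2 h3
  rw [iteratedDeriv_succ'] at e2
  rw [e2] at e1
  simp only [iteratedDeriv_one]
  have h4 : ((-1 : ℂ) ^ k) * (-1) ^ k = 1 := by rw [← mul_pow]; simp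
  have := congrArg (fun z => (-1 : ℂ) ^ k * z) e1
  simp only [← mul_assoc, h4, one_mul] at this
  rw [← this, pow_succ, ← mul_assoc, h4]
  ring

theorem _root_.GPE.IsWeakDeriv.unique {k : ℕ} {u v w : ℝ → ℂ} (h : IsWeakDeriv a b k u v)
    (h' : IsWeakDeriv a b k u w) (hv : Integrable v (vol a b)) (hw : Integrable w (vol a b)) :
    v =ᵐ[vol a b] w := by
  have hi : IntegrableOn (fun x => v x - w x) (Ioo a b) := hv.sub hw
  have := isOpen_Ioo.ae_eq_zero_of_integral_contDiff_smul_eq_zero (μ := volume)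
    hi.locallyIntegrableOn fun φ h1 h2 h3 => by
      have e1 : ∫ x, φ x • (v x - w x) = ∫ x, φ x • (v x - w x) ∂(vol a b) := by
        rw [setIntegral_eq_integral_of_forall_compl_eq_zero]
        intro x hx
        rw [image_eq_zero_of_notMem_tsupport fun h => hx (h3 h), zero_smul]
      obtain ⟨C, hC⟩ := h2.exists_bound_of_continuous h1.continuous
      have hm : ∀ z : ℝ → ℂ, Integrable z (vol a b) →
          Integrable (fun x => z x * (φ x : ℂ)) (vol a b) := fun z hz =>
        hz.mul_bdd (c := C) (Complex.continuous_ofReal.comp h1.continuous).aestronglyMeasurable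
          (Eventually.of_forall fun x => by simpa using hC x)
      have e2 := (h φ h1 h2 h3).symm.trans (h' φ h1 h2 h3)
      have e3 := mul_left_cancel₀ (pow_ne_zero k (by norm_num : (-1 : ℂ) ≠ 0)) e2
      rw [e1]
      have e4 : (fun x => φ x • (v x - w x)) = fun x => v x * (φ x : ℂ) - w x * (φ x : ℂ) := by
        funext x; rw [Complex.real_smul]; ring
      rw [e4, integral_sub (hm v hv) (hm w hw), e3, sub_self]
  have := (ae_restrict_iff' (μ := volume) measurableSet_Ioo).2 this
  filter_upwards [this] with x hx
  exact sub_eq_zero.1 hx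

/-- Integration by parts against a smooth `e` without compact support: test with `e` times a cutoff
and let the layers shrink. The boundary term disappears because `w e` takes equal values at both
ends. -/
theorem _root_.GPE.IsWeakDeriv.integral_mul (hab : a < b) {u v w : ℝ → ℂ} (h : IsWeakDeriv a b 1 u v)
    (hv : Integrable v (vol a b)) (hw : ContinuousOn w (Icc a b)) (huw : u =ᵐ[vol a b] w)
    (hwab : w a = w b) {e : ℝ → ℝ} (he : ContDiff ℝ ∞ e) (heab : e a = e b) :
    ∫ x, u x * ((deriv e x : ℝ) : ℂ) ∂(vol a b) = -∫ x, v x * ((e x : ℝ) : ℂ) ∂(vol a b) := by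
  have hwi : Integrable w (vol a b) := (hw.integrableOn_Icc).mono_set Ioo_subset_Icc_self
  have hui : Integrable u (vol a b) := hwi.congr huw.symm
  have hec : Continuous e := he.continuous
  have hdc : Continuous (deriv e) := he.continuous_deriv (by exact_mod_cast le_top)
  obtain ⟨Ce, hCe⟩ := isCompact_Icc.exists_bound_of_continuousOn (s := Icc a b) hec.continuousOn
  obtain ⟨Cd, hCd⟩ := isCompact_Icc.exists_bound_of_continuousOn (s := Icc a b) hdc.continuousOn
  have hdom : ∀ (z : ℝ → ℂ) (f : ℝ → ℝ) (C : ℝ), Integrable z (vol a b) → Continuous f →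
      (∀ x ∈ Icc a b, ‖f x‖ ≤ C) → Tendsto (fun ε => ∫ x, z x * ((cutoff a b ε x * f x : ℝ) : ℂ)
        ∂(vol a b)) (𝓝[>] 0) (𝓝 (∫ x, z x * ((f x : ℝ) : ℂ) ∂(vol a b))) := by
    intro z f C hz hf hC
    refine tendsto_integral_filter_of_dominated_convergence (fun x => ‖z x‖ * C) ?_ ?_
      (hz.norm.mul_const C) ?_
    · refine Eventually.of_forall fun ε => hz.aestronglyMeasurable.mul ?_
      exact (Complex.continuous_ofReal.comp
        ((contDiff_cutoff ε).continuous.mul hf)).aestronglyMeasurable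
    · refine Eventually.of_forall fun ε => (ae_restrict_iff' measurableSet_Ioo).2
        (Eventually.of_forall fun x hx => ?_)
      rw [norm_mul, Complex.norm_real, norm_mul]
      refine mul_le_mul_of_nonneg_left ?_ (norm_nonneg _)
      have := hC x (Ioo_subset_Icc_self hx)
      refine (mul_le_of_le_one_left (norm_nonneg _) (abs_cutoff_le ε x)).trans this
    · refine (ae_restrict_iff' measurableSet_Ioo).2 (Eventually.of_forall fun x hx => ?_)
      refine tendsto_const_nhds.congr' ?_
      filter_upwards [cutoff_eventually hx] with ε hε
      rw [hε, one_mul]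
  have hfin : Tendsto (fun ε => ∫ x, w x * (e x : ℂ) * ((deriv (cutoff a b ε) x : ℝ) : ℂ) ∂(vol a b))
      (𝓝[>] 0) (𝓝 0) := by
    refine tendsto_integral_mul_deriv_cutoff hab (F := fun x => w x * (e x : ℂ))
      (hw.mul (Complex.continuous_ofReal.comp hec).continuousOn) ?_
    simp only [hwab, heab]
  have hl := (hdom u (deriv e) Cd hui hdc hCd).add hfin
  rw [add_zero] at hl
  refine tendsto_nhds_unique hl ((hdom v e Ce hv hec hCe).neg.congr' ?_)
  filter_upwards [self_mem_nhdsWithin] with ε hε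
  have hε : 0 < ε := hε
  have hts : tsupport (fun x => cutoff a b ε x * e x) ⊆ Icc (a + ε) (b - ε) :=
    (tsupport_mul_subset_left).trans (tsupport_cutoff_subset hε)
  have e1 := h (fun x => cutoff a b ε x * e x) ((contDiff_cutoff ε).mul he)
    (isCompact_Icc.of_isClosed_subset (isClosed_tsupport _) hts)
    (hts.trans fun x hx => ⟨by linarith [hx.1], by linarith [hx.2]⟩)
  rw [pow_one, neg_one_mul] at e1
  rw [← e1]
  simp only [iteratedDeriv_one]
  have hcd : Continuous (deriv (cutoff a b ε)) :=
    (contDiff_cutoff ε).continuous_deriv (by exact_mod_cast le_top)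
  have hd : ∀ x, deriv (fun x => cutoff a b ε x * e x) x
      = deriv (cutoff a b ε) x * e x + cutoff a b ε x * deriv e x := fun x =>
    deriv_fun_mul ((contDiff_cutoff ε).differentiable (by simp) x) (he.differentiable (by simp) x)
  have hI : ∀ (f : ℝ → ℝ), Continuous f → Integrable (fun x => u x * ((f x : ℝ) : ℂ)) (vol a b) := by
    intro f hf
    obtain ⟨C, hC⟩ := isCompact_Icc.exists_bound_of_continuousOn (s := Icc a b) hf.continuousOn
    refine hui.mul_bdd (c := C) (Complex.continuous_ofReal.comp hf).aestronglyMeasurable ?_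
    exact (ae_restrict_iff' measurableSet_Ioo).2
      (Eventually.of_forall fun x hx => by simpa using hC x (Ioo_subset_Icc_self hx))
  have e2 : ∫ x, w x * (e x : ℂ) * ((deriv (cutoff a b ε) x : ℝ) : ℂ) ∂(vol a b)
      = ∫ x, u x * ((deriv (cutoff a b ε) x * e x : ℝ) : ℂ) ∂(vol a b) :=
    integral_congr_ae (by filter_upwards [huw] with x hx; rw [hx]; push_cast; ring)
  have i1 := hI (fun x => cutoff a b ε x * deriv e x) ((contDiff_cutoff ε).continuous.mul hdc)
  have i2 := hI (fun x => deriv (cutoff a b ε) x * e x) (hcd.mul hec)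
  rw [e2, ← integral_add i1 i2]
  refine integral_congr_ae (Eventually.of_forall fun x => ?_)
  simp only [hd]
  push_cast; ring

theorem _root_.GPE.IsWeakDeriv.of_hasDerivAt (hab : a < b) {F F' : ℝ → ℂ} (hF : ∀ x, HasDerivAt F (F' x) x)
    (hF' : Continuous F') : IsWeakDeriv a b 1 F F' := by
  intro φ h1 h2 h3
  have hd : Continuous (deriv φ) := h1.continuous_deriv (by exact_mod_cast le_top)
  have hφ : ∀ x, HasDerivAt (fun x => ((φ x : ℝ) : ℂ)) ((deriv φ x : ℝ) : ℂ) x := fun x =>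
    (h1.differentiable (by simp) x).hasDerivAt.ofReal_comp
  have e := intervalIntegral.integral_mul_deriv_eq_deriv_mul (a := a) (b := b)
    (fun x _ => hF x) (fun x _ => hφ x) (hF'.intervalIntegrable _ _)
    ((Complex.continuous_ofReal.comp hd).intervalIntegrable _ _)
  have ha : φ a = 0 := image_eq_zero_of_notMem_tsupport fun h => lt_irrefl _ (h3 h).1
  have hb : φ b = 0 := image_eq_zero_of_notMem_tsupport fun h => lt_irrefl _ (h3 h).2
  rw [integral_vol hab, integral_vol hab]
  simp only [iteratedDeriv_one]
  rw [e, ha, hb]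
  simp

theorem isWeakDeriv_zero (u : ℝ → ℂ) : IsWeakDeriv a b 0 u u := by
  intro φ _ _ _
  simp

end WeakDerivatives

/-! ### Fourier coefficients on the interval. -/

section IntervalCoefficients

variable {a b : ℝ} [hL : Fact (0 < b - a)]

theorem lt_of_fact : a < b := sub_pos.1 hL.out

theorem integrable_L2 (f : L2 a b) : Integrable f (vol a b) := (Lp.memLp f).integrable (by norm_num)

/-- The periodic function on the line with period `b - a` given by a function on the circle, with
`a` corresponding to the base point of the circle. -/
def pull (a b : ℝ) (U : PerC (b - a)) (x : ℝ) : ℂ := U ((x - a : ℝ) : AddCircle (b - a))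

theorem continuous_pull (U : PerC (b - a)) : Continuous (pull a b U) :=
  U.continuous.comp ((AddCircle.continuous_mk' _).comp (continuous_id.sub continuous_const))

theorem mode_eq_fourier (l : ℤ) (x : ℝ) :
    mode a b l x = fourier l ((x - a : ℝ) : AddCircle (b - a)) := by
  rw [mode, fourier_coe_apply]
  congr 1
  simp only [GPE.μ]
  push_cast
  ring

theorem exp_neg_eq_fourier (l : ℤ) (x : ℝ) : Complex.exp (-Complex.I * GPE.μ a b l * (x - a))
    = fourier (-l) ((x - a : ℝ) : AddCircle (b - a)) := by
  rw [fourier_coe_apply]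
  congr 1
  simp only [GPE.μ]
  push_cast
  ring

theorem coeffHat_eq (f : ℝ → ℂ) (l : ℤ) : coeffHat a b f l
    = 1 / (b - a) * ∫ x, f x * fourier (-l) ((x - a : ℝ) : AddCircle (b - a)) ∂(vol a b) := by
  rw [coeffHat, integral_vol lt_of_fact]
  simp only [exp_neg_eq_fourier]

theorem coeffHat_congr {f g : ℝ → ℂ} (h : f =ᵐ[vol a b] g) (l : ℤ) :
    coeffHat a b f l = coeffHat a b g l := by
  rw [coeffHat_eq, coeffHat_eq]
  congr 1
  exact integral_congr_ae (by filter_upwards [h] with x hx; rw [hx])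

theorem coeffHat_pull (U : PerC (b - a)) (l : ℤ) : coeffHat a b (pull a b U) l = coeff l U := by
  rw [coeff_apply, fourierCoeff_eq_intervalIntegral _ _ 0, coeffHat]
  simp only [exp_neg_eq_fourier, pull]
  rw [intervalIntegral.integral_comp_sub_right
    (fun y => U (y : AddCircle (b - a)) * fourier (-l) (y : AddCircle (b - a))) a, sub_self,
    zero_add, Complex.real_smul]
  push_cast
  congr 1
  refine intervalIntegral.integral_congr fun x _ => ?_
  simp only [smul_eq_mul]
  ring

theorem integrable_mul_fourier {f : ℝ → ℂ} (hf : Integrable f (vol a b)) (l : ℤ) :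
    Integrable (fun x => f x * fourier (-l) ((x - a : ℝ) : AddCircle (b - a))) (vol a b) := by
  refine hf.mul_bdd (c := 1) (continuous_pull (fourier (-l))).aestronglyMeasurable ?_
  refine Eventually.of_forall fun x => ?_
  rw [fourier_apply, Circle.norm_coe]

theorem coeffHat_add {f g : ℝ → ℂ} (hf : Integrable f (vol a b)) (hg : Integrable g (vol a b))
    (l : ℤ) : coeffHat a b (fun x => f x + g x) l = coeffHat a b f l + coeffHat a b g l := by
  simp only [coeffHat_eq, add_mul]
  rw [integral_add (integrable_mul_fourier hf l) (integrable_mul_fourier hg l), mul_add]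

theorem coeffHat_smul (c : ℂ) (f : ℝ → ℂ) (l : ℤ) :
    coeffHat a b (fun x => c * f x) l = c * coeffHat a b f l := by
  simp only [coeffHat_eq, mul_assoc]
  rw [integral_const_mul]
  ring

theorem norm_sq_L2 (f : L2 a b) : ‖f‖ ^ 2 = ∫ x, ‖f x‖ ^ 2 ∂(vol a b) := by
  have h : ((‖f‖ ^ 2 : ℝ) : ℂ) = ((∫ x, ‖f x‖ ^ 2 ∂(vol a b) : ℝ) : ℂ) := by
    have h1 := inner_self_eq_norm_sq_to_K (𝕜 := ℂ) f
    rw [MeasureTheory.L2.inner_def] at h1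
    simp only [inner_self_eq_norm_sq_to_K] at h1
    rw [← integral_complex_ofReal]
    push_cast
    exact h1.symm
  exact_mod_cast h

/-- Parseval's identity on `(a, b)`. -/
theorem hasSum_sq_coeffHat (f : L2 a b) :
    HasSum (fun l => ‖coeffHat a b f l‖ ^ 2) ((b - a)⁻¹ * ‖f‖ ^ 2) := by
  have hab : a < b := lt_of_fact
  have hm : MemLp f 2 (volume.restrict (Ioc a b)) := by
    rw [← Measure.restrict_congr_set Ioo_ae_eq_Ioc]; exact Lp.memLp f
  have h := hasSum_sq_fourierCoeffOn hab hm
  have e : ∫ x in a..b, ‖f x‖ ^ 2 = ‖f‖ ^ 2 := by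
    rw [norm_sq_L2, intervalIntegral.integral_of_le hab.le, integral_Ioc_eq_integral_Ioo]
  rw [e, smul_eq_mul] at h
  convert! h using 2 with l
  rw [fourierCoeffOn_eq_integral, coeffHat_eq, integral_vol hab]
  -- Coefficients based at `a` and at `0` differ by a unimodular phase, which does not affect
  -- moduli.
  have e2 : ∀ x : ℝ, (fourier (-l) ((x - a : ℝ) : AddCircle (b - a)) : ℂ)
      = fourier (-l) ((-a : ℝ) : AddCircle (b - a)) * fourier (-l) (x : AddCircle (b - a)) := by
    intro x
    simp only [fourier_coe_apply, ← Complex.exp_add]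
    congr 1
    push_cast
    ring
  have e3 : ∀ x : ℝ, f x * fourier (-l) ((x - a : ℝ) : AddCircle (b - a))
      = fourier (-l) ((-a : ℝ) : AddCircle (b - a)) * (fourier (-l) (x : AddCircle (b - a)) • f x) := by
    intro x
    rw [e2, smul_eq_mul]; ring
  simp only [e3]
  rw [intervalIntegral.integral_const_mul, norm_mul, norm_mul, fourier_apply, Circle.norm_coe,
    one_mul, norm_smul]
  norm_num
  rw [← Complex.ofReal_sub, Complex.norm_real, Real.norm_eq_abs]

/-- The `l`-th Fourier coefficient on `(a, b)` as a continuous linear functional. -/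
def coeffL2 (l : ℤ) : L2 a b →L[ℂ] ℂ :=
  LinearMap.mkContinuous
    { toFun := fun f => coeffHat a b f l
      map_add' := fun f g => by
        rw [coeffHat_congr (Lp.coeFn_add f g)]
        exact coeffHat_add (integrable_L2 f) (integrable_L2 g) l
      map_smul' := fun c f => by
        rw [coeffHat_congr (Lp.coeFn_smul c f)]
        exact coeffHat_smul c f l } (√(b - a)⁻¹) fun f => by
    have h := (hasSum_sq_coeffHat f)
    have h1 := le_hasSum h l fun _ _ => sq_nonneg _
    have h2 := hL.out
    refine (sq_le_sq₀ (norm_nonneg _) (by positivity)).1 ?_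
    rw [mul_pow, Real.sq_sqrt (by positivity)]
    exact h1

theorem coeffL2_apply (l : ℤ) (f : L2 a b) : coeffL2 l f = coeffHat a b f l := rfl

/-- Test functions are real, so the exponential is split into cosine and sine; both have equal
values at `a` and `b`, as the integration by parts requires. -/
theorem coeffHat_of_isWeakDeriv {u v w : ℝ → ℂ} (h : IsWeakDeriv a b 1 u v)
    (hv : Integrable v (vol a b)) (hw : ContinuousOn w (Icc a b)) (huw : u =ᵐ[vol a b] w)
    (hwab : w a = w b) (l : ℤ) :
    coeffHat a b v l = Complex.I * GPE.μ a b l * coeffHat a b u l := by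
  have hab : a < b := lt_of_fact
  have hui : Integrable u (vol a b) :=
    Integrable.congr ((hw.integrableOn_Icc).mono_set Ioo_subset_Icc_self) huw.symm
  set m := GPE.μ a b l with hm
  have hmb : m * (b - a) = l * (2 * Real.pi) := by
    have := hL.out.ne'
    rw [hm, GPE.μ]; field_simp
  have hd : ∀ x, HasDerivAt (fun x => m * (x - a)) m x := fun x => by
    simpa using ((hasDerivAt_id x).sub_const a).const_mul m
  have hlin : ContDiff ℝ ∞ fun x : ℝ => m * (x - a) :=
    contDiff_const.mul (contDiff_id.sub contDiff_const)
  have e1 := h.integral_mul hab hv hw huw hwab (e := fun x => Real.cos (m * (x - a)))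
    (Real.contDiff_cos.comp hlin) (by simp only [sub_self, mul_zero, hmb]; simp [Real.cos_int_mul_two_pi])
  have e2 := h.integral_mul hab hv hw huw hwab (e := fun x => Real.sin (m * (x - a)))
    (Real.contDiff_sin.comp hlin) (by
      simp only [sub_self, mul_zero, hmb]
      have : (l : ℝ) * (2 * Real.pi) = ((2 * l : ℤ) : ℝ) * Real.pi := by push_cast; ring
      rw [this, Real.sin_int_mul_pi, Real.sin_zero])
  have d1 : ∀ x, deriv (fun x => Real.cos (m * (x - a))) x = -(m * Real.sin (m * (x - a))) :=
    fun x => by rw [((hd x).cos).deriv]; ring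
  have d2 : ∀ x, deriv (fun x => Real.sin (m * (x - a))) x = m * Real.cos (m * (x - a)) :=
    fun x => by rw [((hd x).sin).deriv]; ring
  simp only [d1] at e1
  simp only [d2] at e2
  have hI : ∀ z : ℝ → ℂ, Integrable z (vol a b) → ∀ f : ℝ → ℝ, Continuous f → (∀ x, |f x| ≤ 1) →
      Integrable (fun x => z x * ((f x : ℝ) : ℂ)) (vol a b) := fun z hz f hf hf1 =>
    hz.mul_bdd (c := 1) (Complex.continuous_ofReal.comp hf).aestronglyMeasurable
      (Eventually.of_forall fun x => by simpa using hf1 x)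
  have hcosc : Continuous fun x => Real.cos (m * (x - a)) := by fun_prop
  have hsinc : Continuous fun x => Real.sin (m * (x - a)) := by fun_prop
  have key : ∀ z : ℝ → ℂ, Integrable z (vol a b) →
      ∫ x, z x * Complex.exp (-Complex.I * m * (x - a)) ∂(vol a b)
        = ∫ x, z x * ((Real.cos (m * (x - a)) : ℝ) : ℂ) ∂(vol a b)
          - Complex.I * ∫ x, z x * ((Real.sin (m * (x - a)) : ℝ) : ℂ) ∂(vol a b) := by
    intro z hz
    rw [← integral_const_mul, ← integral_sub (hI z hz _ hcosc fun x => Real.abs_cos_le_one _)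
      ((hI z hz _ hsinc fun x => Real.abs_sin_le_one _).const_mul _)]
    congr 1
    ext x
    have : -Complex.I * m * (x - a) = ((-(m * (x - a)) : ℝ) : ℂ) * Complex.I := by push_cast; ring
    rw [this, Complex.exp_mul_I, ← Complex.ofReal_cos, ← Complex.ofReal_sin, Real.cos_neg,
      Real.sin_neg]
    push_cast; ring
  have c1 : ∫ x, u x * ((-(m * Real.sin (m * (x - a))) : ℝ) : ℂ) ∂(vol a b)
      = -m * ∫ x, u x * ((Real.sin (m * (x - a)) : ℝ) : ℂ) ∂(vol a b) := by
    rw [← integral_const_mul]; congr 1; ext x; push_cast; ring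
  have c2 : ∫ x, u x * ((m * Real.cos (m * (x - a)) : ℝ) : ℂ) ∂(vol a b)
      = m * ∫ x, u x * ((Real.cos (m * (x - a)) : ℝ) : ℂ) ∂(vol a b) := by
    rw [← integral_const_mul]; congr 1; ext x; push_cast; ring
  rw [c1] at e1
  rw [c2] at e2
  rw [coeffHat, coeffHat, ← integral_vol hab, ← integral_vol hab, key v hv, key u hui]
  have e1' : ∫ x, v x * ((Real.cos (m * (x - a)) : ℝ) : ℂ) ∂(vol a b)
      = m * ∫ x, u x * ((Real.sin (m * (x - a)) : ℝ) : ℂ) ∂(vol a b) := by linear_combination e1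
  have e2' : ∫ x, v x * ((Real.sin (m * (x - a)) : ℝ) : ℂ) ∂(vol a b)
      = -(m * ∫ x, u x * ((Real.cos (m * (x - a)) : ℝ) : ℂ) ∂(vol a b)) := by linear_combination e2
  rw [e1', e2']
  linear_combination (1 / (b - a) * (m : ℂ) *
    ∫ x, u x * ((Real.sin (m * (x - a)) : ℝ) : ℂ) ∂(vol a b)) * Complex.I_sq

end IntervalCoefficients

/-! ### From tuples of weak derivatives to Fourier weights. -/

section Jets

variable {a b : ℝ} [hL : Fact (0 < b - a)]

/-- The jet `j` consists of the derivatives of `U` up to order `m`, in terms of Fourier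
coefficients. -/
def JetOf (m : ℕ) (U : PerC (b - a)) (j : Jet a b m) : Prop :=
  ∀ (k : Fin (m + 1)) (l : ℤ), coeffHat a b (j k) l = (Complex.I * GPE.μ a b l) ^ (k : ℕ) * coeff l U

theorem JetOf.smul {m : ℕ} {U : PerC (b - a)} {j : Jet a b m} (h : JetOf m U j) (c : ℂ) :
    JetOf m (c • U) (c • j) := fun k l => by
  have := (coeffL2 (a := a) (b := b) l).map_smul c (j k)
  simp only [coeffL2_apply] at this
  rw [PiLp.smul_apply, this, h k l, map_smul, smul_eq_mul, smul_eq_mul]; ring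

theorem JetOf.sub {m : ℕ} {U U' : PerC (b - a)} {j j' : Jet a b m} (h : JetOf m U j)
    (h' : JetOf m U' j') : JetOf m (U - U') (j - j') := fun k l => by
  have := (coeffL2 (a := a) (b := b) l).map_sub (j k) (j' k)
  simp only [coeffL2_apply] at this
  rw [PiLp.sub_apply, this, h k l, h' k l, map_sub]; ring

theorem norm_component_le {m : ℕ} (j : Jet a b m) (k : Fin (m + 1)) : ‖j k‖ ≤ ‖j‖ :=
  PiLp.norm_apply_le j k

/-- Since `(1 + |l|)^m ≤ 2^m(1 + |l|^m)`, Parseval for the function and its top derivative suffices;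
`q` converts `|μ_l|` into `|l|`. -/
theorem JetOf.bd (m : ℕ) : ∃ C, 0 ≤ C ∧ ∀ (U : PerC (b - a)) (j : Jet a b m), JetOf m U j →
    Bd m U (C * ‖j‖) := by
  have hLp := hL.out
  set q : ℝ := (b - a) / (2 * Real.pi)
  have hq : 0 ≤ q := by positivity
  set A : ℝ := (2 ^ m) ^ 2 * (2 * (1 + (q ^ m) ^ 2)) * (b - a)⁻¹
  have hA : 0 ≤ A := by positivity
  refine ⟨√A, Real.sqrt_nonneg _, fun U j h => bd_iff.2 ⟨by positivity, fun F => ?_⟩⟩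
  have hsum : ∀ k, ∑ l ∈ F, ‖coeffHat a b (j k) l‖ ^ 2 ≤ (b - a)⁻¹ * ‖j‖ ^ 2 := fun k =>
    (sum_le_hasSum F (fun _ _ => sq_nonneg _) (hasSum_sq_coeffHat (j k))).trans (by
      gcongr; exact norm_component_le j k)
  have hpt : ∀ l, (wt l ^ m * ‖coeff l U‖) ^ 2 ≤ (2 ^ m) ^ 2 * (2 * (‖coeffHat a b (j 0) l‖ ^ 2
      + (q ^ m) ^ 2 * ‖coeffHat a b (j (Fin.last m)) l‖ ^ 2)) := by
    intro l
    have h0 : coeffHat a b (j 0) l = coeff l U := by simpa using h 0 l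
    have h1 : q ^ m * ‖coeffHat a b (j (Fin.last m)) l‖ = |(l : ℝ)| ^ m * ‖coeff l U‖ := by
      rw [h (Fin.last m) l, norm_mul, norm_pow, norm_mul, Complex.norm_I, one_mul,
        Complex.norm_real, Fin.val_last, ← mul_assoc, ← mul_pow]
      congr 2
      rw [GPE.μ, Real.norm_eq_abs, abs_div, abs_mul, abs_of_pos hLp,
        abs_of_pos (by positivity : 0 < 2 * Real.pi)]
      simp only [q]
      have := Real.pi_pos.ne'
      field_simp
    have h2 : wt l ^ m ≤ 2 ^ m * (1 + |(l : ℝ)| ^ m) := by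
      have h3 := add_pow_le zero_le_one (abs_nonneg (l : ℝ)) m
      rw [one_pow] at h3
      refine h3.trans ?_
      gcongr
      · norm_num
      · omega
    have h3 : wt l ^ m * ‖coeff l U‖ ≤ 2 ^ m * (‖coeffHat a b (j 0) l‖
        + q ^ m * ‖coeffHat a b (j (Fin.last m)) l‖) := by
      rw [h1, h0]
      calc _ ≤ 2 ^ m * (1 + |(l : ℝ)| ^ m) * ‖coeff l U‖ := by gcongr
        _ = _ := by ring
    have hw := wt_pos l
    calc _ ≤ (2 ^ m * (‖coeffHat a b (j 0) l‖
        + q ^ m * ‖coeffHat a b (j (Fin.last m)) l‖)) ^ 2 := by gcongr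
      _ ≤ _ := by
        rw [mul_pow, ← mul_pow (q ^ m)]
        gcongr
        exact add_sq_le
  calc _ ≤ ∑ l ∈ F, (2 ^ m) ^ 2 * (2 * (‖coeffHat a b (j 0) l‖ ^ 2
      + (q ^ m) ^ 2 * ‖coeffHat a b (j (Fin.last m)) l‖ ^ 2)) := Finset.sum_le_sum fun l _ => hpt l
    _ = (2 ^ m) ^ 2 * (2 * (∑ l ∈ F, ‖coeffHat a b (j 0) l‖ ^ 2
      + (q ^ m) ^ 2 * ∑ l ∈ F, ‖coeffHat a b (j (Fin.last m)) l‖ ^ 2)) := by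
        rw [← Finset.mul_sum, ← Finset.mul_sum, Finset.sum_add_distrib, ← Finset.mul_sum]
    _ ≤ (2 ^ m) ^ 2 * (2 * ((b - a)⁻¹ * ‖j‖ ^ 2 + (q ^ m) ^ 2 * ((b - a)⁻¹ * ‖j‖ ^ 2))) := by
        gcongr <;> exact hsum _
    _ = _ := by rw [mul_pow, Real.sq_sqrt hA]; ring

theorem norm_le_of_coeffHat (f : L2 a b) {M : ℝ}
    (h : ∀ F : Finset ℤ, ∑ l ∈ F, ‖coeffHat a b f l‖ ^ 2 ≤ M ^ 2) :
    ‖f‖ ^ 2 ≤ (b - a) * M ^ 2 := by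
  have hLp := hL.out
  have h1 := hasSum_le_of_sum_le (hasSum_sq_coeffHat f) h
  calc ‖f‖ ^ 2 = (b - a) * ((b - a)⁻¹ * ‖f‖ ^ 2) := by field_simp
    _ ≤ _ := by gcongr

/-- The representative continuous on `[a, b]` has equal end values, so it descends to a continuous
function on the circle. -/
theorem exists_rep {m : ℕ} (hm : 0 < m) {g : Jet a b m} (hg : g ∈ HPer a b m) :
    ∃ U : PerC (b - a), g 0 =ᵐ[vol a b] pull a b U := by
  obtain ⟨w, hw, hgw, hab⟩ := hg.2 0 hm
  have hLp := hL.out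
  have hc : Continuous (liftIco (b - a) 0 fun y => w (y + a)) := by
    refine liftIco_continuous (by simpa using hab) (hw.comp (by fun_prop) ?_)
    intro y hy
    rw [zero_add] at hy
    exact ⟨by linarith [hy.1], by linarith [hy.2]⟩
  refine ⟨⟨_, hc⟩, hgw.trans ((ae_restrict_iff' measurableSet_Ioo).2
    (Eventually.of_forall fun x hx => ?_))⟩
  change w x = liftIco (b - a) 0 (fun y => w (y + a)) ((x - a : ℝ) : AddCircle (b - a))
  rw [liftIco_zero_coe_apply ⟨by linarith [hx.1], by linarith [hx.2]⟩, sub_add_cancel]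

/-- Induction on the order: the passage from `k` to `k + 1` uses the matching boundary values of the
`k`-th derivative, which are available exactly for `k < m`. -/
theorem jetOf_of_mem_hPer {m : ℕ} {g : Jet a b m} (hg : g ∈ HPer a b m) {U : PerC (b - a)}
    (hU : g 0 =ᵐ[vol a b] pull a b U) : JetOf m U g := by
  rintro ⟨k, hk⟩ l
  induction k with
  | zero =>
    simp only [pow_zero, one_mul]
    exact (coeffHat_congr hU l).trans (coeffHat_pull U l)
  | succ k ih =>
    have hk' : k < m := by omega
    obtain ⟨w, hw, hgw, hab⟩ := hg.2 ⟨k, by omega⟩ hk'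
    have h1 := (hg.1 ⟨k, by omega⟩).step (hg.1 ⟨k + 1, hk⟩)
    rw [coeffHat_of_isWeakDeriv h1 (integrable_L2 _) hw hgw hab l, ih (by omega)]
    ring

/-- No periodicity is assumed of `j`. Its weak derivatives coincide with those of the periodic `g`
by uniqueness, and so inherit the multiplier formula. -/
theorem jetOf_of_mem_H {m n : ℕ} (hn : n ≤ m) {g : Jet a b m} (hg : g ∈ HPer a b m) {j : Jet a b n}
    (hj : j ∈ H a b n) {U : PerC (b - a)} (hgU : g 0 =ᵐ[vol a b] pull a b U)
    (hjU : j 0 =ᵐ[vol a b] pull a b U) : JetOf n U j := by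
  rintro ⟨k, hk⟩ l
  have h1 : IsWeakDeriv a b k (g 0) (g ⟨k, by omega⟩) := hg.1 ⟨k, by omega⟩
  have h2 : IsWeakDeriv a b k (j 0) (j ⟨k, hk⟩) := hj ⟨k, hk⟩
  have h3 := h1.congr (hjU.trans hgU.symm) EventuallyEq.rfl
  rw [coeffHat_congr (h2.unique h3 (integrable_L2 _) (integrable_L2 _)) l]
  exact jetOf_of_mem_hPer hg hgU ⟨k, by omega⟩ l

end Jets

/-! ### Lipschitz and second-difference bounds for curves in normed spaces. -/

section TimeRegularity

variable {E : Type*} [NormedAddCommGroup E] [NormedSpace ℝ E] {T : ℝ} {f : ℝ → E}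

theorem exists_lipschitz (hT : 0 < T) (hf : ContDiffOn ℝ 1 f (Icc 0 T)) :
    ∃ K, 0 ≤ K ∧ ∀ s ∈ Icc 0 T, ∀ t ∈ Icc 0 T, ‖f t - f s‖ ≤ K * |t - s| := by
  have hc := hf.continuousOn_derivWithin (uniqueDiffOn_Icc hT) le_rfl
  obtain ⟨K, hK⟩ := isCompact_Icc.exists_bound_of_continuousOn hc
  refine ⟨max K 0, le_max_right _ _, fun s hs t ht => ?_⟩
  exact Convex.norm_image_sub_le_of_norm_derivWithin_le (hf.differentiableOn one_ne_zero)
    (fun x hx => (hK x hx).trans (le_max_left _ _)) (convex_Icc 0 T) hs ht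

/-- First-order Taylor expansion at `t`, with remainder controlled by the Lipschitz constant of the
derivative, is used at both `t + θτ` and `t + τ`; the linear terms cancel. -/
theorem exists_second_difference (hT : 0 < T) (hf : ContDiffOn ℝ 2 f (Icc 0 T)) :
    ∃ K, 0 ≤ K ∧ ∀ t τ θ : ℝ, 0 ≤ t → 0 < τ → t + τ ≤ T → 0 ≤ θ → θ ≤ 1 →
      ‖f (t + θ * τ) - (1 - θ) • f t - θ • f (t + τ)‖ ≤ K * τ ^ 2 := by
  have h2 : ContDiffOn ℝ (1 + 1) f (Icc 0 T) := by simpa [one_add_one_eq_two] using hf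
  obtain ⟨hd, -, hd1⟩ := (contDiffOn_succ_iff_derivWithin (uniqueDiffOn_Icc hT)).1 h2
  obtain ⟨K, hK0, hK⟩ := exists_lipschitz hT hd1
  refine ⟨2 * K, by positivity, fun t τ θ ht hτ htτ hθ hθ1 => ?_⟩
  set D := derivWithin f (Icc 0 T)
  have htm : t ∈ Icc 0 T := ⟨ht, by linarith⟩
  have hsub : Icc t (t + τ) ⊆ Icc 0 T := Icc_subset_Icc ht htτ
  have key : ∀ s ∈ Icc t (t + τ), ‖f s - f t - (s - t) • D t‖ ≤ K * τ ^ 2 := by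
    intro s hs
    have hder : ∀ x ∈ Icc t (t + τ), HasDerivWithinAt (fun x => f x - (x - t) • D t) (D x - D t)
        (Icc t (t + τ)) x := fun x hx => by
      have h1 := ((hd x (hsub hx)).hasDerivWithinAt).mono hsub
      have h3 := ((hasDerivWithinAt_id x (Icc t (t + τ))).sub_const t).smul_const (D t)
      rw [one_smul] at h3
      exact h1.sub h3
    have h1 := Convex.norm_image_sub_le_of_norm_hasDerivWithin_le (C := K * τ) hder (fun x hx => by
      refine (hK t htm x (hsub hx)).trans (mul_le_mul_of_nonneg_left ?_ hK0)
      rw [abs_of_nonneg] <;> linarith [hx.1, hx.2]) (convex_Icc _ _)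
      (left_mem_Icc.2 (by linarith)) hs
    simp only [sub_self, zero_smul, sub_zero] at h1
    calc _ = ‖f s - (s - t) • D t - f t‖ := by congr 1; abel
      _ ≤ K * τ * ‖s - t‖ := h1
      _ ≤ K * τ * τ := by
        gcongr
        rw [Real.norm_eq_abs, abs_of_nonneg] <;> linarith [hs.1, hs.2]
      _ = _ := by ring
  have e1 := key (t + θ * τ) ⟨by nlinarith, by nlinarith⟩
  have e2 := key (t + τ) ⟨by linarith, le_rfl⟩
  rw [add_sub_cancel_left] at e1 e2
  have e3 : f (t + θ * τ) - (1 - θ) • f t - θ • f (t + τ)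
      = (f (t + θ * τ) - f t - (θ * τ) • D t) - θ • (f (t + τ) - f t - τ • D t) := by
    module
  rw [e3]
  refine (norm_sub_le _ _).trans ?_
  rw [norm_smul, Real.norm_eq_abs, abs_of_nonneg hθ]
  have := mul_le_of_le_one_left (norm_nonneg (f (t + τ) - f t - τ • D t)) hθ1
  linarith

end TimeRegularity

/-! ### Regularity data extracted from the solution. -/

section SolutionData

variable {a b : ℝ} [hL : Fact (0 < b - a)] {T β : ℝ} {V : ℝ → ℝ} {ψ₀ : ℝ → ℂ} {ψ : ℝ → ℝ → ℂ}
  {V' : PerC (b - a)} {u : ℝ → PerC (b - a)}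

theorem star_eq_of_real (hV : (fun x => (V x : ℂ)) =ᵐ[vol a b] pull a b V') : star V' = V' := by
  refine coeff_ext fun l => ?_
  rw [← coeffHat_pull, ← coeffHat_pull]
  refine coeffHat_congr ?_ l
  filter_upwards [hV] with x hx
  have h : pull a b (star V') x = conj (pull a b V' x) := rfl
  rw [h, ← hx, Complex.conj_ofReal]

/-- A Fourier coefficient is a continuous functional on `L²`, so the time derivative in `L²` passes
through it, while `∂ₓₓ` becomes `(iμ_l)²`. -/
theorem ode_of_isSolution (hsol : IsSolution a b T β V ψ₀ ψ)
    (hV : (fun x => (V x : ℂ)) =ᵐ[vol a b] pull a b V')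
    (hu : ∀ t ∈ Icc 0 T, ψ t =ᵐ[vol a b] pull a b (u t)) (l : ℤ) {t : ℝ} (ht : t ∈ Icc 0 T) :
    HasDerivWithinAt (fun t => coeff l (u t)) (-Complex.I * ((freqL (b - a) l : ℂ) ^ 2
      * coeff l (u t) + coeff l (force V' β (u t)))) (Icc 0 T) t := by
  obtain ⟨Ψ, Ψt, h⟩ := hsol.equation
  obtain ⟨h1, h2, h3⟩ := h t ht
  have e0 : ∀ s ∈ Icc 0 T, coeffL2 l ((Ψ s : Jet a b 2) 0) = coeff l (u s) := fun s hs => by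
    rw [coeffL2_apply, coeffHat_congr ((h s hs).1.trans (hu s hs)), coeffHat_pull]
  have d1 := ((coeffL2 (a := a) (b := b) l).restrictScalars ℝ).hasFDerivAt.comp_hasDerivWithinAt t h2
  have d2 : HasDerivWithinAt (fun t => coeff l (u t)) (coeffHat a b (Ψt t) l) (Icc 0 T) t :=
    d1.congr (fun s hs => (e0 s hs).symm) (e0 t ht).symm
  have hj := jetOf_of_mem_hPer (Ψ t).2 (h1.trans (hu t ht)) 2 l
  have e1 : Ψt t =ᵐ[vol a b] fun x => Complex.I * (Ψ t : Jet a b 2) 2 x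
      + -Complex.I * pull a b (force V' β (u t)) x := by
    filter_upwards [h3, hV, hu t ht] with x hx hVx hux
    have e2 : pull a b (force V' β (u t)) x = pull a b V' x * pull a b (u t) x
        + β * (pull a b (u t) x * conj (pull a b (u t) x) * pull a b (u t) x) := rfl
    rw [e2, ← hVx, ← hux, Complex.mul_conj']
    linear_combination (-Complex.I) * hx + Ψt t x * Complex.I_sq
  have hi : Integrable (pull a b (force V' β (u t))) (vol a b) :=
    ((continuous_pull _).integrableOn_Icc).mono_set Ioo_subset_Icc_self
  rw [coeffHat_congr e1, coeffHat_add ((integrable_L2 _).const_mul _) (hi.const_mul _),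
    coeffHat_smul, coeffHat_smul, hj, coeffHat_pull] at d2
  convert! d2 using 1
  change _ = Complex.I * ((Complex.I * (freqL (b - a) l : ℂ)) ^ 2 * coeff l (u t)) + _
  linear_combination (-Complex.I * (freqL (b - a) l : ℂ) ^ 2 * coeff l (u t)) * Complex.I_sq

theorem timeData_of_isSolution {σ : ℕ} (hT : 0 < T) (hsol : IsSolution a b T β V ψ₀ ψ)
    (hV : (fun x => (V x : ℂ)) =ᵐ[vol a b] pull a b V')
    (hu : ∀ t ∈ Icc 0 T, ψ t =ᵐ[vol a b] pull a b (u t))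
    (hVm : MemSpace (HPer a b (2 + σ)) fun x => (V x : ℂ))
    (h0 : MemC T 0 (HPer a b (4 + σ)) ψ) (h1 : MemC T 1 (H a b (2 + σ)) ψ)
    (h2 : MemC T 2 (H a b σ) ψ) : TimeData T β σ V' u := by
  obtain ⟨Ψ₀, hc₀, hΨ₀⟩ := h0
  obtain ⟨Ψ₁, hc₁, hΨ₁⟩ := h1
  obtain ⟨Ψ₂, hc₂, hΨ₂⟩ := h2
  have j0 : ∀ t ∈ Icc 0 T, JetOf (4 + σ) (u t) (Ψ₀ t : Jet a b (4 + σ)) := fun t ht =>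
    jetOf_of_mem_hPer (Ψ₀ t).2 ((hΨ₀ t ht).trans (hu t ht))
  have j1 : ∀ t ∈ Icc 0 T, JetOf (2 + σ) (u t) (Ψ₁ t : Jet a b (2 + σ)) := fun t ht =>
    jetOf_of_mem_H (by omega) (Ψ₀ t).2 (Ψ₁ t).2 ((hΨ₀ t ht).trans (hu t ht))
      ((hΨ₁ t ht).trans (hu t ht))
  have j2 : ∀ t ∈ Icc 0 T, JetOf σ (u t) (Ψ₂ t : Jet a b σ) := fun t ht =>
    jetOf_of_mem_H (by omega) (Ψ₀ t).2 (Ψ₂ t).2 ((hΨ₀ t ht).trans (hu t ht))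
      ((hΨ₂ t ht).trans (hu t ht))
  refine ⟨star_eq_of_real hV, ?_, ?_, ?_, ?_, fun l t ht => ode_of_isSolution hsol hV hu l ht⟩
  · obtain ⟨g, hg, hgV⟩ := hVm
    obtain ⟨C, hC, h⟩ := JetOf.bd (a := a) (b := b) (2 + σ)
    exact ⟨_, h _ _ (jetOf_of_mem_hPer hg (hgV.trans hV))⟩
  · obtain ⟨C, hC, h⟩ := JetOf.bd (a := a) (b := b) (4 + σ)
    obtain ⟨B, hB⟩ := isCompact_Icc.exists_bound_of_continuousOn hc₀.continuousOn
    exact ⟨C * B, fun t ht => (h _ _ (j0 t ht)).mono (mul_le_mul_of_nonneg_left (hB t ht) hC)⟩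
  · obtain ⟨C, hC, h⟩ := JetOf.bd (a := a) (b := b) (2 + σ)
    obtain ⟨K, hK, hlip⟩ := exists_lipschitz hT hc₁
    refine ⟨C * K, by positivity, fun t ht s hs => ?_⟩
    refine (h _ _ ((j1 t ht).sub (j1 s hs))).mono ?_
    rw [mul_assoc]
    exact mul_le_mul_of_nonneg_left (hlip s hs t ht) hC
  · obtain ⟨C, hC, h⟩ := JetOf.bd (a := a) (b := b) σ
    obtain ⟨K, hK, hsec⟩ := exists_second_difference hT hc₂
    refine ⟨C * K, by positivity, fun t τ θ ht hτ htτ hθ hθ1 => ?_⟩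
    have m0 : t ∈ Icc 0 T := ⟨ht, by linarith⟩
    have m1 : t + τ ∈ Icc 0 T := ⟨by linarith, htτ⟩
    have m2 : t + θ * τ ∈ Icc 0 T := ⟨by nlinarith, by nlinarith⟩
    refine (h _ _ (((j2 _ m2).sub ((j2 _ m0).smul ((1 - θ : ℝ) : ℂ))).sub
      ((j2 _ m1).smul ((θ : ℝ) : ℂ)))).mono ?_
    rw [mul_assoc]
    refine mul_le_mul_of_nonneg_left ?_ hC
    have := hsec t τ θ ht hτ htτ hθ hθ1
    simp only [Complex.coe_smul]
    exact this

end SolutionData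

/-! ### Identification of the grid scheme with `strang`. -/

section GridFunctions

variable {a b : ℝ} [hL : Fact (0 < b - a)] {N : ℕ} {τ β : ℝ} {v : Fin (N + 1) → ℂ}
  {U : PerC (b - a)}

theorem node_sub (a b : ℝ) (N j : ℕ) : node a b N j - a = j * ((b - a) / N) := by
  rw [node, mesh]; ring

theorem pull_node (U : PerC (b - a)) (j : ℕ) : pull a b U (node a b N j) = U (gridPt (b - a) N j) := by
  rw [pull, node_sub]; rfl

/-- The grid vector `v` consists of the values of `U` at the nodes. -/
def GridOf (v : Fin (N + 1) → ℂ) (U : PerC (b - a)) : Prop :=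
  ∀ j : Fin (N + 1), v j = pull a b U (node a b N j)

theorem GridOf.coeffTilde_eq (h : GridOf v U) (l : ℤ) : coeffTilde a b v l = dcoeff N l U := by
  rw [coeffTilde, dcoeff_apply]
  congr 1
  refine Finset.sum_congr rfl fun j _ => ?_
  rw [h j.castSucc, Fin.val_castSucc, pull_node, exp_neg_eq_fourier, node_sub]
  rfl

theorem pull_sum (S : Finset ℤ) (c : ℤ → ℂ) (x : ℝ) :
    pull a b (∑ l ∈ S, c l • (fourier l : PerC (b - a))) x = ∑ l ∈ S, c l * mode a b l x := by
  rw [pull, ContinuousMap.sum_apply]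
  refine Finset.sum_congr rfl fun l _ => ?_
  rw [mode_eq_fourier]; rfl

theorem GridOf.interp_eq (h : GridOf v U) (x : ℝ) :
    interp a b v x = pull a b (interpC N U) x := by
  rw [interpC_apply, pull_sum, interp]
  exact Finset.sum_congr rfl fun l _ => by rw [h.coeffTilde_eq]

theorem freeSym_eq (τ : ℝ) (l : ℤ) : freeSym (b - a) τ l
    = Complex.exp (-Complex.I * (τ / 2) * GPE.μ a b l ^ 2) := by
  rw [freeSym]
  congr 1
  change _ = -Complex.I * (τ / 2) * (freqL (b - a) l : ℂ) ^ 2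
  push_cast; ring

theorem GridOf.stage1 (h : GridOf v U) : GridOf (stage1 a b τ v) (free N τ (interpC N U)) := by
  intro j
  rw [free, mult_apply, pull_sum, GPE.stage1]
  refine Finset.sum_congr rfl fun l hl => ?_
  rw [coeff_interpC, if_pos hl, h.coeffTilde_eq, freeSym_eq]

theorem GridOf.nonlin (h : GridOf v U) : GridOf
    (fun j => v j * Complex.exp (-Complex.I * τ * (β * (‖v j‖ : ℂ) ^ 2))) (nonlin β τ U) := by
  intro j
  have e : pull a b (PeriodicSobolev.nonlin β τ U) (node a b N j) = pull a b U (node a b N j)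
      * Complex.exp (-(Complex.I * τ * β) * (pull a b U (node a b N j)
        * conj (pull a b U (node a b N j)))) := rfl
  rw [e, ← h j, Complex.mul_conj']
  change v j * Complex.exp _ = v j * Complex.exp _
  congr 2
  ring

/-- Equality holds only almost everywhere because `V` is known only up to null sets. That is enough:
the next stage sees this function through integrals. -/
theorem GridOf.stage2 {V : ℝ → ℝ} {V' : PerC (b - a)}
    (hV : (fun x => (V x : ℂ)) =ᵐ[vol a b] pull a b V') (h : GridOf v U) :
    stage2 a b β V τ v =ᵐ[vol a b]
      pull a b (cexp ((-(Complex.I * τ)) • V') * interpC N (PeriodicSobolev.nonlin β τ U)) := by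
  filter_upwards [hV] with x hx
  have e : pull a b (cexp ((-(Complex.I * τ)) • V') * interpC N (PeriodicSobolev.nonlin β τ U)) x
      = Complex.exp (-(Complex.I * τ) * pull a b V' x)
        * pull a b (interpC N (PeriodicSobolev.nonlin β τ U)) x := rfl
  rw [e, ← hx, GPE.stage2, h.nonlin.interp_eq, neg_mul]

theorem gridOf_stage3 {w : ℝ → ℂ} (h : w =ᵐ[vol a b] pull a b U) :
    GridOf (stage3 a b τ N w) (free N τ U) := by
  intro j
  rw [free, mult_apply, pull_sum, GPE.stage3]
  refine Finset.sum_congr rfl fun l hl => ?_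
  rw [coeffHat_congr h, coeffHat_pull, freeSym_eq]

/-- The scheme on grid vectors and the scheme on trigonometric polynomials agree. -/
theorem interp_STeFP {V : ℝ → ℝ} {V' : PerC (b - a)} {ψ₀ : ℝ → ℂ} (hN : 0 < N) (hE : Even N)
    (hV : (fun x => (V x : ℂ)) =ᵐ[vol a b] pull a b V') (hψ₀ : EqOn ψ₀ (pull a b U) (Icc a b))
    (n : ℕ) (x : ℝ) : interp a b (STeFP a b β V ψ₀ N τ n) x
      = pull a b (strangSeq V' β N τ (interpC N U) n) x := by
  -- At `n = 0` the grid values come from the initial datum, which need not be a trigonometric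
  -- polynomial. Hence the invariant speaks of some `W` and of its interpolant.
  have key : ∃ W : PerC (b - a), GridOf (STeFP a b β V ψ₀ N τ n) W
      ∧ interpC N W = strangSeq V' β N τ (interpC N U) n := by
    induction n with
    | zero =>
      refine ⟨U, fun j => hψ₀ ?_, rfl⟩
      have hLp := hL.out
      have hN' : (0 : ℝ) < N := by exact_mod_cast hN
      have h1 : node a b N j - a = j * ((b - a) / N) := node_sub a b N j
      have h2 : (j : ℝ) ≤ N := by exact_mod_cast Nat.lt_succ_iff.1 j.2
      have h3 : (j : ℝ) * ((b - a) / N) ≤ N * ((b - a) / N) := by gcongr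
      have h4 : (N : ℝ) * ((b - a) / N) = b - a := by field_simp
      have h5 : 0 ≤ (j : ℝ) * ((b - a) / N) := by positivity
      constructor <;> linarith
    | succ n ih =>
      obtain ⟨W, hW, hWn⟩ := ih
      refine ⟨strangSeq V' β N τ (interpC N U) (n + 1), ?_,
        (supp_strangSeq V' β N τ _ (supp_interpC _) (n + 1)).interpC_eq hN hE⟩
      have h1 := hW.stage1 (τ := τ)
      rw [hWn] at h1
      exact gridOf_stage3 (GridOf.stage2 hV h1)
  obtain ⟨W, hW, hWn⟩ := key
  rw [hW.interp_eq, hWn]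

end GridFunctions

/-! ### Return to the norms on the interval. -/

section Norms

variable {a b : ℝ} [hL : Fact (0 < b - a)]

theorem memLp_pull (U : PerC (b - a)) : MemLp (pull a b U) 2 (vol a b) :=
  MemLp.of_bound (continuous_pull U).aestronglyMeasurable ‖U‖
    (Eventually.of_forall fun _ => U.norm_coe_le_norm _)

/-- The element of `L²(a, b)` given by a continuous periodic function. -/
def toL2 (a b : ℝ) [Fact (0 < b - a)] (U : PerC (b - a)) : L2 a b := (memLp_pull U).toLp

theorem toL2_ae (U : PerC (b - a)) : toL2 a b U =ᵐ[vol a b] pull a b U := (memLp_pull U).coeFn_toLp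

theorem coeffHat_toL2 (U : PerC (b - a)) (l : ℤ) : coeffHat a b (toL2 a b U) l = coeff l U :=
  (coeffHat_congr (toL2_ae U) l).trans (coeffHat_pull U l)

theorem normL2_le {f : ℝ → ℂ} {U : PerC (b - a)} {M : ℝ} (hf : f =ᵐ[vol a b] pull a b U)
    (h : Bd 0 U M) : normL2 a b f ≤ ENNReal.ofReal (√(b - a) * M) := by
  have hM := h.1
  have h1 := norm_le_of_coeffHat (toL2 a b U) (M := M) fun F => by
    simpa [coeffHat_toL2] using (bd_iff.1 h).2 F
  have h2 : ‖toL2 a b U‖ ≤ √(b - a) * M := by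
    refine (sq_le_sq₀ (norm_nonneg _) (by positivity)).1 ?_
    rwa [mul_pow, Real.sq_sqrt hL.out.le]
  have h3 : normL2 a b f = ‖toL2 a b U‖ₑ := by
    rw [normL2, Lp.enorm_def]
    exact eLpNorm_congr_ae (hf.trans (toL2_ae U).symm)
  rw [h3, ← ofReal_norm]
  exact ENNReal.ofReal_le_ofReal h2

theorem hasDerivAt_mode (l : ℤ) (x : ℝ) :
    HasDerivAt (mode a b l) (Complex.I * GPE.μ a b l * mode a b l x) x := by
  have h : HasDerivAt (fun x : ℝ => Complex.I * GPE.μ a b l * ((x : ℂ) - a))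
      (Complex.I * GPE.μ a b l) x := by
    simpa using ((HasDerivAt.ofReal_comp (hasDerivAt_id x)).sub_const (a : ℂ)).const_mul
      (Complex.I * GPE.μ a b l)
  exact h.cexp.congr_deriv (mul_comm _ _)

/-- A trigonometric polynomial is differentiated classically, term by term, which supplies its weak
derivative. -/
theorem exists_jet_of_supp {S : Finset ℤ} {U : PerC (b - a)} (h : Supp S U) :
    ∃ j ∈ H a b 1, j 0 =ᵐ[vol a b] pull a b U ∧ JetOf 1 U j := by
  set U' : PerC (b - a) := mult S (fun l => Complex.I * GPE.μ a b l) U with hU'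
  have hd : ∀ x, HasDerivAt (pull a b U) (pull a b U' x) x := by
    intro x
    have e1 : pull a b U = fun x => ∑ l ∈ S, coeff l U * mode a b l x := by
      funext x
      conv_lhs => rw [h.eq_sum]
      exact pull_sum S _ x
    rw [e1, hU', mult_apply, pull_sum]
    refine HasDerivAt.fun_sum fun l _ => ?_
    refine ((hasDerivAt_mode l x).const_mul (coeff l U)).congr_deriv ?_
    ring
  have hw := GPE.IsWeakDeriv.of_hasDerivAt (lt_of_fact (a := a) (b := b)) hd (continuous_pull U')
  refine ⟨WithLp.toLp 2 ![toL2 a b U, toL2 a b U'], fun k => ?_, toL2_ae U, fun k l => ?_⟩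
  · fin_cases k
    · exact isWeakDeriv_zero _
    · exact hw.congr (toL2_ae U) (toL2_ae U')
  · fin_cases k
    · exact (coeffHat_toL2 U l).trans (by simp)
    · refine (coeffHat_toL2 U' l).trans ?_
      rw [hU', coeff_mult]
      split_ifs with hl
      · simp
      · rw [h l hl, mul_zero]

theorem exists_jet_of_mem_hPer {g : Jet a b 2} (hg : g ∈ HPer a b 2) {U : PerC (b - a)}
    (hU : g 0 =ᵐ[vol a b] pull a b U) :
    ∃ j ∈ H a b 1, j 0 =ᵐ[vol a b] pull a b U ∧ JetOf 1 U j := by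
  have h := jetOf_of_mem_hPer hg hU
  refine ⟨WithLp.toLp 2 ![g 0, g 1], fun k => ?_, hU, fun k l => ?_⟩
  · fin_cases k
    · exact hg.1 0
    · exact hg.1 1
  · fin_cases k
    · exact h 0 l
    · exact h 1 l

/-- The constant in the comparison of the two `H¹` norms. -/
def normConst (L : ℝ) : ℝ := √(L * (1 + (2 * Real.pi / L) ^ 2))

theorem JetOf.norm_le {U : PerC (b - a)} {j : Jet a b 1} (hj : JetOf 1 U j) {M : ℝ}
    (h : Bd 1 U M) : ‖j‖ ≤ normConst (b - a) * M := by
  have hM := h.1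
  have hLp := hL.out
  have h0 := norm_le_of_coeffHat (j 0) (M := M) fun F => by
    have := (bd_iff.1 (h.lower zero_le_one)).2 F
    refine le_trans (le_of_eq (Finset.sum_congr rfl fun l _ => ?_)) this
    rw [hj 0 l]; simp
  have h1 := norm_le_of_coeffHat (j 1) (M := 2 * Real.pi / (b - a) * M) fun F => by
    have := (bd_iff.1 h).2 F
    rw [mul_pow]
    refine le_trans ?_ (mul_le_mul_of_nonneg_left this (sq_nonneg _))
    rw [Finset.mul_sum]
    refine Finset.sum_le_sum fun l _ => ?_
    have e : ‖coeffHat a b (j 1) l‖ ^ 2 = freqL (b - a) l ^ 2 * ‖coeff l U‖ ^ 2 := by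
      rw [hj 1 l]
      simp only [Fin.val_one, pow_one, norm_mul, Complex.norm_I, one_mul, Complex.norm_real,
        mul_pow, Real.norm_eq_abs, sq_abs]
      rfl
    rw [e, mul_pow, ← mul_assoc, pow_one]
    exact mul_le_mul_of_nonneg_right (freqL_sq_le l) (sq_nonneg _)
  refine (sq_le_sq₀ (norm_nonneg _) (mul_nonneg (Real.sqrt_nonneg _) hM)).1 ?_
  rw [mul_pow, Real.sq_sqrt (by positivity), PiLp.norm_sq_eq_of_L2, Fin.sum_univ_two]
  refine (add_le_add h0 h1).trans (le_of_eq ?_)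
  ring

/-- The norm is an infimum over jets, so one jet suffices: the first derivatives of the exact
solution minus those of the trigonometric polynomial. -/
theorem normH1_le {f : ℝ → ℂ} {U W : PerC (b - a)} {g : Jet a b 2} (hg : g ∈ HPer a b 2)
    (hU : g 0 =ᵐ[vol a b] pull a b U) {S : Finset ℤ} (hW : Supp S W)
    (hf : f =ᵐ[vol a b] pull a b (U - W)) {M : ℝ} (h : Bd 1 (U - W) M) :
    normH1 a b f ≤ ENNReal.ofReal (normConst (b - a) * M) := by
  obtain ⟨j, hj, hjU, hj'⟩ := exists_jet_of_mem_hPer hg hU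
  obtain ⟨i, hi, hiW, hi'⟩ := exists_jet_of_supp hW
  have h1 := (hj'.sub hi').norm_le h
  refine (iInf₂_le (⟨j - i, sub_mem hj hi⟩ : H a b 1) ?_).trans ?_
  · have e : (j - i) 0 =ᵐ[vol a b] fun x => j 0 x - i 0 x := Lp.coeFn_sub (j 0) (i 0)
    refine e.trans ?_
    filter_upwards [hjU, hiW, hf] with x h1 h2 h3
    rw [h1, h2, h3]; rfl
  · rw [← ofReal_norm]
    exact ENNReal.ofReal_le_ofReal h1

end Norms

/-! ### Error bounds for the original scheme. -/

section ErrorBounds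

variable {a b : ℝ} [hL : Fact (0 < b - a)] {T β : ℝ} {V : ℝ → ℝ} {ψ₀ : ℝ → ℂ} {ψ : ℝ → ℝ → ℂ}
  {V' : PerC (b - a)} {u : ℝ → PerC (b - a)}

theorem adm_of_admissible {h₀ τ : ℝ} {N n : ℕ} (h : Admissible a b T h₀ N τ n) :
    Adm (b - a) T N τ n :=
  ⟨h.1, h.2.1, h.2.2.2.1, h.2.2.2.2.1, h.2.2.2.2.2⟩

/-- Both sides are continuous, so equality almost everywhere becomes equality on all of `[a, b]`.
Pointwise equality matters because the scheme starts from nodal values. -/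
theorem eqOn_of_isSolution (hT : 0 < T) (hsol : IsSolution a b T β V ψ₀ ψ)
    (hψ₀ : ContinuousOn ψ₀ (Icc a b)) (hu : ∀ t ∈ Icc 0 T, ψ t =ᵐ[vol a b] pull a b (u t)) :
    EqOn ψ₀ (pull a b (u 0)) (Icc a b) := by
  have hab : a < b := lt_of_fact
  refine Measure.eqOn_Icc_of_ae_eq volume hab.ne ?_ hψ₀ (continuous_pull _).continuousOn
  rw [← Measure.restrict_congr_set Ioo_ae_eq_Icc]
  have h0 := hu 0 ⟨le_rfl, hT.le⟩
  filter_upwards [h0, ae_restrict_mem measurableSet_Ioo] with x hx hx'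
  rw [← hx, hsol.initial x (Ioo_subset_Icc_self hx')]

theorem error_ae (hT : 0 < T) (hsol : IsSolution a b T β V ψ₀ ψ)
    (hψ₀ : ContinuousOn ψ₀ (Icc a b)) (hu : ∀ t ∈ Icc 0 T, ψ t =ᵐ[vol a b] pull a b (u t))
    (hV : (fun x => (V x : ℂ)) =ᵐ[vol a b] pull a b V') {N n : ℕ} {τ : ℝ}
    (hA : Adm (b - a) T N τ n) : error a b β V ψ₀ ψ N τ n =ᵐ[vol a b]
      pull a b (u (n * τ) - strangSeq V' β N τ (interpC N (u 0)) n) := by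
  filter_upwards [hu _ hA.mem] with x hx
  rw [error, hx, interp_STeFP hA.N_pos hA.even hV (eqOn_of_isSolution hT hsol hψ₀ hu)]
  rfl

theorem normL2_error_le (hT : 0 < T) (hsol : IsSolution a b T β V ψ₀ ψ)
    (hψ₀ : ContinuousOn ψ₀ (Icc a b)) (hu : ∀ t ∈ Icc 0 T, ψ t =ᵐ[vol a b] pull a b (u t))
    (hV : (fun x => (V x : ℂ)) =ᵐ[vol a b] pull a b V') {N n : ℕ} {τ : ℝ}
    (hA : Adm (b - a) T N τ n) {M : ℝ}
    (h : Bd 0 (u (n * τ) - strangSeq V' β N τ (interpC N (u 0)) n) M) :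
    normL2 a b (error a b β V ψ₀ ψ N τ n) ≤ ENNReal.ofReal (√(b - a) * M) :=
  normL2_le (error_ae hT hsol hψ₀ hu hV hA) h

theorem normH1_error_le (hT : 0 < T) (hsol : IsSolution a b T β V ψ₀ ψ)
    (hψ₀ : ContinuousOn ψ₀ (Icc a b)) (hu : ∀ t ∈ Icc 0 T, ψ t =ᵐ[vol a b] pull a b (u t))
    (hV : (fun x => (V x : ℂ)) =ᵐ[vol a b] pull a b V') {N n : ℕ} {τ : ℝ}
    (hA : Adm (b - a) T N τ n) {M : ℝ}
    (h : Bd 1 (u (n * τ) - strangSeq V' β N τ (interpC N (u 0)) n) M) :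
    normH1 a b (error a b β V ψ₀ ψ N τ n) ≤ ENNReal.ofReal (normConst (b - a) * M) := by
  obtain ⟨Ψ, Ψt, hΨ⟩ := hsol.equation
  exact normH1_le (Ψ (n * τ)).2 ((hΨ _ hA.mem).1.trans (hu _ hA.mem))
    (supp_strangSeq V' β N τ _ (supp_interpC _) n) (error_ae hT hsol hψ₀ hu hV hA) h

end ErrorBounds

end PeriodicSobolev

end

/-! ### The main theorem. -/

theorem theorem3p2 (a b T β : ℝ) (hab : a < b) (hT : 0 < T)
    (V : ℝ → ℝ) (ψ₀ : ℝ → ℂ) (ψ : ℝ → ℝ → ℂ)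
    (hψ₀ : ContinuousOn ψ₀ (Set.Icc a b))
    (hsol : GPE.IsSolution a b T β V ψ₀ ψ)
    (hV : GPE.MemSpace (GPE.HPer a b 2) (fun x => (V x : ℂ)))
    (hψ_0 : GPE.MemC T 0 (GPE.HPer a b 4) ψ)
    (hψ_1 : GPE.MemC T 1 (GPE.H a b 2) ψ)
    (hψ_2 : GPE.MemC T 2 (GPE.H a b 0) ψ) :
    ∃ h₀ : ℝ, 0 < h₀ ∧
      (∃ C : ℝ, 0 < C ∧ ∀ (N : ℕ) (τ : ℝ) (n : ℕ), GPE.Admissible a b T h₀ N τ n →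
        GPE.normL2 a b (GPE.error a b β V ψ₀ ψ N τ n)
            ≤ ENNReal.ofReal (C * (τ ^ 2 + GPE.mesh a b N ^ 4)) ∧
        GPE.normH1 a b (GPE.error a b β V ψ₀ ψ N τ n)
            ≤ ENNReal.ofReal (C * (τ ^ (3 / 2 : ℝ) + GPE.mesh a b N ^ 3))) ∧
      (GPE.MemSpace (GPE.HPer a b 3) (fun x => (V x : ℂ)) →
        GPE.MemC T 0 (GPE.HPer a b 5) ψ →
        GPE.MemC T 1 (GPE.H a b 3) ψ →
        GPE.MemC T 2 (GPE.H a b 1) ψ →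
        ∃ C : ℝ, 0 < C ∧ ∀ (N : ℕ) (τ : ℝ) (n : ℕ), GPE.Admissible a b T h₀ N τ n →
          GPE.normH1 a b (GPE.error a b β V ψ₀ ψ N τ n)
            ≤ ENNReal.ofReal (C * (τ ^ 2 + GPE.mesh a b N ^ 4))) := by
  have : Fact (0 < b - a) := ⟨sub_pos.2 hab⟩
  obtain ⟨gV, hgV, hgV'⟩ := hV
  obtain ⟨V', hgV''⟩ := PeriodicSobolev.exists_rep two_pos hgV
  have hVV := hgV'.symm.trans hgV''
  have hrep : ∀ t, ∃ U, t ∈ Set.Icc 0 T → ψ t =ᵐ[GPE.vol a b] PeriodicSobolev.pull a b U := by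
    obtain ⟨Ψ, -, hΨ⟩ := hψ_0
    intro t
    by_cases ht : t ∈ Set.Icc 0 T
    · obtain ⟨U, hU⟩ := PeriodicSobolev.exists_rep four_pos (Ψ t).2
      exact ⟨U, fun _ => (hΨ t ht).symm.trans hU⟩
    · exact ⟨0, fun h => absurd h ht⟩
  choose u hu using hrep
  have D₀ : PeriodicSobolev.TimeData T β 0 V' u :=
    PeriodicSobolev.timeData_of_isSolution hT hsol hVV hu ⟨gV, hgV, hgV'⟩ hψ_0 hψ_1 hψ_2
  -- The threshold and the `H¹` bound come from the weaker regularity alone, so the same `h₀` serves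
  -- both parts.
  obtain ⟨h₀, K, hh₀, hK⟩ := PeriodicSobolev.strangSeq_bounded D₀
  have hbd : ∀ (N : ℕ) (τ : ℝ) (n : ℕ), GPE.Admissible a b T h₀ N τ n → ∀ m < n,
      PeriodicSobolev.Bd 1 (PeriodicSobolev.strangSeq V' β N τ
        (PeriodicSobolev.interpC N (u 0)) m) K := fun N τ n hA m hm =>
    hK N τ m ((PeriodicSobolev.adm_of_admissible hA).mono hm.le) hA.2.2.1
  have hLp : 0 < b - a := sub_pos.2 hab
  have hnc : 0 ≤ PeriodicSobolev.normConst (b - a) := Real.sqrt_nonneg _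
  refine ⟨h₀, hh₀, ?_, fun hV3 h0 h1 h2 => ?_⟩
  · obtain ⟨C₀, hC₀, c0⟩ := PeriodicSobolev.convergence D₀ zero_le_one K
    obtain ⟨C₁, hC₁, c1⟩ := PeriodicSobolev.convergence_one_of_zero D₀ K
    refine ⟨√(b - a) * C₀ + PeriodicSobolev.normConst (b - a) * C₁ + 1, by positivity,
      fun N τ n hA => ?_⟩
    have hA' := PeriodicSobolev.adm_of_admissible hA
    have hτ := hA'.τ_pos
    have hm : 0 ≤ GPE.mesh a b N := div_nonneg hLp.le (Nat.cast_nonneg N)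
    have e0 := PeriodicSobolev.normL2_error_le hT hsol hψ₀ hu hVV hA' (c0 N τ n hA' (hbd N τ n hA))
    have e1 := PeriodicSobolev.normH1_error_le hT hsol hψ₀ hu hVV hA' (c1 N τ n hA' (hbd N τ n hA))
    refine ⟨e0.trans (ENNReal.ofReal_le_ofReal ?_), e1.trans (ENNReal.ofReal_le_ofReal ?_)⟩
    · change √(b - a) * (C₀ * GPE.mesh a b N ^ 4) ≤ _
      rw [← mul_assoc]
      gcongr
      · have : 0 ≤ PeriodicSobolev.normConst (b - a) * C₁ := by positivity
        linarith
      -- The estimate obtained is in powers of `h` only; the power of `τ` is a nonnegative extra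
      -- term.
      · exact le_add_of_nonneg_left (by positivity)
    · change PeriodicSobolev.normConst (b - a) * (C₁ * GPE.mesh a b N ^ 3) ≤ _
      rw [← mul_assoc]
      gcongr
      · have : 0 ≤ √(b - a) * C₀ := by positivity
        linarith
      · exact le_add_of_nonneg_left (by positivity)
  · have D₁ : PeriodicSobolev.TimeData T β 1 V' u :=
      PeriodicSobolev.timeData_of_isSolution hT hsol hVV hu hV3 h0 h1 h2
    obtain ⟨C₁, hC₁, c1⟩ := PeriodicSobolev.convergence D₁ le_rfl K
    refine ⟨PeriodicSobolev.normConst (b - a) * C₁ + 1, by positivity, fun N τ n hA => ?_⟩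
    have hA' := PeriodicSobolev.adm_of_admissible hA
    have hτ := hA'.τ_pos
    have hm : 0 ≤ GPE.mesh a b N := div_nonneg hLp.le (Nat.cast_nonneg N)
    have e1 := PeriodicSobolev.normH1_error_le hT hsol hψ₀ hu hVV hA' (c1 N τ n hA' (hbd N τ n hA))
    refine e1.trans (ENNReal.ofReal_le_ofReal ?_)
    change PeriodicSobolev.normConst (b - a) * (C₁ * GPE.mesh a b N ^ 4) ≤ _
    rw [← mul_assoc]
    gcongr
    · linarith
    · exact le_add_of_nonneg_left (by positivity)
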